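/- Let $K$ be a field of characteristic $0$ with algebraic closure $\overline K$, let $n,\alpha\ge 1$, $d=n\alpha$, and let $f\in K[x_1,\dots,x_n]$ be homogeneous of degree $d$ (possibly $0$), given by a black box which returns $f(x)$ on input $x\in K^n$. The Lie algebra of $f$ is $$\mathfrak g_f=\Big\{(a_{ij})\in M_n(K):\ \sum_{i,j}a_{ij}\,x_j\,\frac{\partial f}{\partial x_i}=0\Big\}.$$ Consider the following randomized algorithm, which draws its random field elements independently and uniformly from a finite set $S\subseteq K$. 1. Compute a basis $B_1,\dots,B_k$ of $\mathfrak g_f$: compute the values of the $n^2$ polynomials $x_j\,\partial f/\partial x_i$ at $n^2$ random points of $S^n$ (each partial derivative being obtained by interpolation from $d+1$ values of $f$ on a line parallel to an axis), and take a basis of the space of linear relations satisfied by these values. 2. Reject if $k\ne n-1$. 3. Reject unless the matrices $B_1,\dots,B_{n-1}$ pairwise commute, are all diagonalizable over $\overline K$, and have trace zero (diagonalizability is tested by checking that the minimal polynomial is coprime to its derivative). Otherwise declare that $f$ has a factorization $f=(l_1\cdots l_n)^\alpha$ with linearly independent linear forms $l_i$ over $\overline K$. 4. Simultaneously diagonalize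 the $B_i$, by computing an invertible matrix $A$ over $\overline K$ which diagonalizes a random linear combination $R=\sum_i t_iB_i$: the rows of $A$ form bases of the left eigenspaces of $R$. 5. Let $m=(x_1\cdots x_n)^\alpha$. Compute $\lambda=f(p)/m(Ap)$ at a random point $p\in S^n$, multiply the first row of $A$ by an $\alpha$-th root of $\lambda$, and output the linear forms $l_1,\dots,l_n$ given by the rows of the resulting matrix. The running time is the number of random draws plus the number of executed instructions: arithmetic operations and zero tests in $K$ and $\overline K$, loading the constants $0,1$, viewing an element of $K$ in $\overline K$, calls to the black box, computing the eigenvalues in $\overline K$ of an $n\times n$ matrix over $K$, and extracting a root in $\overline K$; each of them is charged one unit. **Theorem.** There are absolute constants $C,c\in\mathbb N$ (independent of $K$, $n$, $\alpha$, $f$ and $S$) such that the following holds for all such $K,n,\alpha,f$. * (Polynomial time) For every outcome of the random choices, the running time is at most $C(n+d)^c$, and at most one eigenvalue computation and at most one root extraction are performed. * (Correctness) For every $\varepsilon>0$ and every finite $S\subseteq K$ with $|S|\ge C(n+d)^c/\varepsilon$, the following holds with probability at least $1-\varepsilon$: if $f$ can be written as $f=(l_1\cdots l_n)^\alpha$ with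 linearly independent linear forms $l_1,\dots,l_n$ over $\overline K$, the algorithm outputs such a factorization, and otherwise it rejects. -/

import Mathlib

universe u v w

namespace LinFact

/-!
### The machine model

Arithmetic algorithms with a black box, in the style of algebraic computation trees.
There are two sorts of values, elements of the base field `K` and elements of its algebraic
closure.  A program is written for *arbitrary types* `X .base` and `X .ext` of values, on which
no operation whatsoever is available: values can only be combined, compared or used through the
instructions below, each of which is charged one time unit.  As usual in arithmetic complexity, the
bookkeeping on indices and lists, which involves no field element, is not charged.
-/

/-- The two sorts of values: base field, and algebraic closure of the base field. -/
inductive Srt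
  | base
  | ext

/-- The binary arithmetic operations. -/
inductive Op
  | add
  | sub
  | mul
  | div

/-- A program with values in `X`, using a black box for a function of `n` variables over the base
field, and returning a result of type `α`.  Apart from returning (`ret`), which is free, an
instruction is one of
* `const s b k`: load the constant `1` (if `b` is true) or `0` (if `b` is false);
* `arith s o x y k`: an addition, subtraction, multiplication or division;
* `ifZero s x p q`: continue with `p` if `x = 0`, and with `q` otherwise;
* `lift x k`: view an element of the base field as an element of its closure;
* `query x k`: call the black box at a point with coordinates in the base field;
* `eigenvalues M k`: compute the list of the eigenvalues, in the closure and with multiplicity, of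
  an `n × n` matrix over the base field;
* `root r x k`: extract an `r`-th root in the closure. -/
inductive Prog (X : Srt → Type u) (n : ℕ) (α : Type v) : Type (max u v)
  | ret (a : α) : Prog X n α
  | const (s : Srt) (b : Bool) (k : X s → Prog X n α) : Prog X n α
  | arith (s : Srt) (o : Op) (x y : X s) (k : X s → Prog X n α) : Prog X n α
  | ifZero (s : Srt) (x : X s) (p q : Prog X n α) : Prog X n α
  | lift (x : X .base) (k : X .ext → Prog X n α) : Prog X n α
  | query (x : Fin n → X .base) (k : X .base → Prog X n α) : Prog X n α
  | eigenvalues (M : Fin n → Fin n → X .base) (k : List (X .ext) → Prog X n α) : Prog X n α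
  | root (r : ℕ) (x : X .ext) (k : X .ext → Prog X n α) : Prog X n α

namespace Prog

/-- Sequential composition. -/
def bind {X : Srt → Type u} {n : ℕ} {α : Type v} {β : Type w} :
    Prog X n α → (α → Prog X n β) → Prog X n β
  | ret a, h => h a
  | const s b k, h => const s b fun y => (k y).bind h
  | arith s o x y k, h => arith s o x y fun z => (k z).bind h
  | ifZero s x p q, h => ifZero s x (p.bind h) (q.bind h)
  | lift x k, h => lift x fun y => (k y).bind h
  | query x k, h => query x fun y => (k y).bind h
  | eigenvalues M k, h => eigenvalues M fun y => (k y).bind h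
  | root r x k, h => root r x fun y => (k y).bind h

instance {X : Srt → Type u} {n : ℕ} : Monad (Prog.{u, u} X n) where
  pure := ret
  bind := bind

end Prog

/-! ### Semantics and cost -/

/-- The values of the two sorts: `K` and `L`. -/
@[reducible] def Val (K L : Type u) : Srt → Type u
  | .base => K
  | .ext => L

instance Val.instField (K L : Type u) [Field K] [Field L] : (s : Srt) → Field (Val K L s)
  | .base => inferInstanceAs (Field K)
  | .ext => inferInstanceAs (Field L)

/-- The meaning of an arithmetic operation (division by `0` returns `0`). -/
def Op.eval {F : Type u} [Field F] : Op → F → F → F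
  | .add, x, y => x + y
  | .sub, x, y => x - y
  | .mul, x, y => x * y
  | .div, x, y => x / y

/-- The kinds of instructions. -/
inductive Kind
  | const
  | arith
  | test
  | lift
  | query
  | eigenvalues
  | root
  deriving DecidableEq

section Semantics

variable {K L : Type u} [Field K] [Field L] [Algebra K L]

/-- The eigenvalues in `L` of a matrix over `K`, listed with multiplicity in some order. -/
noncomputable def eigenvalueList (L : Type u) [Field L] [Algebra K L] {n : ℕ}
    (M : Fin n → Fin n → K) : List L :=
  ((Matrix.of M).map (algebraMap K L)).charpoly.roots.toList

/-- Some `r`-th root of `x` (and `0` if there is none). -/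
noncomputable def someRoot (r : ℕ) (x : L) : L :=
  (Polynomial.nthRoots r x).toList.headD 0

open Classical in
/-- The result of running a program over `K` and `L` with black box `f`. -/
noncomputable def Prog.eval {n : ℕ} (f : (Fin n → K) → K) {α : Type v} :
    Prog (Val K L) n α → α
  | .ret a => a
  | .const _ b k => (k (if b then 1 else 0)).eval f
  | .arith _ o x y k => (k (o.eval x y)).eval f
  | .ifZero _ x p q => if x = 0 then p.eval f else q.eval f
  | .lift x k => (k (algebraMap K L x)).eval f
  | .query x k => (k (f x)).eval f
  | .eigenvalues M k => (k (eigenvalueList L M)).eval f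
  | .root r x k => (k (someRoot r x)).eval f

open Classical in
/-- The total cost of the instructions executed when a program is run over `K` and `L` with black
box `f`, if an instruction of kind `i` is charged `c i`. -/
noncomputable def Prog.cost {n : ℕ} (f : (Fin n → K) → K) (c : Kind → ℕ) {α : Type v} :
    Prog (Val K L) n α → ℕ
  | .ret _ => 0
  | .const _ b k => c .const + (k (if b then 1 else 0)).cost f c
  | .arith _ o x y k => c .arith + (k (o.eval x y)).cost f c
  | .ifZero _ x p q => c .test + if x = 0 then p.cost f c else q.cost f c
  | .lift x k => c .lift + (k (algebraMap K L x)).cost f c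
  | .query x k => c .query + (k (f x)).cost f c
  | .eigenvalues M k => c .eigenvalues + (k (eigenvalueList L M)).cost f c
  | .root r x k => c .root + (k (someRoot r x)).cost f c

/-- The number of all executed instructions. -/
noncomputable def Prog.time {n : ℕ} (f : (Fin n → K) → K) {α : Type v}
    (p : Prog (Val K L) n α) : ℕ :=
  p.cost f fun _ => 1

/-- The number of executed instructions of kind `i`. -/
noncomputable def Prog.count {n : ℕ} (f : (Fin n → K) → K) (i : Kind) {α : Type v}
    (p : Prog (Val K L) n α) : ℕ :=
  p.cost f fun j => if j = i then 1 else 0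

end Semantics

/-! ### Basic routines -/

section Routines

variable {X : Srt → Type u} {n : ℕ} {s : Srt}

/-- Load `0`. -/
def zero : Prog X n (X s) := .const s false .ret

/-- Load `1`. -/
def one : Prog X n (X s) := .const s true .ret

/-- One arithmetic operation. -/
def op (o : Op) (x y : X s) : Prog X n (X s) := .arith s o x y .ret

/-- View an element of the base field in the closure. -/
def toExt (x : X .base) : Prog X n (X .ext) := .lift x .ret

/-- Call the black box. -/
def blackBox (x : Fin n → X .base) : Prog X n (X .base) := .query x .ret

/-- Run a program for every index below `m` and collect the results. -/
def tabulate {β : Type u} : (m : ℕ) → (Fin m → Prog X n β) → Prog X n (Fin m → β)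
  | 0, _ => .ret Fin.elim0
  | m + 1, g => do
    let b ← g 0
    let t ← tabulate m fun i => g i.succ
    .ret (Fin.cons b t)

/-- Run a program for every element of a list and collect the results. -/
def traverse {ι : Type v} {β : Type u} (g : ι → Prog X n β) : List ι → Prog X n (List β)
  | [] => .ret []
  | a :: as => do
    let b ← g a
    let bs ← traverse g as
    .ret (b :: bs)

/-- Sum of a list. -/
def sum : List (X s) → Prog X n (X s)
  | [] => zero
  | x :: xs => do
    let t ← sum xs
    op .add x t

/-- Product of a list. -/
def prod : List (X s) → Prog X n (X s)
  | [] => one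
  | x :: xs => do
    let t ← prod xs
    op .mul x t

/-- The natural number `k`, as a value. -/
def natural : ℕ → Prog X n (X s)
  | 0 => zero
  | k + 1 => do
    let t ← natural k
    let o ← one
    op .add t o

/-- The power `x ^ k`. -/
def power (x : X s) (k : ℕ) : Prog X n (X s) := prod (List.replicate k x)

/-- Continue with `p` if all elements of a list are `0`, and with `q` otherwise. -/
def ifAllZero {β : Type u} (p q : Prog X n β) : List (X s) → Prog X n β
  | [] => p
  | x :: xs => .ifZero s x (ifAllZero p q xs) q

/-- Continue with `p` if `x` is in the list, and with `q` otherwise. -/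
def ifMem {β : Type u} (p q : Prog X n β) (x : X s) : List (X s) → Prog X n β
  | [] => q
  | y :: ys => do
    let t ← op .sub x y
    .ifZero s t p (ifMem p q x ys)

/-- Remove repetitions from a list. -/
def distinct : List (X s) → Prog X n (List (X s))
  | [] => .ret []
  | x :: xs => do
    let ys ← distinct xs
    ifMem (.ret ys) (.ret (x :: ys)) x ys

/-- `∑ i, a i * b i`. -/
def dot {m : ℕ} (a b : Fin m → X s) : Prog X n (X s) := do
  let t ← tabulate m fun i => op .mul (a i) (b i)
  sum (List.ofFn t)

/-- The identity matrix. -/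
def identity (m : ℕ) : Prog X n (Fin m → Fin m → X s) := do
  let z ← zero
  let o ← one
  .ret fun i j => if i = j then o else z

/-- The product of two square matrices. -/
def matMul {m : ℕ} (A B : Fin m → Fin m → X s) : Prog X n (Fin m → Fin m → X s) :=
  tabulate m fun i => tabulate m fun j => dot (A i) fun k => B k j

/-- The power `A ^ k` of a square matrix. -/
def matPow {m : ℕ} (A : Fin m → Fin m → X s) : ℕ → Prog X n (Fin m → Fin m → X s)
  | 0 => identity m
  | k + 1 => do
    let P ← matPow A k
    matMul A P

/-- The list of the entries of a square matrix. -/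
def entries {m : ℕ} {β : Type u} (A : Fin m → Fin m → β) : List β :=
  List.ofFn fun p : Fin (m * m) => A (finProdFinEquiv.symm p).1 (finProdFinEquiv.symm p).2

/-- One step of Gaussian elimination: from a basis of a subspace, compute a basis of the
intersection of that subspace with the hyperplane `r · x = 0`.  The first basis vector `b` with
`r · b ≠ 0` (if any) is dropped, and a multiple of it is subtracted from the later ones. -/
def eliminate {m : ℕ} (r : Fin m → X s) :
    List (Fin m → X s) → Prog X n (List (Fin m → X s))
  | [] => .ret []
  | b :: bs => do
    let c ← dot r b
    .ifZero s c
      (do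
        let t ← eliminate r bs
        .ret (b :: t))
      (traverse
        (fun b' => do
          let c' ← dot r b'
          let q ← op .div c' c
          tabulate m fun i => do
            let y ← op .mul q (b i)
            op .sub (b' i) y)
        bs)

/-- A basis of the space of the solutions `x` of the linear equations `r · x = 0`, where `r` runs
through a list of rows of length `m`. -/
def kernel (m : ℕ) : List (Fin m → X s) → Prog X n (List (Fin m → X s))
  | [] => do
    let E ← identity m
    .ret (List.ofFn E)
  | r :: rs => do
    let B ← kernel m rs
    eliminate r B

end Routines

/-! ### Step 1: a basis of the Lie algebra of `f`

The Lie algebra of `f` is the space of the matrices `(a i j)` such that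
`∑ i, ∑ j, a i j * x j * ∂f/∂x i = 0`.  It is computed as the space of the matrices that satisfy this
equation at `n ^ 2` random points; the partial derivatives are computed by interpolation on lines
parallel to the axes.
-/

section Algorithm

variable {X : Srt → Type u} {n : ℕ}

/-- The weight `(1 / k) * ∏ j / (j - k)`, over `1 ≤ j ≤ d` with `j ≠ k`.  The derivative at `0` of a
univariate polynomial `g` of degree at most `d` is the sum over `1 ≤ k ≤ d` of the products of these
weights with `g k - g 0`. -/
def weight (d k : ℕ) : Prog X n (X .base) := do
  let a ← natural k
  let ts ← traverse
    (fun j : ℕ => do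
      let b ← natural j
      let e ← op .sub b a
      op .div b e)
    ((List.range' 1 d).filter fun j => j ≠ k)
  let p ← prod ts
  op .div p a

/-- The partial derivative of `f` with respect to the `i`-th variable at the point `a`, for `f` of
degree at most `d`, from `d + 1` calls to the black box. -/
def partialDeriv (d : ℕ) (a : Fin n → X .base) (i : Fin n) : Prog X n (X .base) := do
  let y₀ ← blackBox a
  let ts ← traverse
    (fun k : ℕ => do
      let t ← natural k
      let b ← op .add (a i) t
      let y ← blackBox (Function.update a i b)
      let z ← op .sub y y₀
      let c ← weight d k
      op .mul c z)
    (List.range' 1 d)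
  sum ts

/-- The values at the point `a` of the `n ^ 2` polynomials `x j * ∂f/∂x i`. -/
def lieRow (d : ℕ) (a : Fin n → X .base) : Prog X n (Fin (n * n) → X .base) := do
  let D ← tabulate n fun i => partialDeriv d a i
  tabulate (n * n) fun e =>
    op .mul (a (finProdFinEquiv.symm e).2) (D (finProdFinEquiv.symm e).1)

/-- Step 1: a basis of the Lie algebra of `f`, from `n ^ 2` (random) points. -/
def lieBasis (d : ℕ) (pts : Fin (n * n) → Fin n → X .base) :
    Prog X n (List (Fin n → Fin n → X .base)) := do
  let rows ← tabulate (n * n) fun p => lieRow d (pts p)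
  let B ← kernel (n * n) (List.ofFn rows)
  .ret (B.map fun b i j => b (finProdFinEquiv (i, j)))

/-! ### Steps 2 and 3: the decision -/

/-- The coefficients `c 0, …, c k` of the polynomials `c` of degree at most `k` with `c(M) = 0`
(a basis of the space of these polynomials). -/
def annihilators (M : Fin n → Fin n → X .base) (k : ℕ) :
    Prog X n (List (Fin (k + 1) → X .base)) := do
  let P ← tabulate (k + 1) fun e => matPow M e
  kernel (k + 1) (List.ofFn fun p : Fin (n * n) =>
    fun e => P e (finProdFinEquiv.symm p).1 (finProdFinEquiv.symm p).2)

/-- The matrix `c'(M)`, where `c'` is the derivative of the polynomial with coefficients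
`c 0, …, c k`. -/
def derivAt (M : Fin n → Fin n → X .base) (k : ℕ) (c : Fin (k + 1) → X .base) :
    Prog X n (Fin n → Fin n → X .base) := do
  let P ← tabulate k fun e => matPow M e
  let q ← tabulate k fun e => do
    let t ← natural (e + 1)
    op .mul t (c e.succ)
  tabulate n fun i => tabulate n fun j => dot q fun e => P e i j

/-- Search for the minimal polynomial `μ` of `M` (up to a constant factor) in degrees
`k, k + 1, …`, and return a basis of the kernel of `μ'(M)`. -/
def defectFrom (M : Fin n → Fin n → X .base) :
    (fuel k : ℕ) → Prog X n (List (Fin n → X .base))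
  | 0, _ => .ret []
  | fuel + 1, k => do
    let A ← annihilators M k
    match A with
    | [] => defectFrom M fuel (k + 1)
    | c :: _ => do
      let D ← derivAt M k c
      kernel n (List.ofFn D)

/-- A basis of the kernel of `μ'(M)`, where `μ` is the minimal polynomial of `M`.  It is empty if and
only if `μ` and `μ'` are coprime, that is, if and only if `M` is diagonalizable over the algebraic
closure. -/
def defect (M : Fin n → Fin n → X .base) : Prog X n (List (Fin n → X .base)) :=
  defectFrom M (n + 1) 0

/-- The entries of `A * B - B * A`. -/
def commutator (A B : Fin n → Fin n → X .base) : Prog X n (List (X .base)) := do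
  let P ← matMul A B
  let Q ← matMul B A
  let D ← tabulate n fun i => tabulate n fun j => op .sub (P i j) (Q i j)
  .ret (entries D)

/-- The trace of `A`. -/
def trace (A : Fin n → Fin n → X .base) : Prog X n (X .base) :=
  sum (List.ofFn fun i => A i i)

/-- Steps 1, 2 and 3: compute a basis of the Lie algebra of `f`; reject (result `none`) if it does
not have exactly `n - 1` elements; reject unless these matrices commute, have trace `0` and are all
diagonalizable over the algebraic closure. If none of these tests fails, declare that `f` has a
factorization, and keep the basis for the next steps. -/
def decideStep (d : ℕ) (pts : Fin (n * n) → Fin n → X .base) :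
    Prog X n (Option (List (Fin n → Fin n → X .base))) := do
  let B ← lieBasis d pts
  if B.length ≠ n - 1 then
    .ret none
  else do
    let commutators ← traverse (fun p => commutator p.1 p.2) (B.product B)
    let traces ← traverse trace B
    let defects ← traverse defect B
    ifAllZero
      (if defects.flatten.isEmpty then .ret (some B) else .ret none)
      (.ret none)
      (commutators.flatten ++ traces)

/-! ### Step 4: simultaneous diagonalization -/

/-- The linear combination of the matrices in the list `B` with coefficients `t`. -/
def combination (t : Fin (n - 1) → X .base) (B : List (Fin n → Fin n → X .base)) :
    Prog X n (Fin n → Fin n → X .base) :=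
  tabulate n fun i => tabulate n fun j => do
    let ts ← traverse (fun p => op .mul p.1 (p.2 i j)) ((List.ofFn t).zip B)
    sum ts

/-- A basis of the space of the row vectors `x` with `x * R = μ * x`. -/
def leftEigenspace (R : Fin n → Fin n → X .base) (μ : X .ext) :
    Prog X n (List (Fin n → X .ext)) := do
  let S ← tabulate n fun j => tabulate n fun i => do
    let r ← toExt (R i j)
    if i = j then op .sub r μ else .ret r
  kernel n (List.ofFn S)

/-- Step 4: diagonalize a (random) linear combination `R` of the matrices in the list `B`.  The
result is the list of the rows of a matrix `A` such that `A * R * A⁻¹` is diagonal. -/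
def diagonalize (t : Fin (n - 1) → X .base) (B : List (Fin n → Fin n → X .base)) :
    Prog X n (List (Fin n → X .ext)) := do
  let R ← combination t B
  let eigs ← Prog.eigenvalues R .ret
  let eigs' ← distinct eigs
  let spaces ← traverse (leftEigenspace R) eigs'
  .ret spaces.flatten

/-! ### Step 5: rescaling -/

/-- Step 5: given a matrix `A` such that `f (x) = c * (∏ i, (A x) i) ^ α` for some constant `c`,
compute `c` from the value of `f` at a (random) point `x`, and multiply the first row of `A` by an
`α`-th root of `c`. -/
def rescale (α : ℕ) (x : Fin n → X .base) (A : Fin n → Fin n → X .ext) :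
    Prog X n (Fin n → Fin n → X .ext) := do
  let y ← blackBox x
  let y' ← toExt y
  let x' ← tabulate n fun i => toExt (x i)
  let z ← tabulate n fun i => dot (A i) x'
  let p ← prod (List.ofFn z)
  let q ← power p α
  let c ← op .div y' q
  let r ← Prog.root α c .ret
  tabulate n fun i => tabulate n fun j =>
    if (i : ℕ) = 0 then op .mul r (A i j) else .ret (A i j)

/-! ### The algorithm -/

/-- The random choices of the algorithm, each of them an element of `V`: `n ^ 2` points for step 1,
`n - 1` coefficients for step 4, and one point for step 5. -/
structure Coins (V : Type u) (n : ℕ) : Type u where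
  pts : Fin (n * n) → Fin n → V
  coeffs : Fin (n - 1) → V
  pt : Fin n → V

/-- The number of elements drawn at random. -/
def numCoins (n : ℕ) : ℕ := n * n * n + (n - 1) + n

/-- Apply a function to all random choices. -/
def Coins.map {V : Type u} {W : Type v} (g : V → W) (ω : Coins V n) : Coins W n where
  pts p i := g (ω.pts p i)
  coeffs i := g (ω.coeffs i)
  pt i := g (ω.pt i)

/-- The five-step algorithm, for a polynomial of degree `n * α` in `n` variables given by a black
box.  It rejects with `none`; otherwise it returns the matrix of the coefficients of `n` linear
forms.  (For a list of rows of length `n - 1` the vectors returned by step 4 always are `n` in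
number, since the linear combination which is diagonalized there is diagonalizable.) -/
def algorithm (α : ℕ) (ω : Coins (X .base) n) :
    Prog X n (Option (Fin n → Fin n → X .ext)) := do
  let D ← decideStep (n * α) ω.pts
  match D with
  | none => .ret none
  | some B => do
    let rows ← diagonalize ω.coeffs B
    if h : rows.length = n then do
      let l ← rescale α ω.pt fun i => rows.get (i.cast h.symm)
      .ret (some l)
    else
      .ret none

end Algorithm

/-! ### What the algorithm has to do -/

section Specification

variable {K L : Type u} [Field K] [Field L] [Algebra K L] {n : ℕ}

/-- `f = (l 0 ⋯ l (n - 1)) ^ α` over `L`, where `l i` is the linear form `∑ j, l i j * x j`, and the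
`n` linear forms are linearly independent. -/
def IsFactorization (f : MvPolynomial (Fin n) K) (α : ℕ) (l : Fin n → Fin n → L) : Prop :=
  LinearIndependent L l ∧
    MvPolynomial.map (algebraMap K L) f =
      (∏ i, ∑ j, MvPolynomial.C (l i j) * MvPolynomial.X j) ^ α

/-- The correct answers on input `f`: a factorization if there is one over `L`, and rejection
otherwise. -/
def IsCorrect (f : MvPolynomial (Fin n) K) (α : ℕ) : Option (Fin n → Fin n → L) → Prop
  | none => ¬ ∃ l : Fin n → Fin n → L, IsFactorization f α l
  | some l => IsFactorization f α l

/-- The algorithm, with values in `K` and `L` and with given random choices in `K`. -/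
def runOn (K L : Type u) (α : ℕ) (ω : Coins K n) :
    Prog (Val K L) n (Option (Fin n → Fin n → L)) :=
  algorithm (X := Val K L) α ω

/-- The black box for `f`. -/
noncomputable def blackBoxOf (f : MvPolynomial (Fin n) K) (x : Fin n → K) : K :=
  MvPolynomial.eval x f

/-- The probability that the algorithm returns a wrong answer on input `f`, if its random choices
are independent and uniformly distributed in the finite set `S`. -/
noncomputable def errorProb (L : Type u) [Field L] [Algebra K L] (f : MvPolynomial (Fin n) K)
    (α : ℕ) (S : Finset K) : ℝ :=
  (Nat.card {ω : Coins S n //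
      ¬ IsCorrect f α ((runOn K L α (ω.map Subtype.val)).eval (blackBoxOf f))} : ℝ) /
    (Nat.card (Coins S n) : ℝ)

end Specification

end LinFact

namespace LinFact

section RoutineSemantics

variable {K L : Type u} [Field K] [Field L] [Algebra K L] {n : ℕ} {s : Srt}
  (f : (Fin n → K) → K) (c : Kind → ℕ)

/-! ### Sequential composition -/

/-! Write `lieAction f b` for the derivative of `f` along the linear vector field `x ↦ b x`; the Lie
algebra of `f` is its kernel in `b`. A linear change of variables conjugates this Lie algebra
(`lieAction_subst`), and a diagonal matrix with entries `v` multiplies the monomial `x ^ e` by `∑ i,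
v i * e i` (`coeff_lieAction_diagonal`). Hence in characteristic 0 the Lie algebra of `(x₁ ⋯ xₙ) ^
α` consists of the diagonal matrices of trace zero. If `f = (l₁ ⋯ lₙ) ^ α`, its Lie algebra over `L`
is a conjugate of that one; it is cut out by linear equations over `K`, so a `K`-basis has exactly
`n - 1` elements and passes all tests.

Conversely, `n - 1` independent commuting diagonalizable matrices of trace zero become diagonal in a
common eigenbasis. A monomial of the transformed `f` must have its exponent vector orthogonal to the
whole hyperplane of vectors of sum zero, so all its exponents are equal, and the degree makes them
equal to `α`. Thus `f` is a constant times a power of a product of independent linear forms, and the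
constant is absorbed by a root (`exists_isFactorization`). The polynomial 0 is rejected, because its
Lie algebra has dimension `n ^ 2 > n - 1`.

Randomness can fail in three ways, each controlled by the Schwartz–Zippel lemma. The sample points
may fail to detect a nonzero element of the range of `lieAction f`, a space of dimension at most `n
^ 2` and degree at most `d` (`prob_exists_common_zero_le`). The combination `R` may have a repeated
eigenvalue; otherwise its left eigenspaces are the lines spanned by the `l i`
(`exists_eval_diagonalize`). Finally `f` may vanish at the last point. The three bounds add up to
`(n ^ 2 * d + n ^ 2 + d) / |S|` (`errorProb_le`). If there is no factorization, only the first
failure matters.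

The running time is bounded compositionally for an arbitrary price list in which ordinary
instructions cost at most `W`: one estimate, `cost_runOn_le`, yields the total time and both
instruction counts. -/

theorem Prog.eval_bind' {α : Type v} {β : Type w} (p : Prog (Val K L) n α)
    (h : α → Prog (Val K L) n β) : (p.bind h).eval f = (h (p.eval f)).eval f := by
  induction p with
  | ifZero s x p q hp hq =>
    simp only [Prog.bind, Prog.eval]
    split_ifs <;> simp [hp, hq]
  | _ => simp_all [Prog.bind, Prog.eval]

theorem Prog.cost_bind' {α : Type v} {β : Type w} (p : Prog (Val K L) n α)
    (h : α → Prog (Val K L) n β) :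
    (p.bind h).cost f c = p.cost f c + (h (p.eval f)).cost f c := by
  induction p with
  | ifZero s x p q hp hq =>
    simp only [Prog.bind, Prog.eval, Prog.cost]
    split_ifs <;> simp [hp, hq, add_assoc]
  | _ => simp_all [Prog.bind, Prog.eval, Prog.cost, add_assoc]

@[simp]
theorem Prog.eval_bind {α β : Type u} (p : Prog (Val K L) n α) (h : α → Prog (Val K L) n β) :
    (p >>= h).eval f = (h (p.eval f)).eval f :=
  Prog.eval_bind' f p h

@[simp]
theorem Prog.cost_bind {α β : Type u} (p : Prog (Val K L) n α) (h : α → Prog (Val K L) n β) :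
    (p >>= h).cost f c = p.cost f c + (h (p.eval f)).cost f c :=
  Prog.cost_bind' f c p h

@[simp]
theorem Prog.eval_ret {α : Type v} (a : α) : (Prog.ret a : Prog (Val K L) n α).eval f = a := rfl

/-! ### Results of the basic routines -/

-- Here and below, `no_index` keeps the result type out of the simp index: at a concrete sort `Val K
-- L s` reduces to `K` or `L`, and the rule must still apply.
@[simp]
theorem eval_zero : Prog.eval (K := K) (L := L) (α := no_index _) f (zero (s := s)) = 0 := by
  simp [zero, Prog.eval]

@[simp]
theorem eval_one : Prog.eval (K := K) (L := L) (α := no_index _) f (one (s := s)) = 1 := by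
  simp [one, Prog.eval]

@[simp]
theorem eval_op (o : Op) (x y : Val K L s) :
    Prog.eval (K := K) (L := L) (α := no_index _) f (op o x y) = o.eval x y := rfl

@[simp]
theorem eval_toExt (x : K) :
    Prog.eval (K := K) (L := L) (n := n) (α := no_index _) f (toExt x) = algebraMap K L x := rfl

@[simp]
theorem eval_blackBox (x : Fin n → K) :
    Prog.eval (K := K) (L := L) (α := no_index _) f (blackBox x) = f x := rfl

@[simp]
theorem eval_tabulate {β : Type u} (m : ℕ) (g : Fin m → Prog (Val K L) n β) :
    (tabulate m g).eval f = fun i => (g i).eval f := by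
  induction m with
  | zero => exact funext fun i => i.elim0
  | succ m ih =>
    simp only [tabulate, Prog.eval_bind, ih, Prog.eval_ret]
    exact funext fun i => Fin.cases rfl (fun _ => rfl) i

@[simp]
theorem eval_traverse {ι : Type v} {β : Type u} (g : ι → Prog (Val K L) n β) (l : List ι) :
    (traverse g l).eval f = l.map fun a => (g a).eval f := by
  induction l with
  | nil => rfl
  | cons a l ih => simp [traverse, ih]

@[simp]
theorem eval_sum (l : List (Val K L s)) :
    Prog.eval (K := K) (L := L) (α := no_index _) f (sum l) = l.sum := by
  induction l with
  | nil => simp [sum]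
  | cons a l ih => simp [sum, ih, Op.eval]

@[simp]
theorem eval_prod (l : List (Val K L s)) :
    Prog.eval (K := K) (L := L) (α := no_index _) f (prod l) = l.prod := by
  induction l with
  | nil => simp [prod]
  | cons a l ih => simp [prod, ih, Op.eval]

@[simp]
theorem eval_natural (k : ℕ) :
    Prog.eval (K := K) (L := L) (α := no_index _) f (natural k) = (k : Val K L s) := by
  induction k with
  | zero => simp [natural]
  | succ k ih => simp [natural, ih, Op.eval]

@[simp]
theorem eval_power (x : Val K L s) (k : ℕ) :
    Prog.eval (K := K) (L := L) (α := no_index _) f (power x k) = x ^ k := by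
  simp [power]

open Classical in
theorem eval_ifAllZero {β : Type u} (p q : Prog (Val K L) n β) (l : List (Val K L s)) :
    (ifAllZero p q l).eval f = if ∀ x ∈ l, x = 0 then p.eval f else q.eval f := by
  induction l with
  | nil => simp [ifAllZero]
  | cons a l ih =>
    by_cases h : a = 0 <;> simp [ifAllZero, Prog.eval, ih, h]

open Classical in
theorem eval_ifMem {β : Type u} (p q : Prog (Val K L) n β) (x : Val K L s)
    (l : List (Val K L s)) :
    (ifMem p q x l).eval f = if x ∈ l then p.eval f else q.eval f := by
  induction l with
  | nil => simp [ifMem]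
  | cons a l ih =>
    by_cases h : x = a <;> simp [ifMem, Prog.eval, ih, h, Op.eval, sub_eq_zero]

open Classical in
@[simp]
theorem eval_distinct (l : List (Val K L s)) :
    Prog.eval (K := K) (L := L) (α := no_index _) f (distinct l) = l.dedup := by
  induction l with
  | nil => simp [distinct]
  | cons a l ih =>
    by_cases h : a ∈ l <;> simp [distinct, eval_ifMem, ih, h]

@[simp]
theorem eval_dot {m : ℕ} (a b : Fin m → Val K L s) :
    Prog.eval (K := K) (L := L) (α := no_index _) f (dot a b) = a ⬝ᵥ b := by
  simp [dot, Op.eval, List.sum_ofFn, dotProduct]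

@[simp]
theorem eval_identity (m : ℕ) :
    Prog.eval (K := K) (L := L) (α := no_index _) f (identity (s := s) m) =
      fun i => Pi.single i 1 := by
  ext i j
  simp [identity, Pi.single_apply, eq_comm]

@[simp]
theorem eval_matMul {m : ℕ} (A B : Fin m → Fin m → Val K L s) :
    Prog.eval (K := K) (L := L) (α := no_index _) f (matMul A B) = Matrix.of.symm (Matrix.of A * Matrix.of B) := by
  ext i j
  simp [matMul, Matrix.mul_apply, dotProduct]

@[simp]
theorem eval_matPow {m : ℕ} (A : Fin m → Fin m → Val K L s) (k : ℕ) :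
    Prog.eval (K := K) (L := L) (α := no_index _) f (matPow A k) = Matrix.of.symm (Matrix.of A ^ k) := by
  induction k with
  | zero =>
    ext i j
    simp [matPow, Matrix.one_apply, Pi.single_apply, eq_comm]
  | succ k ih => simp [matPow, ih, pow_succ']

/-! ### Gaussian elimination -/

theorem eval_eliminate_cons {m : ℕ} (r b : Fin m → Val K L s) (bs : List (Fin m → Val K L s)) :
    (eliminate r (b :: bs) : Prog (Val K L) n _).eval f =
      open Classical in
      if r ⬝ᵥ b = 0 then b :: (eliminate r bs : Prog (Val K L) n _).eval f
      else bs.map fun b' => b' - (r ⬝ᵥ b' / r ⬝ᵥ b) • b := by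
  classical
  by_cases h : r ⬝ᵥ b = 0
  · simp [eliminate, Prog.eval, h]
  · simp only [eliminate, Prog.eval_bind, eval_dot, Prog.eval, h, if_false, eval_traverse]
    refine List.map_congr_left fun b' _ => funext fun i => ?_
    simp [Op.eval]

/-- If `r ⬝ᵥ b ≠ 0`, the vectors after the pivot `b` are projected along `b` onto the hyperplane `r
⬝ᵥ x = 0`. The projection of the span of `bs` is exactly the part of the span of `b :: bs` lying in
the hyperplane. -/
theorem span_eval_eliminate {m : ℕ} (r : Fin m → Val K L s) (l : List (Fin m → Val K L s))
    (x : Fin m → Val K L s) :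
    x ∈ Submodule.span (Val K L s) {y | y ∈ (eliminate r l : Prog (Val K L) n _).eval f} ↔
      x ∈ Submodule.span (Val K L s) {y | y ∈ l} ∧ r ⬝ᵥ x = 0 := by
  induction l generalizing x with
  | nil =>
    simp only [eliminate, Prog.eval_ret, List.not_mem_nil, Set.ofPred_false,
      Submodule.span_empty, Submodule.mem_bot]
    exact ⟨fun h => by simp [h], fun h => h.1⟩
  | cons b bs ih =>
    have hcons : ∀ (a : Fin m → Val K L s) (t : List (Fin m → Val K L s)),
        {y | y ∈ a :: t} = insert a {y | y ∈ t} := fun a t => by ext; simp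
    rw [eval_eliminate_cons]
    split_ifs with h
    · simp only [hcons, Submodule.mem_span_insert, ih]
      constructor
      · rintro ⟨a, z, ⟨hz, hr⟩, rfl⟩
        exact ⟨⟨a, z, hz, rfl⟩, by simp [h, hr]⟩
      · rintro ⟨⟨a, z, hz, rfl⟩, hr⟩
        exact ⟨a, z, ⟨hz, by simpa [h] using hr⟩, rfl⟩
    -- The projection is written as a linear map, so that the span of the image is the image of the
    -- span.
    · have himg : {y | y ∈ bs.map fun b' => b' - (r ⬝ᵥ b' / r ⬝ᵥ b) • b} =
          (LinearMap.id - ((LinearMap.toSpanSingleton (Val K L s) _ b).comp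
            ((r ⬝ᵥ b)⁻¹ • dotProductBilin (Val K L s) (Val K L s) r)) :
              (Fin m → Val K L s) →ₗ[Val K L s] _) '' {y | y ∈ bs} := by
        ext y
        simp [LinearMap.toSpanSingleton_apply, div_eq_inv_mul]
      rw [himg, Submodule.span_image, hcons, Submodule.mem_span_insert]
      constructor
      · rintro ⟨z, hz, rfl⟩
        refine ⟨⟨-((r ⬝ᵥ b)⁻¹ * r ⬝ᵥ z), z, hz, ?_⟩, ?_⟩
        · simp [LinearMap.toSpanSingleton_apply]; abel
        · simp [LinearMap.toSpanSingleton_apply]; field_simp; ring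
      · rintro ⟨⟨a, z, hz, rfl⟩, hr⟩
        refine ⟨z, hz, ?_⟩
        -- The equation of the hyperplane forces the coefficient of `b`.
        have : a = -((r ⬝ᵥ b)⁻¹ * r ⬝ᵥ z) := by
          simp at hr
          field_simp
          linear_combination hr
        rw [this]
        simp [LinearMap.toSpanSingleton_apply]; abel

theorem linearIndependent_get_nil {F V : Type*} [Field F] [AddCommGroup V] [Module F V] :
    LinearIndependent F ([] : List V).get :=
  haveI : IsEmpty (Fin ([] : List V).length) := inferInstanceAs (IsEmpty (Fin 0))
  linearIndependent_empty_type

theorem linearIndependent_get_cons {F V : Type*} [Field F] [AddCommGroup V] [Module F V] (b : V)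
    (l : List V) : LinearIndependent F (b :: l).get ↔
      LinearIndependent F l.get ∧ b ∉ Submodule.span F {y | y ∈ l} := by
  have h1 : (b :: l).get = (Fin.cons b l.get : Fin (l.length + 1) → V) :=
    funext fun i => Fin.cases rfl (fun _ => rfl) i
  have h2 : {y | y ∈ l} = Set.range l.get := by
    ext y; simp [List.mem_iff_get]
  rw [h1, h2]
  exact linearIndependent_finCons

/-- A unipotent change of vectors: modulo `b` nothing changes. By induction, a dependence of the new
head on the new tail would put `a` in the span of `b` and `l`, and the exchange property would then
put `b` in the span of `a` and `l`. -/
theorem linearIndependent_get_map_sub {F V : Type*} [Field F] [AddCommGroup V] [Module F V]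
    (b : V) (l : List V) (q : V → F) (h : LinearIndependent F (b :: l).get) :
    LinearIndependent F (l.map fun y => y - q y • b).get := by
  induction l with
  | nil => exact linearIndependent_get_nil
  | cons a l ih =>
    rw [linearIndependent_get_cons, linearIndependent_get_cons] at h
    obtain ⟨⟨hl, ha⟩, hb⟩ := h
    have hcons : ∀ (a : V) (t : List V), {y | y ∈ a :: t} = insert a {y | y ∈ t} :=
      fun a t => by ext; simp
    rw [hcons] at hb
    rw [List.map_cons, linearIndependent_get_cons]
    refine ⟨ih ((linearIndependent_get_cons _ _).2 ⟨hl, fun hb' =>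
      hb (Submodule.span_mono (Set.subset_insert _ _) hb')⟩), fun hmem => ?_⟩
    have hle : Submodule.span F {y | y ∈ l.map fun y => y - q y • b} ≤
        Submodule.span F (insert b {y | y ∈ l}) := by
      rw [Submodule.span_le]
      intro y hy
      obtain ⟨z, hz, rfl⟩ := List.mem_map.1 hy
      exact Submodule.sub_mem _ (Submodule.subset_span (Set.mem_insert_of_mem _ hz))
        (Submodule.smul_mem _ _ (Submodule.subset_span (Set.mem_insert _ _)))
    have h1 : a ∈ Submodule.span F (insert b {y | y ∈ l}) := by
      have := Submodule.add_mem _ (hle hmem)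
        (Submodule.smul_mem _ (q a) (Submodule.subset_span (Set.mem_insert b {y | y ∈ l})))
      simpa using this
    exact hb (mem_span_insert_exchange h1 ha)

theorem linearIndependent_eval_eliminate {m : ℕ} (r : Fin m → Val K L s)
    (l : List (Fin m → Val K L s)) (hl : LinearIndependent (Val K L s) l.get) :
    LinearIndependent (Val K L s) ((eliminate r l : Prog (Val K L) n _).eval f).get := by
  induction l with
  | nil => exact linearIndependent_get_nil
  | cons b bs ih =>
    have hl' := (linearIndependent_get_cons b bs).1 hl
    by_cases h : r ⬝ᵥ b = 0
    · rw [eval_eliminate_cons, if_pos h, linearIndependent_get_cons]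
      exact ⟨ih hl'.1, fun hb => hl'.2 ((span_eval_eliminate f r bs b).1 hb).1⟩
    · rw [eval_eliminate_cons, if_neg h]
      exact linearIndependent_get_map_sub b bs (fun b' => r ⬝ᵥ b' / r ⬝ᵥ b) hl

/-- Together with `linearIndependent_eval_kernel`, this says that `kernel` returns a basis of the
solution space. All later linear algebra uses only these two facts. -/
theorem mem_span_eval_kernel {m : ℕ} (rs : List (Fin m → Val K L s)) (x : Fin m → Val K L s) :
    x ∈ Submodule.span (Val K L s) {y | y ∈ (kernel m rs : Prog (Val K L) n _).eval f} ↔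
      ∀ r ∈ rs, r ⬝ᵥ x = 0 := by
  induction rs with
  | nil =>
    have h : {y | y ∈ (kernel m [] : Prog (Val K L) n (List (Fin m → Val K L s))).eval f} =
        Set.range (Pi.basisFun (Val K L s) (Fin m)) := by
      ext y
      simp only [kernel, Prog.eval_bind, eval_identity, Prog.eval_ret, List.mem_ofFn,
        Set.mem_ofPred_eq, Set.mem_range]
      exact exists_congr fun i => by rw [Pi.basisFun_apply]
    rw [h, Module.Basis.span_eq]
    simp
  | cons r rs ih =>
    simp only [kernel, Prog.eval_bind, span_eval_eliminate, ih, List.forall_mem_cons]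
    tauto

theorem linearIndependent_eval_kernel {m : ℕ} (rs : List (Fin m → Val K L s)) :
    LinearIndependent (Val K L s) ((kernel m rs : Prog (Val K L) n _).eval f).get := by
  induction rs with
  | nil =>
    have h := (Pi.basisFun (Val K L s) (Fin m)).linearIndependent
    have h1 : (kernel m [] : Prog (Val K L) n (List (Fin m → Val K L s))).eval f =
        List.ofFn fun i : Fin m => (Pi.single i 1 : Fin m → Val K L s) := by
      simp [kernel]
    have h2 : (List.ofFn fun i : Fin m => (Pi.single i 1 : Fin m → Val K L s)).get =
        (Pi.basisFun (Val K L s) (Fin m)) ∘ Fin.cast (List.length_ofFn) := by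
      funext i
      rw [List.get_ofFn, Function.comp_apply, Pi.basisFun_apply]
    rw [h1, h2]
    exact h.comp _ (Fin.cast_injective _)
  | cons r rs ih =>
    have h1 : (kernel m (r :: rs) : Prog (Val K L) n (List (Fin m → Val K L s))).eval f =
        (eliminate r ((kernel m rs : Prog (Val K L) n _).eval f) : Prog (Val K L) n _).eval f := by
      simp [kernel]
    rw [h1]
    exact linearIndependent_eval_eliminate f r _ ih

theorem length_eval_kernel_le {m : ℕ} (rs : List (Fin m → Val K L s)) :
    ((kernel m rs : Prog (Val K L) n _).eval f).length ≤ m := by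
  simpa using (linearIndependent_eval_kernel f rs).fintype_card_le_finrank

end RoutineSemantics

end LinFact

namespace LinFact

/-! ### Differentiation by interpolation -/

section Interpolation

open Polynomial in
-- `g'(0)` is the value at 0 of `(g - g(0)) / X`, a polynomial of degree below `d`, hence equal to
-- its Lagrange interpolant at the nodes `1, …, d`. Characteristic 0 makes these nodes distinct and
-- nonzero.
theorem eval_zero_derivative_eq_sum {K : Type*} [Field K] [CharZero K] {d : ℕ} {g : K[X]}
    (hg : g.natDegree ≤ d) (s : Finset ℕ) (hs : ∀ k, k ∈ s ↔ 1 ≤ k ∧ k ≤ d) :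
    (derivative g).eval 0 =
      ∑ k ∈ s, (∏ j ∈ s.erase k, ((j : K) / ((j : K) - k))) / k * (g.eval (k : K) - g.eval 0) := by
  have h0 : (derivative g).eval 0 = g.divX.eval 0 := by
    conv_lhs => rw [← divX_mul_X_add g]
    simp
  have hcard : s.card = d := by
    have : s = Finset.Icc 1 d := by ext; simp [hs]
    simp [this]
  -- If `divX` vanishes, in particular for `d = 0`, its degree is `⊥`, which is still below the
  -- number of nodes.
  have hdeg : g.divX.degree < s.card := by
    rw [hcard]
    by_cases h : g.divX = 0
    · simp [h]
    · have h1 := natDegree_divX_eq_natDegree_tsub_one (p := g)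
      have h2 : g.natDegree ≠ 0 := fun h0 => h (by
        rw [eq_C_of_natDegree_le_zero h0.le, divX_C])
      exact (natDegree_lt_iff_degree_lt h).1 (by omega)
  have hinj : Set.InjOn (fun k : ℕ => (k : K)) s := Nat.cast_injective.injOn
  have h1 : ∀ k ∈ s, g.divX.eval (k : K) = (g.eval (k : K) - g.eval 0) / k := by
    intro k hk
    have hk0 : (k : K) ≠ 0 := by
      have := (hs k).1 hk
      exact_mod_cast (by omega : k ≠ 0)
    have := congrArg (eval (k : K)) (divX_mul_X_add g)
    simp only [eval_add, eval_mul, eval_X, eval_C] at this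
    rw [← coeff_zero_eq_eval_zero, eq_div_iff hk0]
    linear_combination this
  rw [h0, Lagrange.eq_interpolate_of_eval_eq (v := fun k : ℕ => (k : K)) _ hinj hdeg h1,
    Lagrange.interpolate_apply, eval_finsetSum]
  refine Finset.sum_congr rfl fun k hk => ?_
  rw [eval_mul, eval_C, Lagrange.basis, Polynomial.eval_prod]
  have : ∏ j ∈ s.erase k, eval 0 (Lagrange.basisDivisor (k : K) (j : K)) =
      ∏ j ∈ s.erase k, ((j : K) / ((j : K) - k)) := by
    refine Finset.prod_congr rfl fun j hj => ?_
    rw [Lagrange.basisDivisor, eval_mul, eval_C, eval_sub, eval_X, eval_C, zero_sub,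
      ← neg_sub (j : K) k, inv_neg, neg_mul_neg, inv_mul_eq_div]
  rw [this]
  ring

/-- The chain rule along the polynomial curve `φ`. -/
theorem derivative_aeval_eq_sum {F σ : Type*} [Field F] [Fintype σ] (φ : σ → Polynomial F)
    (p : MvPolynomial σ F) :
    Polynomial.derivative (MvPolynomial.aeval φ p) =
      ∑ i, MvPolynomial.aeval φ (MvPolynomial.pderiv i p) * Polynomial.derivative (φ i) := by
  classical
  induction p using MvPolynomial.induction_on with
  | C a => simp
  | add p q hp hq => simp [hp, hq, add_mul, Finset.sum_add_distrib]
  | mul_X p i hp =>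
    have h : ∀ j, MvPolynomial.aeval φ (MvPolynomial.pderiv j (p * MvPolynomial.X i)) *
        Polynomial.derivative (φ j) =
        MvPolynomial.aeval φ (MvPolynomial.pderiv j p) * Polynomial.derivative (φ j) * φ i +
          if j = i then MvPolynomial.aeval φ p * Polynomial.derivative (φ i) else 0 := by
      intro j
      rw [Derivation.leibniz, MvPolynomial.pderiv_X, smul_eq_mul, smul_eq_mul, map_add, map_mul,
        map_mul, MvPolynomial.aeval_X]
      by_cases hj : j = i
      · subst hj; simp; ring
      · simp [hj, Ne.symm hj]; ring
    rw [map_mul, MvPolynomial.aeval_X, Polynomial.derivative_mul, hp,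
      Finset.sum_congr rfl fun j _ => h j, Finset.sum_add_distrib, Finset.sum_mul]
    simp

end Interpolation

section LieRow

variable {K L : Type u} [Field K] [Field L] [Algebra K L] {n : ℕ}

theorem eval_weight (f : (Fin n → K) → K) (d k : ℕ) :
    Prog.eval (K := K) (L := L) (α := no_index _) f (weight d k) =
      (∏ j ∈ (List.range' 1 d).toFinset.erase k, ((j : K) / ((j : K) - k))) / k := by
  have h : (List.range' 1 d).toFinset.erase k =
      ((List.range' 1 d).filter fun j => j ≠ k).toFinset := by
    ext; simp [and_comm]
  rw [h, List.prod_toFinset _ ((List.nodup_range').filter _)]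
  simp [weight, Op.eval]

theorem eval_partialDeriv [CharZero K] (p : MvPolynomial (Fin n) K) {d : ℕ}
    (hd : p.totalDegree ≤ d) (a : Fin n → K) (i : Fin n) :
    Prog.eval (K := K) (L := L) (α := no_index _) (blackBoxOf p) (partialDeriv d a i) =
      MvPolynomial.eval a (MvPolynomial.pderiv i p) := by
  -- The line through `a` parallel to the `i`-th axis. Only its `i`-th coordinate has a nonzero
  -- derivative, so the chain rule leaves a single term.
  set φ : Fin n → Polynomial K :=
    fun j => if j = i then Polynomial.X + Polynomial.C (a j) else Polynomial.C (a j) with hφ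
  set g : Polynomial K := MvPolynomial.aeval φ p with hg
  have hdeg : g.natDegree ≤ d := by
    have := MvPolynomial.aeval_natDegree_le (n := 1) p hd φ (fun j => by
      simp only [hφ]; split_ifs <;> simp)
    simpa using this
  have hev : ∀ (q : MvPolynomial (Fin n) K) (t : K), (MvPolynomial.aeval φ q).eval t =
      MvPolynomial.eval (Function.update a i (a i + t)) q := by
    intro q t
    rw [MvPolynomial.aeval_def, Polynomial.algebraMap_eq, ← Polynomial.coe_evalRingHom,
      MvPolynomial.hom_eval₂, MvPolynomial.eval, MvPolynomial.coe_eval₂Hom]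
    congr 1
    · ext; simp
    · funext j
      by_cases h : j = i
      · subst h; simp [hφ, add_comm]
      · simp [hφ, h]
  have hder : (Polynomial.derivative g).eval 0 =
      MvPolynomial.eval a (MvPolynomial.pderiv i p) := by
    rw [hg, derivative_aeval_eq_sum, Finset.sum_eq_single i]
    · rw [Polynomial.eval_mul, hev]; simp [hφ]
    · intro j _ hj; simp [hφ, hj]
    · simp
  rw [← hder, eval_zero_derivative_eq_sum hdeg (List.range' 1 d).toFinset
    (fun k => by simp [List.mem_range'_1]; omega), List.sum_toFinset _ List.nodup_range']
  simp only [partialDeriv, Prog.eval_bind, eval_natural, eval_traverse, eval_op,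
    eval_sum, Op.eval, eval_blackBox, eval_weight, hg, hev, blackBoxOf, add_zero,
    Function.update_eq_self]

end LieRow

/-! ### The action of matrices on polynomials -/

section LieAction

variable {F : Type*} [Field F] {n : ℕ}

open MvPolynomial

/-- The polynomial `∑ i, ∑ j, b i j * x j * ∂p/∂x i`, as a linear function of `b`. -/
noncomputable def lieAction (p : MvPolynomial (Fin n) F) :
    Matrix (Fin n) (Fin n) F →ₗ[F] MvPolynomial (Fin n) F where
  toFun b := ∑ i, ∑ j, b i j • (X j * pderiv i p)
  map_add' b c := by simp [add_smul, Finset.sum_add_distrib]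
  map_smul' t b := by simp [mul_smul, Finset.smul_sum]

theorem lieAction_apply (p : MvPolynomial (Fin n) F) (b : Matrix (Fin n) (Fin n) F) :
    lieAction p b = ∑ i, ∑ j, b i j • (X j * pderiv i p) := rfl

theorem lieAction_C (a : F) (b : Matrix (Fin n) (Fin n) F) : lieAction (C a) b = 0 := by
  simp [lieAction_apply]

theorem lieAction_add (p q : MvPolynomial (Fin n) F) (b : Matrix (Fin n) (Fin n) F) :
    lieAction (p + q) b = lieAction p b + lieAction q b := by
  simp [lieAction_apply, mul_add, Finset.sum_add_distrib]

theorem lieAction_mul (p q : MvPolynomial (Fin n) F) (b : Matrix (Fin n) (Fin n) F) :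
    lieAction (p * q) b = lieAction p b * q + p * lieAction q b := by
  simp only [lieAction_apply, Derivation.leibniz, Finset.sum_mul, Finset.mul_sum,
    ← Finset.sum_add_distrib, smul_eq_mul, Algebra.smul_def]
  exact Finset.sum_congr rfl fun i _ => Finset.sum_congr rfl fun j _ => by ring

theorem lieAction_X (k : Fin n) (b : Matrix (Fin n) (Fin n) F) :
    lieAction (X k) b = ∑ j, b k j • X j := by
  classical
  rw [lieAction_apply, Finset.sum_eq_single k]
  · simp
  · intro i _ hi; simp [pderiv_X, hi.symm]
  · simp

theorem lieAction_map {K : Type*} [Field K] [Algebra K F] (p : MvPolynomial (Fin n) K)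
    (b : Matrix (Fin n) (Fin n) K) :
    lieAction (map (algebraMap K F) p) (b.map (algebraMap K F)) =
      map (algebraMap K F) (lieAction p b) := by
  simp only [lieAction_apply, pderiv_map, MvPolynomial.smul_eq_C_mul, map_sum, map_mul, map_C,
    map_X, Matrix.map_apply]

theorem isHomogeneous_lieAction {p : MvPolynomial (Fin n) F} {d : ℕ} (hp : p.IsHomogeneous d)
    (b : Matrix (Fin n) (Fin n) F) : (lieAction p b).IsHomogeneous d := by
  -- Degree 0 is separate because `1 + (d - 1) = d` fails there; the polynomial is then constant and
  -- its action is zero.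
  rcases Nat.eq_zero_or_pos d with rfl | hd
  · rw [← totalDegree_zero_iff_isHomogeneous, totalDegree_eq_zero_iff_eq_C] at hp
    rw [hp, lieAction_C]
    exact isHomogeneous_zero _ _ _
  · refine IsHomogeneous.sum _ _ _ fun i _ => IsHomogeneous.sum _ _ _ fun j _ => ?_
    rw [smul_eq_C_mul]
    refine IsHomogeneous.C_mul ?_ _
    have := (isHomogeneous_X F j).mul (hp.pderiv (i := i))
    rwa [show 1 + (d - 1) = d by omega] at this

/-- Substitution of the linear forms `∑ k, Q i k * x k` for the variables `x i`. -/
noncomputable def subst (Q : Matrix (Fin n) (Fin n) F) :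
    MvPolynomial (Fin n) F →ₐ[F] MvPolynomial (Fin n) F :=
  aeval fun i => ∑ k, Q i k • X k

theorem subst_X (Q : Matrix (Fin n) (Fin n) F) (i : Fin n) :
    subst Q (X i) = ∑ k, Q i k • X k := by simp [subst]

/-- `subst Q` is the pullback `p ↦ p ∘ Q`, hence the reversed order of the factors. -/
theorem subst_subst (P Q : Matrix (Fin n) (Fin n) F) (p : MvPolynomial (Fin n) F) :
    subst P (subst Q p) = subst (Q * P) p := by
  have : (subst P).comp (subst Q) = subst (Q * P) := by
    refine algHom_ext fun i => ?_
    simp only [AlgHom.comp_apply, subst_X, map_sum, map_smul, Matrix.mul_apply, Finset.smul_sum,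
      Finset.sum_smul, smul_smul]
    exact Finset.sum_comm
  exact DFunLike.congr_fun this p

theorem subst_one (p : MvPolynomial (Fin n) F) : subst 1 p = p := by
  have : subst (1 : Matrix (Fin n) (Fin n) F) = AlgHom.id F _ := by
    refine algHom_ext fun i => ?_
    simp [subst_X, Matrix.one_apply]
  exact DFunLike.congr_fun this p

theorem subst_isHomogeneous (Q : Matrix (Fin n) (Fin n) F) {p : MvPolynomial (Fin n) F} {d : ℕ}
    (hp : p.IsHomogeneous d) : (subst Q p).IsHomogeneous d := by
  have := hp.aeval (fun i => ∑ k, Q i k • (X k : MvPolynomial (Fin n) F)) (n := 1)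
    (fun i => IsHomogeneous.sum _ _ _ fun k _ => by
      rw [MvPolynomial.smul_eq_C_mul]; exact (isHomogeneous_X _ _).C_mul _)
  simpa [subst] using this

/-- If `Q` intertwines the vector fields `b` and `b'`, pulling back along `Q` intertwines the
derivations that they define. Both sides obey the same Leibniz rule, so the variables decide. In
this form `Q` need not be invertible. -/
theorem lieAction_subst {Q b b' : Matrix (Fin n) (Fin n) F} (h : Q * b = b' * Q)
    (p : MvPolynomial (Fin n) F) : lieAction (subst Q p) b = subst Q (lieAction p b') := by
  induction p using MvPolynomial.induction_on with
  | C a =>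
    rw [lieAction_C, map_zero, show subst Q (C a) = C a from (subst Q).commutes a, lieAction_C]
  | add p q hp hq => simp [lieAction_add, hp, hq]
  | mul_X p i hp =>
    have hX : lieAction (subst Q (X i)) b = subst Q (lieAction (X i) b') := by
      have hs : lieAction (subst Q (X i)) b = ∑ k, Q i k • lieAction (X k) b := by
        rw [subst_X]
        generalize (Finset.univ : Finset (Fin n)) = t
        induction t using Finset.cons_induction with
        | empty => simp [lieAction_apply]
        | cons k t hk ih =>
          rw [Finset.sum_cons, Finset.sum_cons, lieAction_add, ih, smul_eq_C_mul, lieAction_mul,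
            lieAction_C, zero_mul, zero_add, ← smul_eq_C_mul]
      have h2 : ∀ j, ∑ k, Q i k * b k j = ∑ k, b' i k * Q k j := fun j => by
        rw [← Matrix.mul_apply, h, Matrix.mul_apply]
      rw [hs]
      simp only [lieAction_X, map_sum, map_smul, subst_X, Finset.smul_sum, smul_smul]
      rw [Finset.sum_comm, Finset.sum_comm (f := fun j k => (b' i j * Q j k) • (X k : MvPolynomial (Fin n) F))]
      simp only [← Finset.sum_smul, h2]
    rw [map_mul, lieAction_mul, lieAction_mul, map_add, map_mul, map_mul, hp, hX]

end LieAction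

end LinFact

namespace LinFact

/-! ### The computed basis of the Lie algebra -/

section LieBasis

variable {K L : Type u} [Field K] [Field L] [Algebra K L] {n : ℕ}

/-- Square matrices as vectors. -/
def vecToMatrix (K : Type*) [Field K] (n : ℕ) : (Fin (n * n) → K) ≃ₗ[K] Matrix (Fin n) (Fin n) K where
  toFun x := Matrix.of fun i j => x (finProdFinEquiv (i, j))
  map_add' _ _ := rfl
  map_smul' _ _ := rfl
  invFun b e := b (finProdFinEquiv.symm e).1 (finProdFinEquiv.symm e).2
  left_inv x := funext fun e => congrArg x (finProdFinEquiv.apply_symm_apply e)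
  right_inv b := by ext i j; simp

theorem vecToMatrix_apply {K : Type*} [Field K] {n : ℕ} (x : Fin (n * n) → K) (i j : Fin n) :
    vecToMatrix K n x i j = x (finProdFinEquiv (i, j)) := rfl

theorem eval_lieRow [CharZero K] (p : MvPolynomial (Fin n) K) {d : ℕ} (hd : p.totalDegree ≤ d)
    (a : Fin n → K) :
    Prog.eval (K := K) (L := L) (α := no_index _) (blackBoxOf p) (lieRow d a) =
      fun e => a (finProdFinEquiv.symm e).2 *
        MvPolynomial.eval a (MvPolynomial.pderiv (finProdFinEquiv.symm e).1 p) := by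
  simp [lieRow, Op.eval, eval_partialDeriv p hd]

theorem eval_lieRow_dotProduct [CharZero K] (p : MvPolynomial (Fin n) K) {d : ℕ}
    (hd : p.totalDegree ≤ d) (a : Fin n → K) (x : Fin (n * n) → K) :
    Prog.eval (K := K) (L := L) (α := no_index _) (blackBoxOf p) (lieRow d a) ⬝ᵥ x =
      MvPolynomial.eval a (lieAction p (vecToMatrix K n x)) := by
  rw [eval_lieRow p hd, lieAction_apply, dotProduct, ← finProdFinEquiv.sum_comp,
    Fintype.sum_prod_type]
  simp only [map_sum, MvPolynomial.smul_eval, map_mul, MvPolynomial.eval_X,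
    Equiv.symm_apply_apply, vecToMatrix_apply]
  exact Finset.sum_congr rfl fun i _ => Finset.sum_congr rfl fun j _ => by ring

theorem eval_lieBasis (f : (Fin n → K) → K) (d : ℕ) (pts : Fin (n * n) → Fin n → K) :
    Prog.eval (K := K) (L := L) (α := no_index _) f (lieBasis d pts) =
      ((kernel (X := Val K L) (n := n) (n * n) (List.ofFn fun p =>
        (lieRow (X := Val K L) d (pts p)).eval f)).eval f).map (vecToMatrix K n) := by
  simp only [lieBasis, Prog.eval_bind, eval_tabulate, Prog.eval_ret]
  rfl

theorem linearIndependent_get_map {F V W : Type*} [Field F] [AddCommGroup V] [Module F V]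
    [AddCommGroup W] [Module F W] (e : V →ₗ[F] W) (he : Function.Injective e) {l : List V}
    (h : LinearIndependent F l.get) : LinearIndependent F (l.map e).get := by
  have : (l.map e).get = (e ∘ l.get) ∘ Fin.cast (List.length_map e) := by
    funext i; simp
  rw [this]
  exact (h.map' e (LinearMap.ker_eq_bot.2 he)).comp _ (Fin.cast_injective _)

theorem linearIndependent_lieBasis (f : (Fin n → K) → K) (d : ℕ) (pts : Fin (n * n) → Fin n → K) :
    LinearIndependent K ((lieBasis (X := Val K L) d pts).eval f).get := by
  rw [eval_lieBasis]
  exact linearIndependent_get_map (vecToMatrix K n).toLinearMap (vecToMatrix K n).injective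
    (linearIndependent_eval_kernel (s := .base) f _)

/-- For arbitrary points the computed space only contains the Lie algebra. They agree when no
nonzero polynomial in the range of `lieAction p` vanishes at all the points. -/
theorem mem_span_lieBasis [CharZero K] (p : MvPolynomial (Fin n) K) {d : ℕ}
    (hd : p.totalDegree ≤ d) (pts : Fin (n * n) → Fin n → K) (x : Matrix (Fin n) (Fin n) K) :
    x ∈ Submodule.span K
        {b : Matrix _ _ K | b ∈ (lieBasis (X := Val K L) d pts).eval (blackBoxOf p)} ↔
      ∀ k, MvPolynomial.eval (pts k) (lieAction p x) = 0 := by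
  have h := mem_span_eval_kernel (K := K) (L := L) (s := .base) (blackBoxOf p)
    (List.ofFn fun k => (lieRow (X := Val K L) d (pts k)).eval (blackBoxOf p))
    ((vecToMatrix K n).symm x)
  simp only [List.forall_mem_ofFn_iff] at h
  have h2 : {b : Matrix _ _ K | b ∈ (lieBasis (X := Val K L) d pts).eval (blackBoxOf p)} =
      vecToMatrix K n '' {y | y ∈ (kernel (X := Val K L) (n := n) (n * n) (List.ofFn fun k =>
        (lieRow (X := Val K L) d (pts k)).eval (blackBoxOf p))).eval (blackBoxOf p)} := by
    rw [eval_lieBasis]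
    ext b
    exact List.mem_map
  rw [h2, ← LinearEquiv.coe_coe, Submodule.span_image, Submodule.mem_map_equiv]
  refine h.trans (forall_congr' fun k => ?_)
  have := eval_lieRow_dotProduct (L := L) p hd (pts k) ((vecToMatrix K n).symm x)
  rw [LinearEquiv.apply_symm_apply] at this
  rw [← this]

end LieBasis

/-! ### The test of diagonalizability -/

section Defect

open Polynomial

variable {K L : Type u} [Field K] [Field L] [Algebra K L] {n : ℕ} (f : (Fin n → K) → K)

/-- Let `g` be the gcd and `minpoly = g * r`. Then `q(x) * r(x) = 0`; if `q(x)` is a unit, `r`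
annihilates `x`, so the minimal polynomial divides `r` and `g` is a unit. The converse is a Bézout
relation evaluated at `x`. -/
theorem isUnit_aeval_iff_isCoprime_minpoly {A : Type*} [Ring A] [Algebra K A] {x : A}
    (hx : IsIntegral K x) (q : K[X]) : IsUnit (aeval x q) ↔ IsCoprime (minpoly K x) q := by
  constructor
  · intro hu
    classical
    by_contra hc
    have hg := (EuclideanDomain.gcd_isUnit_iff (x := minpoly K x) (y := q)).not.2 hc
    set g := EuclideanDomain.gcd (minpoly K x) q
    obtain ⟨r, hr⟩ : g ∣ minpoly K x := EuclideanDomain.gcd_dvd_left _ _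
    obtain ⟨t, ht⟩ : g ∣ q := EuclideanDomain.gcd_dvd_right _ _
    have h0 : aeval x r = 0 := by
      have h1 : aeval x q * aeval x r = 0 := by
        rw [← map_mul, ht, mul_right_comm, ← hr, map_mul, minpoly.aeval, zero_mul]
      exact hu.mul_right_eq_zero.1 h1
    have hr0 : r ≠ 0 := by
      rintro rfl; exact minpoly.ne_zero hx (by rw [hr, mul_zero])
    obtain ⟨c, hc⟩ := minpoly.dvd K x h0
    apply hg
    refine IsUnit.of_mul_eq_one c (mul_right_cancel₀ hr0 ?_)
    rw [one_mul, mul_right_comm, ← hr, ← hc]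
  · rintro ⟨a, b, hab⟩
    have h := congrArg (aeval x) hab
    simp only [map_add, map_mul, minpoly.aeval, mul_zero, zero_add, map_one] at h
    exact ⟨⟨aeval x q, aeval x b, by rw [← map_mul, mul_comm, map_mul, h], h⟩, rfl⟩

theorem isEmpty_kernel_iff {s : Srt} (M : Matrix (Fin n) (Fin n) (Val K L s)) :
    (kernel (X := Val K L) n (List.ofFn fun i => M i)).eval f = [] ↔ IsUnit M := by
  rw [← Matrix.mulVec_injective_iff_isUnit, ← Matrix.coe_mulVecLin, ← LinearMap.ker_eq_bot,
    Submodule.eq_bot_iff]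
  have h := mem_span_eval_kernel (K := K) (L := L) f (List.ofFn fun i => M i)
  have hl := linearIndependent_eval_kernel (K := K) (L := L) f (List.ofFn fun i => M i)
  simp only [List.forall_mem_ofFn_iff] at h
  simp only [LinearMap.mem_ker, Matrix.mulVecLin_apply, funext_iff]
  constructor
  · intro h0 x hx
    have := (h x).2 hx
    rw [h0] at this
    simpa [funext_iff] using this
  · intro h0
    by_contra hne
    obtain ⟨v, t, hv⟩ := List.exists_cons_of_ne_nil hne
    rw [hv, linearIndependent_get_cons] at hl
    have hv0 : v = 0 := funext (h0 v ((h v).1 (Submodule.subset_span (by simp [hv]))))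
    exact hl.2 (by simp [hv0])

/-- The polynomial of degree at most `k` with given coefficients. -/
noncomputable def polyOfCoeffs {k : ℕ} (c : Fin (k + 1) → K) : K[X] :=
  ∑ e : Fin (k + 1), Polynomial.monomial (e : ℕ) (c e)

theorem aeval_polyOfCoeffs {k : ℕ} (c : Fin (k + 1) → K) {A : Type*} [Ring A] [Algebra K A]
    (x : A) : aeval x (polyOfCoeffs c) = ∑ e, c e • x ^ (e : ℕ) := by
  simp [polyOfCoeffs, aeval_monomial, Algebra.smul_def]

theorem natDegree_polyOfCoeffs_le {k : ℕ} (c : Fin (k + 1) → K) :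
    (polyOfCoeffs c).natDegree ≤ k :=
  natDegree_sum_le_of_forall_le _ _ fun e _ => (natDegree_monomial_le _).trans (by omega)

theorem coeff_polyOfCoeffs {k : ℕ} (c : Fin (k + 1) → K) (e : Fin (k + 1)) :
    (polyOfCoeffs c).coeff e = c e := by
  simp [polyOfCoeffs, coeff_monomial, Fin.val_inj]

theorem mem_span_annihilators (M : Fin n → Fin n → K) (k : ℕ) (c : Fin (k + 1) → K) :
    c ∈ Submodule.span K {y | y ∈ (annihilators (X := Val K L) M k).eval f} ↔
      aeval (Matrix.of M) (polyOfCoeffs c) = 0 := by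
  have h := mem_span_eval_kernel (K := K) (L := L) (s := .base) f
    (List.ofFn fun p : Fin (n * n) => fun e : Fin (k + 1) =>
      (Matrix.of M ^ (e : ℕ)) (finProdFinEquiv.symm p).1 (finProdFinEquiv.symm p).2) c
  have h2 : (annihilators (X := Val K L) M k).eval f = (kernel (X := Val K L) (n := n) (s := .base)
      (k + 1) (List.ofFn fun p : Fin (n * n) => fun e : Fin (k + 1) =>
      (Matrix.of M ^ (e : ℕ)) (finProdFinEquiv.symm p).1 (finProdFinEquiv.symm p).2)).eval f := by
    simp [annihilators]
  rw [h2]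
  refine h.trans ?_
  rw [List.forall_mem_ofFn_iff, aeval_polyOfCoeffs, ← Matrix.ext_iff,
    ← finProdFinEquiv.forall_congr_right, Prod.forall]
  refine forall_congr' fun i => forall_congr' fun j => ?_
  rw [Matrix.sum_apply]
  simp [dotProduct, mul_comm]

theorem eval_derivAt (M : Fin n → Fin n → K) (k : ℕ) (c : Fin (k + 1) → K) :
    Prog.eval (K := K) (L := L) (α := no_index _) f (derivAt M k c) =
      Matrix.of.symm (aeval (Matrix.of M) (derivative (polyOfCoeffs c))) := by
  have h : aeval (Matrix.of M) (derivative (polyOfCoeffs c)) =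
      ∑ e : Fin k, (((e : ℕ) + 1 : K) * c e.succ) • Matrix.of M ^ (e : ℕ) := by
    simp only [polyOfCoeffs, Fin.sum_univ_succ, map_add, map_sum, derivative_monomial,
      aeval_monomial]
    simp [Algebra.smul_def, mul_comm]
  rw [h]
  ext i j
  simp [derivAt, Op.eval, dotProduct, Matrix.sum_apply]

/-- The invariant `hmin` says that degrees below `k` have been ruled out. The first degree with an
annihilator is that of the minimal polynomial `μ`, the annihilator found is a scalar multiple of
`μ`, and `μ'(M)` is invertible exactly when `μ` and `μ'` are coprime. -/
theorem eval_defectFrom_eq_nil_iff (M : Fin n → Fin n → K) (fuel k : ℕ) (hk : fuel + k = n + 1)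
    (hmin : k ≤ (minpoly K (Matrix.of M)).natDegree) :
    (defectFrom (X := Val K L) M fuel k).eval f = [] ↔ (minpoly K (Matrix.of M)).Separable := by
  have hint : IsIntegral K (Matrix.of M) := Matrix.isIntegral _
  have hmin0 := minpoly.ne_zero hint
  induction fuel generalizing k with
  | zero =>
    -- The fuel cannot run out: here `k = n + 1`, but by Cayley–Hamilton the minimal polynomial has
    -- degree at most `n`.
    have h1 := natDegree_le_of_dvd (Matrix.minpoly_dvd_charpoly (Matrix.of M))
      (Matrix.charpoly_monic _).ne_zero
    rw [Matrix.charpoly_natDegree_eq_dim, Fintype.card_fin] at h1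
    omega
  | succ fuel ih =>
    have hspan := mem_span_annihilators (L := L) f M k
    have hli : LinearIndependent K ((annihilators (X := Val K L) M k).eval f).get := by
      have h2 : (annihilators (X := Val K L) M k).eval f =
          (kernel (X := Val K L) (n := n) (s := .base) (k + 1)
            (List.ofFn fun p : Fin (n * n) => fun e : Fin (k + 1) =>
            (Matrix.of M ^ (e : ℕ)) (finProdFinEquiv.symm p).1
              (finProdFinEquiv.symm p).2)).eval f := by
        simp [annihilators]
      rw [h2]
      exact linearIndependent_eval_kernel (s := .base) f _
    rw [defectFrom, Prog.eval_bind]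
    generalize (annihilators (X := Val K L) M k).eval f = A at hspan hli
    cases A with
    | nil =>
      -- Were the degree equal to `k`, the coefficients of the minimal polynomial would be a nonzero
      -- annihilator.
      refine ih (k + 1) (by omega) (Nat.succ_le_of_lt (lt_of_le_of_ne hmin fun heq => ?_))
      have hc : polyOfCoeffs (fun e : Fin (k + 1) => (minpoly K (Matrix.of M)).coeff e) =
          minpoly K (Matrix.of M) := by
        conv_rhs => rw [(minpoly K (Matrix.of M)).as_sum_range' (k + 1) (by omega),
          Finset.sum_range]
        rfl
      have h := (hspan fun e : Fin (k + 1) => (minpoly K (Matrix.of M)).coeff e).2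
        (by rw [hc, minpoly.aeval])
      simp only [List.not_mem_nil, Set.ofPred_false, Submodule.span_empty,
        Submodule.mem_bot] at h
      exact hmin0 (by rw [← hc, h]; simp [polyOfCoeffs])
    | cons c t =>
      have hc0 : c ≠ 0 := fun h0 => ((linearIndependent_get_cons c t).1 hli).2 (by simp [h0])
      have hann := (hspan c).1 (Submodule.subset_span (by simp))
      have hp0 : polyOfCoeffs c ≠ 0 := fun h0 => hc0 (funext fun e => by
        rw [← coeff_polyOfCoeffs c e, h0]; rfl)
      obtain ⟨r, hr⟩ := minpoly.dvd K (Matrix.of M) hann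
      have hr0 : r ≠ 0 := by rintro rfl; exact hp0 (by rw [hr, mul_zero])
      -- The annihilator has degree at most `k`, and the minimal polynomial has degree at least `k`.
      have hrd : r.natDegree = 0 := by
        have h1 := natDegree_mul hmin0 hr0
        rw [← hr] at h1
        have := natDegree_polyOfCoeffs_le c
        omega
      obtain ⟨a, rfl⟩ := natDegree_eq_zero.1 hrd
      have ha : IsUnit (C a) := isUnit_C.2 (isUnit_iff_ne_zero.2 (by rintro rfl; simp at hr0))
      have h1 : (Prog.eval f (kernel (X := Val K L) (n := n) (s := .base) n (List.ofFn
          (Matrix.of.symm (aeval (Matrix.of M) (derivative (polyOfCoeffs c))))))) = [] ↔ _ :=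
        isEmpty_kernel_iff (s := .base) f (aeval (Matrix.of M) (derivative (polyOfCoeffs c)))
      simp only [Prog.eval_bind, eval_derivAt]
      refine h1.trans ((isUnit_aeval_iff_isCoprime_minpoly hint _).trans ?_)
      rw [hr, derivative_mul, derivative_C, mul_zero, add_zero, isCoprime_mul_unit_right_right ha]
      rfl

theorem eval_defect_eq_nil_iff (M : Fin n → Fin n → K) :
    (defect (X := Val K L) M).eval f = [] ↔ (minpoly K (Matrix.of M)).Separable :=
  eval_defectFrom_eq_nil_iff f M (n + 1) 0 rfl (Nat.zero_le _)

end Defect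

/-! ### The outcome of the tests in steps 2 and 3 -/

section DecideStep

variable {K L : Type u} [Field K] [Field L] [Algebra K L] {n : ℕ}

/-- The properties of a basis that are tested in steps 2 and 3. -/
def IsAccepted (B : List (Matrix (Fin n) (Fin n) K)) : Prop :=
  B.length = n - 1 ∧ (∀ b ∈ B, ∀ b' ∈ B, b * b' = b' * b) ∧ (∀ b ∈ B, b.trace = 0) ∧
    ∀ b ∈ B, (minpoly K b).Separable

theorem mem_entries {m : ℕ} {β : Type u} (A : Fin m → Fin m → β) (x : β) :
    x ∈ entries A ↔ ∃ i j, A i j = x := by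
  rw [entries, List.mem_ofFn, ← finProdFinEquiv.exists_congr_right]
  simp

open Classical in
theorem eval_decideStep (f : (Fin n → K) → K) (d : ℕ) (pts : Fin (n * n) → Fin n → K) :
    (decideStep (X := Val K L) d pts).eval f =
      if IsAccepted ((lieBasis (X := Val K L) d pts).eval f) then
        some ((lieBasis (X := Val K L) d pts).eval f) else none := by
  rw [decideStep, Prog.eval_bind]
  generalize (lieBasis (X := Val K L) d pts).eval f = B
  by_cases hlen : B.length = n - 1
  swap
  · rw [if_pos hlen, if_neg (fun h => hlen h.1), Prog.eval_ret]
  rw [if_neg (not_not.2 hlen)]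
  simp only [Prog.eval_bind, eval_traverse]
  rw [eval_ifAllZero]
  have hcomm : ∀ b b' : Fin n → Fin n → K,
      (∀ x ∈ (commutator (X := Val K L) b b').eval f, x = 0) ↔
        Matrix.of b * Matrix.of b' = Matrix.of b' * Matrix.of b := by
    intro b b'
    simp only [commutator, Prog.eval_bind, eval_matMul, eval_tabulate, eval_op, Prog.eval_ret,
      mem_entries, ← Matrix.ext_iff, Op.eval]
    constructor
    · intro h i j
      exact sub_eq_zero.1 (h _ ⟨i, j, rfl⟩)
    · rintro h x ⟨i, j, rfl⟩
      exact sub_eq_zero.2 (h i j)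
  have htr : ∀ b : Fin n → Fin n → K, (trace (X := Val K L) b).eval f = (Matrix.of b).trace := by
    intro b
    simp [trace, List.sum_ofFn, Matrix.trace]
  have h1 : (∀ x ∈ (List.map (fun p => (commutator (X := Val K L) p.1 p.2).eval f)
      (B.product B)).flatten ++ List.map (fun b => (trace (X := Val K L) b).eval f) B, x = 0) ↔
      (∀ b ∈ B, ∀ b' ∈ B, Matrix.of b * Matrix.of b' = Matrix.of b' * Matrix.of b) ∧
        ∀ b ∈ B, (Matrix.of b).trace = 0 := by
    rw [List.forall_mem_append, List.forall_mem_flatten, List.forall_mem_map, List.forall_mem_map]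
    refine and_congr ⟨fun h b hb b' hb' => (hcomm b b').1 (h (b, b')
      (List.mem_product.2 ⟨hb, hb'⟩)), fun h q hq => (hcomm q.1 q.2).2 ?_⟩
      (forall₂_congr fun b _ => by rw [htr])
    exact h _ (List.mem_product.1 hq).1 _ (List.mem_product.1 hq).2
  have h2 : (List.map (fun b => (defect (X := Val K L) b).eval f) B).flatten.isEmpty = true ↔
      ∀ b ∈ B, (minpoly K (Matrix.of b)).Separable := by
    rw [List.isEmpty_iff, List.flatten_eq_nil_iff]
    simp only [List.forall_mem_map, eval_defect_eq_nil_iff]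
  by_cases hA : IsAccepted (B : List (Matrix (Fin n) (Fin n) K))
  · rw [if_pos (h1.2 ⟨hA.2.1, hA.2.2.1⟩), if_pos (h2.2 hA.2.2.2), if_pos hA, Prog.eval_ret]
  · rw [if_neg hA]
    by_cases hB : ∀ x ∈ (List.map (fun p => (commutator (X := Val K L) p.1 p.2).eval f)
      (B.product B)).flatten ++ List.map (fun b => (trace (X := Val K L) b).eval f) B, x = 0
    · rw [if_pos hB, if_neg fun h => hA ⟨hlen, (h1.1 hB).1, (h1.1 hB).2, h2.1 h⟩, Prog.eval_ret]
    · rw [if_neg hB, Prog.eval_ret]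

end DecideStep

end LinFact

namespace LinFact

open MvPolynomial

/-! ### Vectors orthogonal to a space of codimension one -/

section Orthogonal

variable {F : Type*} [Field F] {n : ℕ}

/-- The orthogonal space of `n - 1` independent vectors is a line, and it contains the all-ones
vector because their coordinates sum to zero. This is used both for exponents of monomials and for
separating eigenvalues. -/
theorem eq_of_dotProduct_eq_zero {m : ℕ} (hm : m = n - 1) {v : Fin m → Fin n → F}
    (hv : LinearIndependent F v) (hsum : ∀ k, ∑ i, v k i = 0) {w : Fin n → F}
    (hw : ∀ k, v k ⬝ᵥ w = 0) (i j : Fin n) : w i = w j := by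
  have hrank : (Matrix.of v).rank = m := by
    simpa using LinearIndependent.rank_matrix (M := Matrix.of v) hv
  have hker := LinearMap.finrank_range_add_finrank_ker (Matrix.of v).mulVecLin
  rw [← Matrix.rank, hrank, Module.finrank_fin_fun] at hker
  have hone : (1 : Fin n → F) ∈ LinearMap.ker (Matrix.of v).mulVecLin := by
    rw [LinearMap.mem_ker]
    funext k
    simpa [Matrix.mulVec, dotProduct] using hsum k
  have hwk : w ∈ LinearMap.ker (Matrix.of v).mulVecLin := by
    rw [LinearMap.mem_ker]
    exact funext hw
  have h1 : Module.finrank F (LinearMap.ker (Matrix.of v).mulVecLin) = 1 := by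
    have := i.isLt
    omega
  have hone0 : (⟨1, hone⟩ : LinearMap.ker (Matrix.of v).mulVecLin) ≠ 0 := fun h => by
    have := congrFun (congrArg Subtype.val h) i
    simp at this
  obtain ⟨t, ht⟩ := (finrank_eq_one_iff_of_nonzero' _ hone0).1 h1 ⟨w, hwk⟩
  have hw' : ∀ i, w i = t := fun i => by
    have := congrFun (congrArg Subtype.val ht) i
    simpa using this.symm
  rw [hw', hw']

theorem finrank_sum_eq_zero (hn : 1 ≤ n) :
    Module.finrank F (LinearMap.ker (∑ i, LinearMap.proj i : (Fin n → F) →ₗ[F] F)) = n - 1 := by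
  have h := LinearMap.finrank_range_add_finrank_ker (∑ i, LinearMap.proj i : (Fin n → F) →ₗ[F] F)
  have hs : Function.Surjective (∑ i, LinearMap.proj i : (Fin n → F) →ₗ[F] F) := fun x =>
    ⟨Pi.single ⟨0, hn⟩ x, by simp⟩
  rw [LinearMap.range_eq_top.2 hs, finrank_top, Module.finrank_self, Module.finrank_fin_fun] at h
  omega

end Orthogonal

/-! ### Diagonal matrices and monomials -/

section Monomials

variable {F : Type*} [Field F] {n : ℕ}

theorem lieAction_diagonal (p : MvPolynomial (Fin n) F) (v : Fin n → F) :
    lieAction p (Matrix.diagonal v) = ∑ i, v i • (X i * pderiv i p) := by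
  rw [lieAction_apply]
  refine Finset.sum_congr rfl fun i _ => ?_
  rw [Finset.sum_eq_single i]
  · simp
  · intro j _ hj; simp [hj.symm]
  · simp

/-- Each operator `x i * ∂/∂x i` scales a monomial by its `i`-th exponent. -/
theorem coeff_lieAction_diagonal (p : MvPolynomial (Fin n) F) (v : Fin n → F) (e : Fin n →₀ ℕ) :
    coeff e (lieAction p (Matrix.diagonal v)) = (∑ i, v i * e i) * coeff e p := by
  induction p using MvPolynomial.induction_on' with
  | monomial m a =>
    simp only [lieAction_diagonal, X_mul_pderiv_monomial, coeff_sum, coeff_smul, coeff_monomial,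
      Finset.sum_mul]
    refine Finset.sum_congr rfl fun i _ => ?_
    split_ifs with h
    · subst h; simp [mul_assoc]
    · simp
  | add p q hp hq => rw [lieAction_add, coeff_add, hp, hq, coeff_add, mul_add]

theorem prod_X_pow_eq_monomial' (α : ℕ) :
    (∏ i, X i : MvPolynomial (Fin n) F) ^ α =
      monomial (Finsupp.equivFunOnFinite.symm fun _ => α) 1 := by
  rw [monomial_eq, C_1, one_mul, Finsupp.prod_fintype _ _ (by simp), ← Finset.prod_pow]
  rfl

/-- An exponent occurring in `p` is orthogonal to every `v k`, hence constant; since its entries add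
up to `n * α`, each of them is `α`. -/
theorem eq_C_mul_of_lieAction_diagonal_eq_zero [CharZero F] {α m : ℕ} (hn : 1 ≤ n) (hm : m = n - 1)
    {p : MvPolynomial (Fin n) F} (hp : p.IsHomogeneous (n * α)) {v : Fin m → Fin n → F}
    (hv : LinearIndependent F v) (hsum : ∀ k, ∑ i, v k i = 0)
    (h : ∀ k, lieAction p (Matrix.diagonal (v k)) = 0) :
    ∃ c, p = C c * (∏ i, X i) ^ α := by
  refine ⟨coeff (Finsupp.equivFunOnFinite.symm fun _ => α) p, ?_⟩
  rw [prod_X_pow_eq_monomial']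
  ext e
  rw [coeff_C_mul, coeff_monomial]
  by_cases he : coeff e p = 0
  · split_ifs with h'
    · rw [h', mul_one]
    · rw [mul_zero, he]
  have hw : ∀ k, v k ⬝ᵥ (fun i => (e i : F)) = 0 := fun k => by
    have := coeff_lieAction_diagonal p (v k) e
    rw [h k, coeff_zero, zero_eq_mul] at this
    exact this.resolve_right he
  have hconst : ∀ i j, e i = e j := fun i j => by
    exact_mod_cast eq_of_dotProduct_eq_zero hm hv hsum hw i j
  have hdeg := hp he
  have heq : e = Finsupp.equivFunOnFinite.symm fun _ => α := by
    ext i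
    rw [Finsupp.weight_apply, Finsupp.sum_fintype _ _ (by simp)] at hdeg
    simp only [Pi.one_apply, smul_eq_mul, mul_one, hconst _ i, Finset.sum_const,
      Finset.card_univ, Fintype.card_fin] at hdeg
    exact Nat.eq_of_mul_eq_mul_left hn hdeg
  rw [if_pos heq.symm, mul_one, ← heq]

/-- The left-hand polynomial is the action of `b` on `∏ i, x i`. At a point whose only zero
coordinate is the `i`-th, just the `i`-th summand survives, which isolates row `i` off the diagonal;
the all-ones point then gives the trace. -/
theorem sum_erase_eq_zero_iff [CharZero F] (b : Matrix (Fin n) (Fin n) F) :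
    ∑ i, ∑ j, b i j • (X j * ∏ k ∈ Finset.univ.erase i, X k : MvPolynomial (Fin n) F) = 0 ↔
      (∃ v, b = Matrix.diagonal v) ∧ b.trace = 0 := by
  constructor
  · intro h
    have hev : ∀ y : Fin n → F,
        ∑ i, (∑ j, b i j * y j) * ∏ k ∈ Finset.univ.erase i, y k = 0 := fun y => by
      have := congrArg (eval y) h
      simpa [MvPolynomial.smul_eval, eval_prod, Finset.sum_mul, mul_assoc] using this
    have hoff : ∀ i (y : Fin n → F), (∀ k, k ≠ i → y k ≠ 0) → y i = 0 →
        ∑ j, b i j * y j = 0 := by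
      intro i y hy hi
      have h1 := hev y
      rw [Finset.sum_eq_single i] at h1
      · exact (mul_eq_zero.1 h1).resolve_right
          (Finset.prod_ne_zero_iff.2 fun k hk => hy k (Finset.ne_of_mem_erase hk))
      · intro j _ hj
        rw [Finset.prod_eq_zero (Finset.mem_erase.2 ⟨hj.symm, Finset.mem_univ i⟩) hi, mul_zero]
      · simp
    have hdiag : ∀ i j, i ≠ j → b i j = 0 := by
      intro i j hij
      -- Two test points that differ only in coordinate `j`, which is 1 in the first and 2 in the
      -- second; subtracting isolates `b i j`.
      have h1 := hoff i (Function.update (1 : Fin n → F) i 0) (fun k hk => by simp [hk]) (by simp)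
      have h2 := hoff i (Function.update (1 : Fin n → F) i 0 + Pi.single j 1) (fun k hk => by
        by_cases hkj : k = j
        · subst hkj; simp [hk, one_add_one_eq_two]
        · simp [hk, hkj]) (by simp [hij])
      simp only [Pi.add_apply, mul_add, Finset.sum_add_distrib, h1, zero_add] at h2
      simpa [Pi.single_apply] using h2
    refine ⟨⟨b.diag, ?_⟩, ?_⟩
    · ext i j
      by_cases hij : i = j
      · subst hij; simp
      · simp [hij, hdiag i j hij]
    · have h1 := hev 1
      simp only [Pi.one_apply, mul_one, Finset.prod_const_one] at h1
      rw [Matrix.trace, ← h1]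
      refine Finset.sum_congr rfl fun i _ => ?_
      rw [Finset.sum_eq_single i (fun j _ hj => hdiag i j hj.symm) (by simp)]
      rfl
  · rintro ⟨⟨v, rfl⟩, ht⟩
    have h1 : ∀ i, ∑ j, Matrix.diagonal v i j •
        (X j * ∏ k ∈ Finset.univ.erase i, X k : MvPolynomial (Fin n) F) = v i • ∏ k, X k := by
      intro i
      rw [Finset.sum_eq_single i]
      · rw [Matrix.diagonal_apply_eq, Finset.mul_prod_erase _ _ (Finset.mem_univ i)]
      · intro j _ hj; simp [hj.symm]
      · simp
    rw [Matrix.trace_diagonal] at ht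
    rw [Finset.sum_congr rfl fun i _ => h1 i, ← Finset.sum_smul, ht, zero_smul]

/-- With `m = (∏ i, x i) ^ α` one has `x i * ∂m/∂x i = α * m`. Multiplying by `∏ i, x i` clears the
denominators, and the factor `α * m` cancels in characteristic 0. -/
theorem lieAction_prod_X_pow_eq_zero_iff [CharZero F] {α : ℕ} (hα : 1 ≤ α)
    (b : Matrix (Fin n) (Fin n) F) :
    lieAction ((∏ i, X i) ^ α) b = 0 ↔ (∃ v, b = Matrix.diagonal v) ∧ b.trace = 0 := by
  rw [← sum_erase_eq_zero_iff]
  have hX : (∏ i, X i : MvPolynomial (Fin n) F) ≠ 0 :=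
    Finset.prod_ne_zero_iff.2 fun i _ => X_ne_zero i
  have hder : ∀ i, (X i : MvPolynomial (Fin n) F) * pderiv i ((∏ i, X i) ^ α) =
      (α : MvPolynomial (Fin n) F) * (∏ i, X i) ^ α := by
    intro i
    rw [prod_X_pow_eq_monomial', X_mul_pderiv_monomial]
    simp
  have h : (∏ i, X i) * lieAction ((∏ i, X i) ^ α) b =
      ((α : MvPolynomial (Fin n) F) * (∏ i, X i) ^ α) *
        ∑ i, ∑ j, b i j • (X j * ∏ k ∈ Finset.univ.erase i, X k) := by
    rw [lieAction_apply, Finset.mul_sum, Finset.mul_sum]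
    refine Finset.sum_congr rfl fun i _ => ?_
    rw [Finset.mul_sum, Finset.mul_sum]
    refine Finset.sum_congr rfl fun j _ => ?_
    rw [← hder i, ← Finset.mul_prod_erase _ _ (Finset.mem_univ i), mul_smul_comm, mul_smul_comm]
    congr 1
    ring
  have hα0 : (α : MvPolynomial (Fin n) F) ≠ 0 := by
    exact_mod_cast (by omega : α ≠ 0)
  constructor
  · intro h0
    rw [h0, mul_zero, zero_eq_mul] at h
    exact h.resolve_left (mul_ne_zero hα0 (pow_ne_zero _ hX))
  · intro h0
    rw [h0, mul_zero, mul_eq_zero] at h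
    exact h.resolve_left hX

end Monomials

/-! ### Diagonalization -/

section Diagonalization

variable {K L : Type*} [Field K] [Field L] [Algebra K L] {n : ℕ}

theorem mul_aeval_map_eq_diagonal_mul {A : Matrix (Fin n) (Fin n) L} {M : Matrix (Fin n) (Fin n) K}
    {v : Fin n → L} (h : A * M.map (algebraMap K L) = Matrix.diagonal v * A) (p : Polynomial K) :
    A * (Polynomial.aeval M p).map (algebraMap K L) =
      Matrix.diagonal (fun i => Polynomial.aeval (v i) p) * A := by
  induction p using Polynomial.induction_on' with
  | add p q hp hq =>
    rw [map_add, Matrix.map_add _ (map_add _), mul_add, hp, hq, ← add_mul, Matrix.diagonal_add]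
    simp
  | monomial k a =>
    have hpow : ∀ k : ℕ, A * (M ^ k).map (algebraMap K L) =
        Matrix.diagonal (fun i => v i ^ k) * A := by
      intro k
      induction k with
      | zero => simp [Matrix.map_one]
      | succ k ih =>
        rw [pow_succ, Matrix.map_mul, ← mul_assoc, ih, mul_assoc, h, ← mul_assoc,
          Matrix.diagonal_mul_diagonal]
        simp [pow_succ]
    rw [Polynomial.aeval_monomial, ← Algebra.smul_def]
    have h1 : (a • M ^ k).map (algebraMap K L) = algebraMap K L a • (M ^ k).map (algebraMap K L) := by
      ext i j; simp
    rw [h1, mul_smul_comm, hpow, ← smul_mul_assoc]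
    congr 1
    ext i j
    by_cases hij : i = j
    · subst hij; simp [Polynomial.aeval_monomial]
    · simp [hij]

/-- If `x ^ 2 * r` is the minimal polynomial, then `(x * r) ^ 2` annihilates `M`, hence vanishes at
every diagonal entry. So does `x * r`, which therefore annihilates `M`, and by minimality `x` is a
unit. Over a perfect field, squarefree means separable. -/
theorem separable_minpoly_of_mul_eq_diagonal_mul [CharZero K] {A : Matrix (Fin n) (Fin n) L}
    (hA : IsUnit A) {M : Matrix (Fin n) (Fin n) K} {v : Fin n → L}
    (h : A * M.map (algebraMap K L) = Matrix.diagonal v * A) : (minpoly K M).Separable := by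
  rw [PerfectField.separable_iff_squarefree]
  have hint : IsIntegral K M := Matrix.isIntegral _
  rintro x ⟨r, hr⟩
  have h1 : Polynomial.aeval M ((x * r) ^ 2) = 0 := by
    rw [show (x * r) ^ 2 = minpoly K M * r by rw [hr]; ring, map_mul, minpoly.aeval, zero_mul]
  have h2 := mul_aeval_map_eq_diagonal_mul h ((x * r) ^ 2)
  rw [h1, Matrix.map_zero _ (map_zero _), mul_zero, eq_comm, hA.mul_left_eq_zero] at h2
  have h3 : ∀ i, Polynomial.aeval (v i) (x * r) = 0 := fun i => by
    have := congrFun (congrFun h2 i) i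
    rw [Matrix.diagonal_apply_eq, map_pow] at this
    exact pow_eq_zero_iff two_ne_zero |>.1 this
  have h4 := mul_aeval_map_eq_diagonal_mul h (x * r)
  simp only [h3, Matrix.diagonal_zero, zero_mul] at h4
  rw [hA.mul_right_eq_zero] at h4
  have h5 : Polynomial.aeval M (x * r) = 0 :=
    Matrix.map_injective (algebraMap K L).injective (h4.trans (by ext; simp))
  obtain ⟨c, hc⟩ := minpoly.dvd K M h5
  have hxr : x * r ≠ 0 := by
    intro h0
    exact minpoly.ne_zero hint (by rw [hr, mul_assoc, h0, mul_zero])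
  refine IsUnit.of_mul_eq_one c (mul_right_cancel₀ hxr ?_)
  rw [one_mul]
  nth_rw 2 [hc]
  rw [hr]
  ring

/-- Over an algebraically closed field the joint generalized eigenspaces of commuting endomorphisms
span. Separability makes each endomorphism semisimple, so these are genuine joint eigenspaces. -/
theorem exists_isUnit_mul_eq_mul_diagonal [IsAlgClosed L] {ι : Type*}
    (M : ι → Matrix (Fin n) (Fin n) K) (hcomm : ∀ k l, M k * M l = M l * M k)
    (hsep : ∀ k, (minpoly K (M k)).Separable) :
    ∃ Q : Matrix (Fin n) (Fin n) L, IsUnit Q ∧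
      ∃ v : ι → Fin n → L, ∀ k, (M k).map (algebraMap K L) * Q = Q * Matrix.diagonal (v k) := by
  classical
  set T : ι → Module.End L (Fin n → L) := fun k => Matrix.toLin' ((M k).map (algebraMap K L))
    with hT
  have haev : ∀ k, Polynomial.aeval (T k) ((minpoly K (M k)).map (algebraMap K L)) = 0 := by
    intro k
    have h1 : Polynomial.aeval ((M k).map (algebraMap K L))
        ((minpoly K (M k)).map (algebraMap K L)) = 0 := by
      rw [Polynomial.aeval_map_algebraMap]
      have := Polynomial.aeval_algHom_apply ((Algebra.ofId K L).mapMatrix (m := Fin n)) (M k)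
        (minpoly K (M k))
      rw [minpoly.aeval, map_zero] at this
      exact this
    have h2 := Polynomial.aeval_algHom_apply
      (Matrix.toLinAlgEquiv' (R := L) (n := Fin n)).toAlgHom ((M k).map (algebraMap K L))
      ((minpoly K (M k)).map (algebraMap K L))
    rw [h1, map_zero] at h2
    exact h2
  have hss : ∀ k, (T k).IsSemisimple := fun k =>
    Module.End.isSemisimple_of_squarefree_aeval_eq_zero ((hsep k).map.squarefree) (haev k)
  have htop := Module.End.iSup_iInf_maxGenEigenspace_eq_top_of_iSup_maxGenEigenspace_eq_top_of_commute
    T (fun k l _ => by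
      show T k * T l = T l * T k
      simp only [hT, Module.End.mul_eq_comp, ← Matrix.toLin'_mul, ← Matrix.map_mul, hcomm k l])
    (fun k => Module.End.iSup_maxGenEigenspace_eq_top (T k))
  set E : Set (Fin n → L) := {x | ∃ χ : ι → L, ∀ k, T k x = χ k • x} with hE
  have hspan : ⊤ ≤ Submodule.span L E := by
    rw [← htop]
    refine iSup_le fun χ x hx => Submodule.subset_span ⟨χ, fun k => ?_⟩
    have := (Submodule.mem_iInf _).1 hx k
    rw [(hss k).isFinitelySemisimple.maxGenEigenspace_eq_eigenspace] at this
    exact Module.End.mem_eigenspace_iff.1 this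
  -- A basis extracted from the spanning set `E` of joint eigenvectors; its members become the
  -- columns of `Q`.
  let b := Module.Basis.ofSpan hspan
  have : Finite _ := Module.Finite.finite_basis b
  have := Fintype.ofFinite
    ((linearIndepOn_empty L (id : (Fin n → L) → Fin n → L)).extend (Set.empty_subset E))
  have hcard := Module.finrank_eq_card_basis b
  rw [Module.finrank_fin_fun] at hcard
  let b' := b.reindex (Fintype.equivFinOfCardEq hcard.symm)
  have hb' : ∀ j, b' j ∈ E := fun j => Module.Basis.ofSpan_subset hspan (by simp [b', b])
  choose χ hχ using hb'
  refine ⟨Matrix.of fun i j => b' j i, ?_, fun k j => χ j k, fun k => ?_⟩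
  · have hli := b'.linearIndependent
    rw [← Matrix.isUnit_transpose, ← Matrix.linearIndependent_rows_iff_isUnit]
    exact hli
  · ext i j
    rw [Matrix.mul_diagonal]
    have := congrFun (hχ j k) i
    simp only [hT, Matrix.toLin'_apply, Pi.smul_apply, smul_eq_mul] at this
    rw [Matrix.of_apply, mul_comm, ← this]
    rfl

end Diagonalization

end LinFact

namespace LinFact

open MvPolynomial

/-! ### From commuting diagonalizable matrices to linear forms -/

section Factorization

variable {K L : Type u} [Field K] [Field L] [Algebra K L] {n α : ℕ}

theorem isFactorization_iff (f : MvPolynomial (Fin n) K) (l : Fin n → Fin n → L) :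
    IsFactorization f α l ↔
      IsUnit (Matrix.of l) ∧ map (algebraMap K L) f = subst (Matrix.of l) ((∏ i, X i) ^ α) := by
  rw [IsFactorization, ← Matrix.linearIndependent_rows_iff_isUnit]
  simp only [map_pow, map_prod, subst_X, MvPolynomial.smul_eq_C_mul, Matrix.of_apply]
  rfl

theorem isFactorization_rescale (hn : 1 ≤ n) (hα : 1 ≤ α) {f : MvPolynomial (Fin n) K}
    {A : Matrix (Fin n) (Fin n) L} (hA : IsUnit A) {c r : L} (hc : c ≠ 0) (hr : r ^ α = c)
    (h : map (algebraMap K L) f = C c * subst A ((∏ i, X i) ^ α)) :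
    IsFactorization f α fun i j => if (i : ℕ) = 0 then r * A i j else A i j := by
  have hr0 : r ≠ 0 := by
    rintro rfl
    exact hc (by rw [← hr, zero_pow (by omega)])
  refine ⟨?_, ?_⟩
  · have h1 := (Matrix.linearIndependent_rows_iff_isUnit.2 hA).units_smul
      (fun i : Fin n => if (i : ℕ) = 0 then Units.mk0 r hr0 else 1)
    convert h1 using 2 with i
    by_cases hi : (i : ℕ) = 0
    · ext j; simp [hi, Units.smul_def]
    · ext j; simp [hi]
  · have h1 : ∀ i : Fin n,
        ∑ j, C (if (i : ℕ) = 0 then r * A i j else A i j) * (X j : MvPolynomial (Fin n) L) =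
          (if i = ⟨0, hn⟩ then C r else 1) * ∑ j, A i j • (X j : MvPolynomial (Fin n) L) := by
      intro i
      by_cases hi : i = ⟨0, hn⟩
      · subst hi
        simp [Finset.mul_sum, mul_assoc, MvPolynomial.smul_eq_C_mul]
      · have : (i : ℕ) ≠ 0 := fun h => hi (Fin.ext h)
        simp [hi, this, MvPolynomial.smul_eq_C_mul]
    rw [h, Finset.prod_congr rfl fun i _ => h1 i, Finset.prod_mul_distrib, mul_pow,
      Finset.prod_ite_eq' Finset.univ, if_pos (Finset.mem_univ _), ← C_pow, hr]
    simp only [map_pow, map_prod, subst_X]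

theorem linearIndependent_map_matrix {ι : Type*} {B : ι → Matrix (Fin n) (Fin n) K}
    (hB : LinearIndependent K B) :
    LinearIndependent L fun k => (B k).map (algebraMap K L) := by
  have h1 := hB.map' (vecToMatrix K n).symm.toLinearMap (LinearEquiv.ker _)
  have h2 := (linearIndependent_algebraMap_comp_iff (S := L)).2 h1
  have h3 : (fun k => (B k).map (algebraMap K L)) = (vecToMatrix L n).toLinearMap ∘
      fun k => algebraMap K L ∘ ((vecToMatrix K n).symm.toLinearMap ∘ B) k := by
    funext k
    ext i j
    have := congrFun (congrFun ((vecToMatrix K n).apply_symm_apply (B k)) i) j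
    rw [vecToMatrix_apply] at this
    rw [Function.comp_apply, LinearEquiv.coe_coe, vecToMatrix_apply, Matrix.map_apply, ← this]
    rfl
  rw [h3]
  exact h2.map' (vecToMatrix L n).toLinearMap (LinearEquiv.ker _)

/-- The linear map `w ↦ Q * diagonal w * Q⁻¹` sends `v k` to `B k`, so a dependence among the `v k`
would pass to the `B k`. -/
theorem linearIndependent_of_mul_eq_mul_diagonal {ι : Type*} {B : ι → Matrix (Fin n) (Fin n) L}
    (hB : LinearIndependent L B) {Q : Matrix (Fin n) (Fin n) L} (hQ : IsUnit Q)
    {v : ι → Fin n → L} (h : ∀ k, B k * Q = Q * Matrix.diagonal (v k)) :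
    LinearIndependent L v := by
  have hdet := (Matrix.isUnit_iff_isUnit_det Q).1 hQ
  refine LinearIndependent.of_comp ((LinearMap.mulRight L Q⁻¹).comp ((LinearMap.mulLeft L Q).comp
    (Matrix.diagonalLinearMap (Fin n) L L))) ?_
  have h1 : ((LinearMap.mulRight L Q⁻¹).comp ((LinearMap.mulLeft L Q).comp
      (Matrix.diagonalLinearMap (Fin n) L L))) ∘ v = B := by
    funext k
    simp [Matrix.diagonalLinearMap, ← h, Matrix.mul_nonsing_inv_cancel_right _ _ hdet]
  rw [h1]
  exact hB

theorem trace_eq_sum_of_mul_eq_mul_diagonal {B Q : Matrix (Fin n) (Fin n) L} (hQ : IsUnit Q)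
    {v : Fin n → L} (h : B * Q = Q * Matrix.diagonal v) : B.trace = ∑ i, v i := by
  have hdet := (Matrix.isUnit_iff_isUnit_det Q).1 hQ
  rw [← Matrix.trace_diagonal, ← Matrix.mul_nonsing_inv_cancel_right Q B hdet, h,
    Matrix.trace_mul_cycle, Matrix.nonsing_inv_mul _ hdet, one_mul]

/-- A polynomial whose Lie algebra contains sufficiently many commuting diagonalizable matrices of
trace zero is a power of a product of linear forms. -/
theorem exists_isFactorization [CharZero K] [IsAlgClosed L] (hn : 1 ≤ n) (hα : 1 ≤ α)
    {f : MvPolynomial (Fin n) K} (hf : f.IsHomogeneous (n * α)) (hf0 : f ≠ 0) {m : ℕ}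
    (hm : m = n - 1) {B : Fin m → Matrix (Fin n) (Fin n) K} (hB : LinearIndependent K B)
    (hLie : ∀ k, lieAction f (B k) = 0) (hcomm : ∀ k l, B k * B l = B l * B k)
    (htrace : ∀ k, (B k).trace = 0) (hsep : ∀ k, (minpoly K (B k)).Separable) :
    ∃ l : Fin n → Fin n → L, IsFactorization f α l := by
  have : CharZero L := charZero_of_injective_algebraMap (algebraMap K L).injective
  obtain ⟨Q, hQ, v, hv⟩ := exists_isUnit_mul_eq_mul_diagonal (L := L) B hcomm hsep
  have hdet := (Matrix.isUnit_iff_isUnit_det Q).1 hQ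
  have hvli := linearIndependent_of_mul_eq_mul_diagonal (linearIndependent_map_matrix hB) hQ hv
  have hsum : ∀ k, ∑ i, v k i = 0 := fun k => by
    rw [← trace_eq_sum_of_mul_eq_mul_diagonal hQ (hv k), ← AddMonoidHom.map_trace, htrace, map_zero]
  -- In the coordinates of the joint eigenbasis, the Lie algebra contains the diagonal matrices with
  -- entries `v k`.
  have hLie' : ∀ k, lieAction (subst Q (map (algebraMap K L) f)) (Matrix.diagonal (v k)) = 0 :=
    fun k => by rw [lieAction_subst (hv k).symm, lieAction_map, hLie, map_zero, map_zero]
  obtain ⟨c, hc⟩ := eq_C_mul_of_lieAction_diagonal_eq_zero hn hm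
    (subst_isHomogeneous Q (hf.map (algebraMap K L))) hvli hsum hLie'
  have hfac : map (algebraMap K L) f = C c * subst Q⁻¹ ((∏ i, X i) ^ α) := by
    have h1 := subst_subst Q⁻¹ Q (map (algebraMap K L) f)
    rw [Matrix.mul_nonsing_inv _ hdet, subst_one, hc, map_mul] at h1
    rw [← h1]
    congr 1
    exact (subst Q⁻¹).commutes c
  have hc0 : c ≠ 0 := by
    rintro rfl
    rw [C_0, zero_mul] at hfac
    exact hf0 ((map_injective _ (algebraMap K L).injective) (by rw [hfac, map_zero]))
  obtain ⟨r, hr⟩ := IsAlgClosed.exists_pow_nat_eq c (show 0 < α by omega)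
  exact ⟨_, isFactorization_rescale hn hα (Matrix.isUnit_nonsing_inv_iff.2 hQ) hc0 hr hfac⟩

/-! ### The Lie algebra of a power of a product of linear forms -/

/-- Substituting the forms `l` is invertible and carries `b` to its conjugate by the matrix of `l`,
which reduces the claim to `(∏ i, x i) ^ α`. -/
theorem lieAction_eq_zero_iff_of_isFactorization [CharZero K] (hα : 1 ≤ α)
    {f : MvPolynomial (Fin n) K} {l : Fin n → Fin n → L} (hl : IsFactorization f α l)
    (b : Matrix (Fin n) (Fin n) L) :
    lieAction (map (algebraMap K L) f) b = 0 ↔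
      ∃ v, Matrix.of l * b = Matrix.diagonal v * Matrix.of l ∧ ∑ i, v i = 0 := by
  have : CharZero L := charZero_of_injective_algebraMap (algebraMap K L).injective
  obtain ⟨hA, hf⟩ := (isFactorization_iff f l).1 hl
  generalize Matrix.of l = A at hA hf ⊢
  have hdet := (Matrix.isUnit_iff_isUnit_det A).1 hA
  have hinj : ∀ p, subst A p = 0 ↔ p = 0 := fun p => by
    refine ⟨fun h => ?_, fun h => by rw [h, map_zero]⟩
    have := subst_subst A⁻¹ A p
    rwa [h, map_zero, Matrix.mul_nonsing_inv _ hdet, subst_one, eq_comm] at this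
  rw [hf, lieAction_subst (b' := A * b * A⁻¹)
    (by rw [mul_assoc _ A⁻¹, Matrix.nonsing_inv_mul _ hdet, mul_one]), hinj,
    lieAction_prod_X_pow_eq_zero_iff hα]
  constructor
  · rintro ⟨⟨v, hv⟩, ht⟩
    refine ⟨v, ?_, by rwa [hv, Matrix.trace_diagonal] at ht⟩
    rw [← hv, mul_assoc _ A⁻¹, Matrix.nonsing_inv_mul _ hdet, mul_one]
  · rintro ⟨v, hv, ht⟩
    rw [hv, Matrix.mul_nonsing_inv_cancel_right _ _ hdet, Matrix.trace_diagonal]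
    exact ⟨⟨v, rfl⟩, ht⟩

/-- Linear equations over `K` acquire no new solutions over `L` beyond the `L`-span: expanding the
entries of `x` in a `K`-basis `ω` of `L`, each coordinate matrix `y t` is a solution over `K`. -/
theorem mem_span_of_lieAction_map_eq_zero {f : MvPolynomial (Fin n) K} {m : ℕ}
    {B : Fin m → Matrix (Fin n) (Fin n) K}
    (hspan : ∀ x, lieAction f x = 0 → x ∈ Submodule.span K (Set.range B))
    {x : Matrix (Fin n) (Fin n) L} (hx : lieAction (map (algebraMap K L) f) x = 0) :
    x ∈ Submodule.span L (Set.range fun k => (B k).map (algebraMap K L)) := by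
  classical
  let ω := Module.Basis.ofVectorSpace K L
  let y : _ → Matrix (Fin n) (Fin n) K := fun t => Matrix.of fun i j => ω.repr (x i j) t
  have hy : ∀ t, lieAction f (y t) = 0 := by
    intro t
    ext e
    have h1 := congrArg (ω.coord t) (congrArg (coeff e) hx)
    simp only [lieAction_apply, pderiv_map, coeff_sum, coeff_smul, map_sum, coeff_zero,
      map_zero] at h1 ⊢
    rw [← h1]
    refine Finset.sum_congr rfl fun i _ => Finset.sum_congr rfl fun j _ => ?_
    have h2 : (X j : MvPolynomial (Fin n) L) * map (algebraMap K L) (pderiv i f) =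
        map (algebraMap K L) (X j * pderiv i f) := by simp
    rw [h2, coeff_map, smul_eq_mul, smul_eq_mul, mul_comm (x i j), ← Algebra.smul_def, map_smul,
      mul_comm]
    rfl
  have hyB : ∀ t, (y t).map (algebraMap K L) ∈
      Submodule.span L (Set.range fun k => (B k).map (algebraMap K L)) := by
    intro t
    obtain ⟨a, ha⟩ := (Submodule.mem_span_range_iff_exists_fun K).1 (hspan _ (hy t))
    refine (Submodule.mem_span_range_iff_exists_fun L).2 ⟨fun k => algebraMap K L (a k), ?_⟩
    rw [← ha]
    ext i j
    simp only [Matrix.smul_apply, smul_eq_mul, map_mul, Matrix.map_apply, Matrix.sum_apply, map_sum]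
  -- `ω` may be infinite, but the finitely many entries of `x` involve finitely many basis elements.
  let S := Finset.univ.biUnion fun q : Fin n × Fin n => (ω.repr (x q.1 q.2)).support
  have hxs : x = ∑ t ∈ S, ω t • (y t).map (algebraMap K L) := by
    ext i j
    rw [Matrix.sum_apply]
    conv_lhs => rw [← ω.linearCombination_repr (x i j), Finsupp.linearCombination_apply,
      Finsupp.sum_of_support_subset _ (s := S) (fun t ht =>
        Finset.mem_biUnion.2 ⟨(i, j), Finset.mem_univ _, ht⟩) _ (by simp)]
    refine Finset.sum_congr rfl fun t _ => ?_
    simp [y, Algebra.smul_def, mul_comm]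
  rw [hxs]
  exact Submodule.sum_mem _ fun t _ => Submodule.smul_mem _ _ (hyB t)

/-- Two dimension counts give `m = n - 1`: the weights `v k` are independent in the hyperplane of
sum zero, and conversely every conjugated diagonal matrix of trace zero lies in the `L`-span of the
`m` matrices. -/
theorem exists_weights_of_isFactorization [CharZero K] (hn : 1 ≤ n) (hα : 1 ≤ α)
    {f : MvPolynomial (Fin n) K} {l : Fin n → Fin n → L} (hl : IsFactorization f α l) {m : ℕ}
    {B : Fin m → Matrix (Fin n) (Fin n) K} (hB : LinearIndependent K B)
    (hspan : ∀ x, x ∈ Submodule.span K (Set.range B) ↔ lieAction f x = 0) :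
    m = n - 1 ∧ ∃ v : Fin m → Fin n → L, LinearIndependent L v ∧ (∀ k, ∑ i, v k i = 0) ∧
      ∀ k, Matrix.of l * (B k).map (algebraMap K L) = Matrix.diagonal (v k) * Matrix.of l := by
  have hiff := lieAction_eq_zero_iff_of_isFactorization hα hl
  obtain ⟨hA, -⟩ := (isFactorization_iff f l).1 hl
  generalize Matrix.of l = A at hA hiff ⊢
  have hdet := (Matrix.isUnit_iff_isUnit_det A).1 hA
  have hv : ∀ k, ∃ v, A * (B k).map (algebraMap K L) = Matrix.diagonal v * A ∧ ∑ i, v i = 0 :=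
    fun k => (hiff _).1 (by
      rw [lieAction_map, (hspan (B k)).1 (Submodule.subset_span ⟨k, rfl⟩), map_zero])
  choose v hv hsum using hv
  have hli : LinearIndependent L v :=
    linearIndependent_of_mul_eq_mul_diagonal (linearIndependent_map_matrix hB)
      (Matrix.isUnit_nonsing_inv_iff.2 hA) fun k => by
        have h1 := congrArg (fun M => A⁻¹ * M * A⁻¹) (hv k)
        simpa [mul_assoc, Matrix.mul_nonsing_inv _ hdet, Matrix.nonsing_inv_mul_cancel_left _ _ hdet]
          using h1
  set T := LinearMap.ker (∑ i, LinearMap.proj i : (Fin n → L) →ₗ[L] L) with hT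
  have hTfin : Module.finrank L T = n - 1 := finrank_sum_eq_zero hn
  refine ⟨le_antisymm ?_ ?_, v, hli, hsum, hv⟩
  · have hli' : LinearIndependent L fun k => (⟨v k, by simpa [hT] using hsum k⟩ : T) :=
      LinearIndependent.of_comp T.subtype hli
    have := hli'.fintype_card_le_finrank
    rwa [hTfin, Fintype.card_fin] at this
  · let g : (Fin n → L) →ₗ[L] Matrix (Fin n) (Fin n) L :=
      (LinearMap.mulRight L A).comp ((LinearMap.mulLeft L A⁻¹).comp
        (Matrix.diagonalLinearMap (Fin n) L L))
    have hgv : ∀ x, g x = A⁻¹ * Matrix.diagonal x * A := fun x => rfl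
    have hAg : ∀ x, A * g x = Matrix.diagonal x * A := fun x => by
      rw [hgv, mul_assoc, Matrix.mul_nonsing_inv_cancel_left _ _ hdet]
    have hg : Function.Injective g := fun x y hxy => by
      have := hAg x
      rw [hxy, hAg] at this
      exact (Matrix.diagonal_injective (hA.mul_left_injective this)).symm
    have hle : T.map g ≤ Submodule.span L (Set.range fun k => (B k).map (algebraMap K L)) := by
      rintro _ ⟨x, hx, rfl⟩
      refine mem_span_of_lieAction_map_eq_zero (fun z hz => (hspan z).2 hz)
        ((hiff _).2 ⟨x, hAg x, ?_⟩)
      simpa [hT] using hx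
    have h1 := Submodule.finrank_mono hle
    rw [← (Submodule.equivMapOfInjective g hg T).finrank_eq, hTfin] at h1
    refine h1.trans ((finrank_range_le_card _).trans ?_)
    rw [Fintype.card_fin]

/-- Otherwise the difference of the `i`-th and `j`-th unit vectors would be orthogonal to all `v k`,
hence constant, giving `1 = -1`. Thus a generic combination has distinct eigenvalues. -/
theorem exists_weight_ne [CharZero L] {m : ℕ} (hm : m = n - 1) {v : Fin m → Fin n → L}
    (hv : LinearIndependent L v) (hsum : ∀ k, ∑ i, v k i = 0) {i j : Fin n} (hij : i ≠ j) :
    ∃ k, v k i ≠ v k j := by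
  by_contra! h
  have h1 := eq_of_dotProduct_eq_zero hm hv hsum
    (w := Pi.single i 1 - Pi.single j 1) (fun k => by simp [dotProduct_sub, h k]) i j
  simp [hij, hij.symm] at h1
  exact (two_ne_zero (α := L)) (by linear_combination h1)

/-- Commutation and trace zero are visible after diagonalization over `L` and descend to `K`, since
`K → L` is injective. -/
theorem isAccepted_of_isFactorization [CharZero K] {B : List (Matrix (Fin n) (Fin n) K)}
    (hlen : B.length = n - 1) {A : Matrix (Fin n) (Fin n) L} (hA : IsUnit A)
    (h : ∀ b ∈ B, ∃ v, A * b.map (algebraMap K L) = Matrix.diagonal v * A ∧ ∑ i, v i = 0) :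
    IsAccepted B := by
  have hdet := (Matrix.isUnit_iff_isUnit_det A).1 hA
  refine ⟨hlen, fun b hb b' hb' => ?_, fun b hb => ?_, fun b hb => ?_⟩
  · obtain ⟨v, hv, -⟩ := h b hb
    obtain ⟨v', hv', -⟩ := h b' hb'
    have hmul : ∀ {b b' : Matrix (Fin n) (Fin n) K} {v v' : Fin n → L},
        A * b.map (algebraMap K L) = Matrix.diagonal v * A →
        A * b'.map (algebraMap K L) = Matrix.diagonal v' * A →
        A * (b * b').map (algebraMap K L) = Matrix.diagonal (fun i => v i * v' i) * A := by
      intro b b' v v' h h'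
      rw [Matrix.map_mul, ← mul_assoc, h, mul_assoc, h', ← mul_assoc,
        Matrix.diagonal_mul_diagonal]
    refine Matrix.map_injective (algebraMap K L).injective (hA.mul_right_injective ?_)
    show A * _ = A * _
    rw [hmul hv hv', hmul hv' hv]
    simp only [mul_comm]
  · obtain ⟨v, hv, hsum⟩ := h b hb
    have h1 : b.map (algebraMap K L) * A⁻¹ = A⁻¹ * Matrix.diagonal v := by
      have h1 := congrArg (fun M => A⁻¹ * M * A⁻¹) hv
      simpa [mul_assoc, Matrix.mul_nonsing_inv _ hdet, Matrix.nonsing_inv_mul_cancel_left _ _ hdet]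
        using h1
    have h2 := trace_eq_sum_of_mul_eq_mul_diagonal (Matrix.isUnit_nonsing_inv_iff.2 hA) h1
    rw [hsum, ← AddMonoidHom.map_trace] at h2
    exact (map_eq_zero (algebraMap K L)).1 h2
  · obtain ⟨v, hv, -⟩ := h b hb
    exact separable_minpoly_of_mul_eq_diagonal_mul hA hv

end Factorization

end LinFact

namespace LinFact

open MvPolynomial

/-! ### Step 4: the left eigenspaces recover the linear forms up to scalars -/

section Diagonalize

variable {K L : Type u} [Field K] [Field L] [Algebra K L] {n : ℕ} (f : (Fin n → K) → K)

theorem exists_eq_ofFn {β : Type*} {l : List β} {m : ℕ} (h : l.length = m) :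
    ∃ g : Fin m → β, l = List.ofFn g := by
  subst h
  exact ⟨l.get, (List.ofFn_get l).symm⟩

theorem linearIndependent_of_get_ofFn {F V : Type*} [Field F] [AddCommGroup V] [Module F V]
    {m : ℕ} {g : Fin m → V} (h : LinearIndependent F (List.ofFn g).get) :
    LinearIndependent F g := by
  have h1 : g = (List.ofFn g).get ∘ Fin.cast List.length_ofFn.symm := by
    funext i; simp
  rw [h1]
  exact h.comp _ (Fin.cast_injective _)

theorem setOf_mem_ofFn {β : Type*} {m : ℕ} (g : Fin m → β) :
    {x | x ∈ List.ofFn g} = Set.range g := by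
  ext x; simp

theorem zip_ofFn {β γ : Type*} {m : ℕ} (g : Fin m → β) (h : Fin m → γ) :
    (List.ofFn g).zip (List.ofFn h) = List.ofFn fun i => (g i, h i) := by
  apply List.ext_getElem <;> simp

theorem eval_combination (t : Fin (n - 1) → K) (B : Fin (n - 1) → Fin n → Fin n → K) :
    Prog.eval (K := K) (L := L) (α := no_index _) f (combination t (List.ofFn B)) =
      Matrix.of.symm (∑ k, t k • Matrix.of (B k)) := by
  ext i j
  simp [combination, zip_ofFn, List.map_ofFn, List.sum_ofFn, Op.eval, Matrix.sum_apply]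

theorem mem_span_leftEigenspace (R : Fin n → Fin n → K) (μ : L) (x : Fin n → L) :
    x ∈ Submodule.span L {y | y ∈ (leftEigenspace (X := Val K L) R μ).eval f} ↔
      Matrix.vecMul x ((Matrix.of R).map (algebraMap K L)) = μ • x := by
  have h := mem_span_eval_kernel (K := K) (L := L) (s := .ext) f (List.ofFn fun j i : Fin n =>
    if i = j then algebraMap K L (R i j) - μ else algebraMap K L (R i j)) x
  have h1 : (leftEigenspace (X := Val K L) R μ).eval f =
      (kernel (X := Val K L) (n := n) (s := .ext) n (List.ofFn fun j i : Fin n =>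
        if i = j then algebraMap K L (R i j) - μ else algebraMap K L (R i j))).eval f := by
    simp only [leftEigenspace, Prog.eval_bind, eval_tabulate]
    congr 4
    funext j i
    split_ifs <;> simp [Op.eval]
  rw [h1]
  refine h.trans ?_
  rw [List.forall_mem_ofFn_iff, funext_iff]
  refine forall_congr' fun j => ?_
  have h2 : (fun i : Fin n => if i = j then algebraMap K L (R i j) - μ else
      algebraMap K L (R i j)) ⬝ᵥ x =
      Matrix.vecMul x ((Matrix.of R).map (algebraMap K L)) j - μ * x j := by
    have h3 : ∀ i, (if i = j then algebraMap K L (R i j) - μ else algebraMap K L (R i j)) * x i =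
        x i * algebraMap K L (R i j) - if i = j then μ * x i else 0 := by
      intro i
      split_ifs <;> ring
    simp [Matrix.vecMul, dotProduct, h3]
  exact (Eq.congr_left h2).trans sub_eq_zero

theorem linearIndependent_leftEigenspace (R : Fin n → Fin n → K) (μ : L) :
    LinearIndependent L ((leftEigenspace (X := Val K L) R μ).eval f).get := by
  have h1 : ∃ rs : List (Fin n → L), (leftEigenspace (X := Val K L) R μ).eval f =
      (kernel (X := Val K L) (n := n) (s := .ext) n rs).eval f :=
    ⟨_, by rw [leftEigenspace, Prog.eval_bind]⟩
  obtain ⟨rs, hrs⟩ := h1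
  rw [hrs]
  exact linearIndependent_eval_kernel (s := .ext) f rs

theorem exists_eq_singleton_smul {F V : Type*} [Field F] [AddCommGroup V] [Module F V]
    {l : List V} (hl : LinearIndependent F l.get) {a : V} (ha : a ≠ 0)
    (hspan : ∀ x, x ∈ Submodule.span F {y | y ∈ l} ↔ ∃ c : F, x = c • a) :
    ∃ c : F, c ≠ 0 ∧ l = [c • a] := by
  have hS : Submodule.span F (Set.range l.get) = Submodule.span F {a} := by
    ext x
    rw [Set.range_list_get, hspan, Submodule.mem_span_singleton]
    simp only [eq_comm]
  have h1 := finrank_span_eq_card hl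
  rw [hS, finrank_span_singleton ha, Fintype.card_fin, eq_comm, List.length_eq_one_iff] at h1
  obtain ⟨x, rfl⟩ := h1
  obtain ⟨c, rfl⟩ := (hspan x).1 (Submodule.subset_span (by simp))
  refine ⟨c, ?_, rfl⟩
  rintro rfl
  exact hl.ne_zero ⟨0, by simp⟩ (by simp)

variable {A : Matrix (Fin n) (Fin n) L} {ρ : Fin n → L} {R : Fin n → Fin n → K}

/-- In the coordinates `y` with `x = y * A` the equation reads `y j * ρ j = ρ i * y j`; since the `ρ
j` are distinct, only `y i` can be nonzero. -/
theorem vecMul_eq_smul_iff (hA : IsUnit A) (hρ : Function.Injective ρ)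
    {M : Matrix (Fin n) (Fin n) L} (h : A * M = Matrix.diagonal ρ * A) (i : Fin n)
    (x : Fin n → L) : Matrix.vecMul x M = ρ i • x ↔ ∃ c : L, x = c • A i := by
  have hdet := (Matrix.isUnit_iff_isUnit_det A).1 hA
  obtain ⟨y, rfl⟩ : ∃ y, x = Matrix.vecMul y A :=
    ⟨Matrix.vecMul x A⁻¹, by rw [Matrix.vecMul_vecMul, Matrix.nonsing_inv_mul _ hdet,
      Matrix.vecMul_one]⟩
  have hinj := Matrix.vecMul_injective_iff_isUnit.2 hA
  have hrow : ∀ c : L, c • A i = Matrix.vecMul (Pi.single i c) A := fun c => by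
    rw [Matrix.single_vecMul]; rfl
  rw [Matrix.vecMul_vecMul, h, ← Matrix.vecMul_vecMul, ← Matrix.smul_vecMul, hinj.eq_iff]
  simp only [hrow, hinj.eq_iff]
  constructor
  · intro hy
    refine ⟨y i, funext fun j => ?_⟩
    by_cases hj : j = i
    · subst hj; simp
    · have h1 := congrFun hy j
      rw [Matrix.vecMul_diagonal, Pi.smul_apply, smul_eq_mul, mul_comm] at h1
      have h2 : y j = 0 := by
        by_contra h0
        exact hj (hρ (mul_right_cancel₀ h0 h1))
      simp [hj, h2]
  · rintro ⟨c, rfl⟩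
    funext j
    rw [Matrix.vecMul_diagonal, Pi.smul_apply, smul_eq_mul, mul_comm]
    by_cases hj : j = i
    · subst hj; rfl
    · simp [hj]

theorem mem_eigenvalueList_iff (hA : IsUnit A)
    (h : A * (Matrix.of R).map (algebraMap K L) = Matrix.diagonal ρ * A) (μ : L) :
    μ ∈ eigenvalueList L R ↔ ∃ i, ρ i = μ := by
  have hdet := (Matrix.isUnit_iff_isUnit_det A).1 hA
  have h1 : (Matrix.of R).map (algebraMap K L) = A⁻¹ * Matrix.diagonal ρ * A := by
    rw [mul_assoc, ← h, Matrix.nonsing_inv_mul_cancel_left _ _ hdet]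
  have h2 : ((Matrix.of R).map (algebraMap K L)).charpoly =
      ∏ i, (Polynomial.X - Polynomial.C (ρ i)) := by
    obtain ⟨U, rfl⟩ := hA
    rw [h1, Matrix.charpoly_units_conj', Matrix.charpoly_diagonal]
  rw [eigenvalueList, Multiset.mem_toList, Polynomial.mem_roots (Matrix.charpoly_monic _).ne_zero,
    h2, Polynomial.IsRoot.def, Polynomial.eval_prod, Finset.prod_eq_zero_iff]
  simp [sub_eq_zero, eq_comm]

/-- The permutation `σ` reflects the unspecified order of the eigenvalues, and `c` the free choice
of a basis vector in each eigenline. -/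
theorem exists_eval_diagonalize (hn : 1 ≤ n) {t : Fin (n - 1) → K}
    {B : Fin (n - 1) → Fin n → Fin n → K} (hA : IsUnit A) (hρ : Function.Injective ρ)
    (h : A * (∑ k, t k • Matrix.of (B k)).map (algebraMap K L) = Matrix.diagonal ρ * A) :
    ∃ (σ : Equiv.Perm (Fin n)) (c : Fin n → L), (∀ i, c i ≠ 0) ∧
      (diagonalize (X := Val K L) t (List.ofFn B)).eval f =
        List.ofFn fun k => c k • A (σ k) := by
  classical
  obtain ⟨R, hR⟩ : ∃ R : Fin n → Fin n → K, Matrix.of R = ∑ k, t k • Matrix.of (B k) :=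
    ⟨Matrix.of.symm (∑ k, t k • Matrix.of (B k)), rfl⟩
  rw [← hR] at h
  have hspace : ∀ i, ∃ c : L, c ≠ 0 ∧
      (leftEigenspace (X := Val K L) R (ρ i)).eval f = [c • A i] := by
    intro i
    have h0 : A i ≠ 0 := (Matrix.linearIndependent_rows_iff_isUnit.2 hA).ne_zero i
    have h1 : ∀ x, x ∈ Submodule.span L
        {y | y ∈ (leftEigenspace (X := Val K L) R (ρ i)).eval f} ↔ ∃ c : L, x = c • A i := by
      intro x
      rw [mem_span_leftEigenspace f R (ρ i) x]
      exact vecMul_eq_smul_iff hA hρ h i x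
    have h2 := linearIndependent_leftEigenspace (L := L) f R (ρ i)
    exact exists_eq_singleton_smul h2 h0 h1
  choose c hc hspace using hspace
  have : Nonempty (Fin n) := ⟨⟨0, hn⟩⟩
  set E := (eigenvalueList L R).dedup with hE
  have hmem : ∀ μ, μ ∈ E ↔ ∃ i, ρ i = μ := fun μ => by
    rw [hE, List.mem_dedup]
    exact mem_eigenvalueList_iff hA h μ
  -- The positions of the listed eigenvalues on the diagonal: every index occurs exactly once, which
  -- gives the permutation.
  set s := E.map (Function.invFun ρ) with hs
  have hEs : E = s.map ρ := by
    rw [hs, List.map_map]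
    conv_lhs => rw [← List.map_id E]
    exact List.map_congr_left fun μ hμ => (Function.invFun_eq ((hmem μ).1 hμ)).symm
  have hsnd : s.Nodup := List.Nodup.of_map ρ (hEs ▸ List.nodup_dedup _)
  have hsall : ∀ i, i ∈ s := fun i => by
    have := (hmem (ρ i)).2 ⟨i, rfl⟩
    rw [hEs, List.mem_map] at this
    obtain ⟨j, hj, hji⟩ := this
    exact hρ hji ▸ hj
  have hslen : s.length = n := by
    rw [← List.toFinset_card_of_nodup hsnd, Finset.eq_univ_of_forall fun i =>
      List.mem_toFinset.2 (hsall i), Finset.card_univ, Fintype.card_fin]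
  obtain ⟨σ, hσ⟩ := exists_eq_ofFn hslen
  have hσinj : Function.Injective σ := List.nodup_ofFn.1 (hσ ▸ hsnd)
  refine ⟨Equiv.ofBijective σ (Finite.injective_iff_bijective.1 hσinj), fun k => c (σ k),
    fun k => hc _, ?_⟩
  have h1 : (diagonalize (X := Val K L) t (List.ofFn B)).eval f = (E.map fun μ =>
      (leftEigenspace (X := Val K L) R μ).eval f).flatten := by
    simp only [diagonalize, Prog.eval_bind, eval_combination, eval_traverse,
      Prog.eval, eval_distinct, ← hR, Equiv.symm_apply_apply, hE]
  have h2 : ∀ s : List (Fin n), (s.map fun i => [c i • A i]).flatten = s.map fun i => c i • A i :=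
    fun s => by
      induction s with
      | nil => rfl
      | cons a t ih =>
        rw [List.map_cons, List.flatten_cons, ih]
        rfl
  have h3 : E.map (fun μ => (leftEigenspace (X := Val K L) R μ).eval f) =
      s.map fun i => [c i • A i] := by
    rw [hEs, List.map_map]
    exact List.map_congr_left fun i _ => hspace i
  rw [h1, h3, h2, hσ, List.map_ofFn]
  rfl

end Diagonalize

/-! ### Step 5: recovering the constant factor -/

section Rescale

variable {K L : Type u} [Field K] [Field L] [Algebra K L] {n : ℕ}

/-- The default value 0 is never used: over an algebraically closed field the list of roots is not
empty. -/
theorem someRoot_pow [IsAlgClosed L] {r : ℕ} (hr : 1 ≤ r) (x : L) : someRoot r x ^ r = x := by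
  obtain ⟨z, hz⟩ := IsAlgClosed.exists_pow_nat_eq x (show 0 < r by omega)
  have h1 : z ∈ (Polynomial.nthRoots r x).toList :=
    Multiset.mem_toList.2 ((Polynomial.mem_nthRoots (by omega)).2 hz)
  obtain ⟨y, t, ht⟩ := List.exists_cons_of_ne_nil (List.ne_nil_of_mem h1)
  rw [someRoot, ht, List.headD_cons]
  have h2 : y ∈ (Polynomial.nthRoots r x).toList := by rw [ht]; simp
  exact (Polynomial.mem_nthRoots (by omega)).1 (Multiset.mem_toList.1 h2)

theorem eval_rescale (f : (Fin n → K) → K) (α : ℕ) (x : Fin n → K) (A : Fin n → Fin n → L) :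
    (rescale (X := Val K L) α x A).eval f = fun i j : Fin n => if (i : ℕ) = 0 then
      someRoot α (algebraMap K L (f x) / (∏ i, A i ⬝ᵥ fun j => algebraMap K L (x j)) ^ α) * A i j
      else A i j := by
  simp only [rescale, Prog.eval_bind, eval_blackBox, eval_toExt, eval_tabulate, eval_dot, eval_prod,
    eval_power, eval_op, Op.eval, Prog.eval, List.prod_ofFn]
  funext i j
  split_ifs <;> simp [Op.eval]

/-- Permuting the forms does not change their product, and scaling them multiplies its power by `(∏
k, c k) ^ α`. The quotient at any point where `f` does not vanish is the inverse of this constant.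
-/
theorem isFactorization_eval_rescale [IsAlgClosed L] {α : ℕ} (hn : 1 ≤ n) (hα : 1 ≤ α)
    {f : MvPolynomial (Fin n) K} {l : Fin n → Fin n → L} (hl : IsFactorization f α l)
    (σ : Equiv.Perm (Fin n)) {c : Fin n → L} (hc : ∀ i, c i ≠ 0) {x : Fin n → K}
    (hx : eval x f ≠ 0) :
    IsFactorization f α
      ((rescale (X := Val K L) α x fun k => c k • l (σ k)).eval (blackBoxOf f)) := by
  obtain ⟨hli, hf⟩ := hl
  have hf := ((isFactorization_iff f l).1 ⟨hli, hf⟩).2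
  set M : Matrix (Fin n) (Fin n) L := Matrix.of fun k => c k • l (σ k) with hM
  have hMu : IsUnit M := by
    rw [← Matrix.linearIndependent_rows_iff_isUnit]
    exact (hli.comp σ σ.injective).units_smul fun k => Units.mk0 (c k) (hc k)
  have hc0 : (∏ k, c k) ^ α ≠ 0 := pow_ne_zero _ (Finset.prod_ne_zero_iff.2 fun k _ => hc k)
  have hfM : map (algebraMap K L) f = C (((∏ k, c k) ^ α)⁻¹) * subst M ((∏ i, X i) ^ α) := by
    have h1 : subst M (∏ i, X i) = C (∏ k, c k) * subst (Matrix.of l) (∏ i, X i) := by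
      simp only [map_prod, subst_X]
      rw [← Equiv.prod_comp σ fun i => ∑ k, Matrix.of l i k • (X k : MvPolynomial (Fin n) L),
        ← Finset.prod_mul_distrib]
      refine Finset.prod_congr rfl fun k _ => ?_
      simp [hM, Finset.mul_sum, MvPolynomial.smul_eq_C_mul, mul_assoc]
    rw [map_pow, h1, mul_pow, ← C_pow, ← mul_assoc, ← C_mul, inv_mul_cancel₀ hc0, C_1, one_mul, hf,
      map_pow]
  rw [eval_rescale]
  refine isFactorization_rescale hn hα hMu (inv_ne_zero hc0) ?_ hfM
  rw [someRoot_pow hα]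
  have h2 : algebraMap K L (eval x f) = ((∏ k, c k) ^ α)⁻¹ *
      (∏ i, M i ⬝ᵥ fun j => algebraMap K L (x j)) ^ α := by
    have := congrArg (eval fun j => algebraMap K L (x j)) hfM
    have hmap : eval (fun j => algebraMap K L (x j)) (map (algebraMap K L) f) =
        algebraMap K L (eval x f) := by
      rw [eval_map, ← aeval_def]
      exact aeval_algebraMap_apply L x f
    rw [hmap] at this
    simp only [map_mul, map_pow, map_prod, subst_X, eval_C, map_sum, MvPolynomial.smul_eval,
      eval_X] at this
    exact this
  have h3 : (∏ i, M i ⬝ᵥ fun j => algebraMap K L (x j)) ^ α ≠ 0 := by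
    intro h0
    rw [h0, mul_zero] at h2
    exact hx ((map_eq_zero (algebraMap K L)).1 h2)
  rw [blackBoxOf, h2]
  exact mul_div_cancel_right₀ _ h3

end Rescale

end LinFact

namespace LinFact

open MvPolynomial

/-! ### Correctness for good random choices -/

section Deterministic

variable {K L : Type u} [Field K] [Field L] [Algebra K L] {n α : ℕ}

theorem eval_runOn_of_not_isAccepted (f : (Fin n → K) → K) (ω : Coins K n)
    (h : ¬ IsAccepted ((lieBasis (X := Val K L) (n * α) ω.pts).eval f)) :
    (runOn K L α ω).eval f = none := by
  rw [runOn, algorithm, Prog.eval_bind, eval_decideStep, if_neg h]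
  rfl

theorem eval_runOn_of_isAccepted (f : (Fin n → K) → K) (ω : Coins K n)
    {B : List (Fin n → Fin n → K)} (hB : (lieBasis (X := Val K L) (n * α) ω.pts).eval f = B)
    (h : IsAccepted (B : List (Matrix (Fin n) (Fin n) K))) {A : Fin n → Fin n → L}
    (hrows : (diagonalize (X := Val K L) ω.coeffs B).eval f = List.ofFn A) :
    (runOn K L α ω).eval f = some ((rescale (X := Val K L) α ω.pt A).eval f) := by
  rw [runOn, algorithm, Prog.eval_bind, eval_decideStep, hB, if_pos h]
  simp only [Prog.eval_bind]
  rw [hrows, dif_pos List.length_ofFn, Prog.eval_bind, Prog.eval_ret]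
  simp

theorem exists_lieBasis_eq_ofFn [CharZero K] {f : MvPolynomial (Fin n) K}
    (hf : f.IsHomogeneous (n * α)) {pts : Fin (n * n) → Fin n → K}
    (hpts : ∀ x, (∀ k, eval (pts k) (lieAction f x) = 0) → lieAction f x = 0) :
    ∃ (m : ℕ) (B : Fin m → Fin n → Fin n → K),
      (lieBasis (X := Val K L) (n * α) pts).eval (blackBoxOf f) = List.ofFn B ∧
      LinearIndependent K (fun k => Matrix.of (B k)) ∧
      ∀ x, x ∈ Submodule.span K (Set.range fun k => Matrix.of (B k)) ↔ lieAction f x = 0 := by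
  obtain ⟨m, B, hB⟩ : ∃ (m : ℕ) (B : Fin m → Fin n → Fin n → K),
      (lieBasis (X := Val K L) (n * α) pts).eval (blackBoxOf f) = List.ofFn B :=
    ⟨_, exists_eq_ofFn rfl⟩
  have h1 := linearIndependent_lieBasis (L := L) (blackBoxOf f) (n * α) pts
  have h2 := mem_span_lieBasis (L := L) f hf.totalDegree_le pts
  rw [hB] at h1 h2
  refine ⟨m, B, hB, linearIndependent_of_get_ofFn h1, fun x => ?_⟩
  have h3 : Set.range (fun k => Matrix.of (B k)) = {b : Matrix (Fin n) (Fin n) K |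
      b ∈ List.ofFn B} :=
    (setOf_mem_ofFn B).symm
  rw [h3, h2]
  exact ⟨hpts x, fun h k => by rw [h, map_zero]⟩

/-- Acceptance would produce a factorization through `exists_isFactorization`. Neither the
coefficients of step 4 nor the point of step 5 plays a role. -/
theorem isCorrect_of_not_exists [CharZero K] [IsAlgClosed L] (hn : 1 ≤ n) (hα : 1 ≤ α)
    {f : MvPolynomial (Fin n) K} (hf : f.IsHomogeneous (n * α)) (ω : Coins K n)
    (hpts : ∀ x, (∀ k, eval (ω.pts k) (lieAction f x) = 0) → lieAction f x = 0)
    (hno : ¬ ∃ l : Fin n → Fin n → L, IsFactorization f α l) :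
    IsCorrect f α ((runOn K L α ω).eval (blackBoxOf f)) := by
  rw [eval_runOn_of_not_isAccepted]
  · exact hno
  intro hacc
  obtain ⟨m, B, hB, hli, hspan⟩ := exists_lieBasis_eq_ofFn (L := L) hf hpts
  rw [hB] at hacc
  obtain ⟨hlen, hcomm, htrace, hsep⟩ := hacc
  replace hlen : m = n - 1 := List.length_ofFn.symm.trans hlen
  have hmem : ∀ k, B k ∈ List.ofFn B := fun k => List.mem_ofFn.2 ⟨k, rfl⟩
  refine hno (exists_isFactorization hn hα hf ?_ hlen hli
    (fun k => (hspan _).1 (Submodule.subset_span ⟨k, rfl⟩))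
    (fun k l => hcomm _ (hmem k) _ (hmem l)) (fun k => htrace _ (hmem k))
    (fun k => hsep _ (hmem k)))
  -- For `f = 0` every matrix lies in the Lie algebra, so an accepted basis would give `n * n = n -
  -- 1`.
  rintro rfl
  have htop : Submodule.span K (Set.range fun k => Matrix.of (B k)) = ⊤ :=
    Submodule.eq_top_iff'.2 fun x => (hspan x).2 (by simp [lieAction_apply])
  have h1 := finrank_span_eq_card hli
  rw [htop, finrank_top, Module.finrank_matrix, Fintype.card_fin, Fintype.card_fin,
    Module.finrank_self, mul_one, hlen] at h1
  have := Nat.le_mul_self n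
  omega

/-- The existential `q` isolates what the coefficients must avoid. It is built from the weights of
the basis computed from `pts`, so it is fixed before `t` and `x` are drawn. -/
theorem exists_isCorrect_of_isFactorization [CharZero K] [IsAlgClosed L] (hn : 1 ≤ n) (hα : 1 ≤ α)
    {f : MvPolynomial (Fin n) K} (hf : f.IsHomogeneous (n * α)) {l : Fin n → Fin n → L}
    (hl : IsFactorization f α l) {pts : Fin (n * n) → Fin n → K}
    (hpts : ∀ x, (∀ k, eval (pts k) (lieAction f x) = 0) → lieAction f x = 0) :
    ∃ q : MvPolynomial (Fin (n - 1)) L, q ≠ 0 ∧ q.totalDegree ≤ n * n ∧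
      ∀ t x, eval (fun k => algebraMap K L (t k)) q ≠ 0 → eval x f ≠ 0 →
        IsCorrect f α ((runOn K L α ⟨pts, t, x⟩).eval (blackBoxOf f)) := by
  have : CharZero L := charZero_of_injective_algebraMap (algebraMap K L).injective
  obtain ⟨m, B, hB, hli, hspan⟩ := exists_lieBasis_eq_ofFn (L := L) hf hpts
  obtain ⟨rfl, v, hv, hsum, hdiag⟩ := exists_weights_of_isFactorization hn hα hl hli hspan
  have hA := ((isFactorization_iff f l).1 hl).1
  -- The product, over ordered pairs of distinct indices, of the differences of eigenvalues of the
  -- combination, as a polynomial in its coefficients; it has at most `n * n` linear factors.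
  refine ⟨∏ i, ∏ j ∈ Finset.univ.erase i, ∑ k, (v k i - v k j) • X k, ?_, ?_, ?_⟩
  · refine Finset.prod_ne_zero_iff.2 fun i _ => Finset.prod_ne_zero_iff.2 fun j hj h0 => ?_
    obtain ⟨k, hk⟩ := exists_weight_ne rfl hv hsum (Finset.ne_of_mem_erase hj).symm
    have h1 := congrArg (eval (Pi.single k 1)) h0
    simp [MvPolynomial.smul_eval, Pi.single_apply, sub_eq_zero, hk] at h1
  · have h1 : ∀ i j, (∑ k, (v k i - v k j) • X k : MvPolynomial (Fin (n - 1)) L).totalDegree ≤ 1 :=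
      fun i j => totalDegree_finsetSum_le fun k _ =>
        (totalDegree_smul_le _ _).trans (totalDegree_X k).le
    refine (totalDegree_finsetProd _ _).trans ((Finset.sum_le_card_nsmul _ _ n fun i _ =>
      (totalDegree_finsetProd _ _).trans ((Finset.sum_le_card_nsmul _ _ 1 fun j _ =>
        h1 i j).trans ?_)).trans (by simp))
    simp [Finset.card_erase_of_mem]
  · intro t x hq hx
    have hρ : Function.Injective fun i => ∑ k, algebraMap K L (t k) * v k i := by
      intro i j hij
      by_contra hne
      rw [map_prod, Finset.prod_ne_zero_iff] at hq
      have hq' := hq i (Finset.mem_univ _)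
      rw [map_prod, Finset.prod_ne_zero_iff] at hq'
      refine hq' j (Finset.mem_erase.2 ⟨Ne.symm hne, Finset.mem_univ _⟩) ?_
      simp only [map_sum, MvPolynomial.smul_eval, eval_X, sub_mul, Finset.sum_sub_distrib]
      rw [sub_eq_zero]
      simpa only [mul_comm] using hij
    have hconj : Matrix.of l * (∑ k, t k • Matrix.of (B k)).map (algebraMap K L) =
        Matrix.diagonal (fun i => ∑ k, algebraMap K L (t k) * v k i) * Matrix.of l := by
      have h1 : (∑ k, t k • Matrix.of (B k)).map (algebraMap K L) =
          ∑ k, algebraMap K L (t k) • (Matrix.of (B k)).map (algebraMap K L) := by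
        ext i j
        simp only [Matrix.map_apply, Matrix.sum_apply, Matrix.smul_apply, map_sum, smul_eq_mul,
          map_mul]
      have h2 : Matrix.diagonal (fun i => ∑ k, algebraMap K L (t k) * v k i) =
          ∑ k, algebraMap K L (t k) • Matrix.diagonal (v k) := by
        ext i j
        by_cases hij : i = j
        · subst hij; simp only [Matrix.sum_apply, Matrix.smul_apply, Matrix.diagonal_apply_eq, smul_eq_mul]
        · simp [hij, Matrix.sum_apply, Matrix.smul_apply]
      rw [h1, h2, Matrix.mul_sum, Matrix.sum_mul]
      refine Finset.sum_congr rfl fun k _ => ?_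
      rw [mul_smul_comm, hdiag, smul_mul_assoc]
    obtain ⟨σ, c, hc, hrows⟩ := exists_eval_diagonalize (blackBoxOf f) hn hA hρ hconj
    have hacc : IsAccepted (List.ofFn B : List (Matrix (Fin n) (Fin n) K)) := by
      refine isAccepted_of_isFactorization List.length_ofFn hA fun b hb => ?_
      obtain ⟨k, rfl⟩ := List.mem_ofFn.1 hb
      exact ⟨v k, hdiag k, hsum k⟩
    rw [eval_runOn_of_isAccepted (blackBoxOf f) ⟨pts, t, x⟩ hB hacc hrows]
    exact isFactorization_eval_rescale hn hα hl σ hc hx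

end Deterministic

/-! ### Probabilities -/

section Probability

/-- The probability of an event for the uniform distribution on a finite type. -/
noncomputable def prob {Ω : Type*} (P : Ω → Prop) : ℝ :=
  (Nat.card {x // P x} : ℝ) / (Nat.card Ω : ℝ)

theorem prob_mono {Ω : Type*} [Finite Ω] {P Q : Ω → Prop} (h : ∀ x, P x → Q x) :
    prob P ≤ prob Q := by
  refine div_le_div_of_nonneg_right ?_ (Nat.cast_nonneg _)
  exact_mod_cast Nat.card_le_card_of_injective (Subtype.map id h)
    (Subtype.map_injective h Function.injective_id)

theorem prob_comp_equiv {Ω Ω' : Type*} (e : Ω ≃ Ω') (P : Ω' → Prop) :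
    prob (fun x => P (e x)) = prob P := by
  rw [prob, prob, Nat.card_congr e, Nat.card_congr (e.subtypeEquiv (q := P) fun _ => Iff.rfl)]

theorem prob_false {Ω : Type*} {P : Ω → Prop} (h : ∀ x, ¬ P x) : prob P = 0 := by
  have : IsEmpty {x // P x} := ⟨fun x => h _ x.2⟩
  simp [prob]

/-- A union bound by fibres over the first coordinate: fibres with `P x` count in full, the others
contribute at most `b` each. The second event may depend on the first draw. -/
theorem prob_prod_le {Ω Ω' : Type*} [Finite Ω] [Finite Ω'] [Nonempty Ω] [Nonempty Ω']
    {P : Ω → Prop} {Q : Ω → Ω' → Prop} {a b : ℝ} (hb : 0 ≤ b) (hP : prob P ≤ a)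
    (hQ : ∀ x, ¬ P x → prob (Q x) ≤ b) :
    prob (fun z : Ω × Ω' => P z.1 ∨ Q z.1 z.2) ≤ a + b := by
  classical
  have := Fintype.ofFinite Ω
  have hΩ : (0 : ℝ) < Nat.card Ω := by exact_mod_cast Nat.card_pos
  have hΩ' : (0 : ℝ) < Nat.card Ω' := by exact_mod_cast Nat.card_pos
  let e : {z : Ω × Ω' // P z.1 ∨ Q z.1 z.2} ≃ Σ x : Ω, {y : Ω' // P x ∨ Q x y} :=
    { toFun z := ⟨z.1.1, z.1.2, z.2⟩
      invFun s := ⟨(s.1, s.2.1), s.2.2⟩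
      left_inv _ := rfl
      right_inv _ := rfl }
  have hfib : ∀ x : Ω, (Nat.card {y : Ω' // P x ∨ Q x y} : ℝ) ≤
      (if P x then 1 else 0) * Nat.card Ω' + b * Nat.card Ω' := by
    intro x
    split_ifs with h
    · have h1 : (Nat.card {y : Ω' // P x ∨ Q x y} : ℝ) ≤ Nat.card Ω' := by
        exact_mod_cast Finite.card_subtype_le _
      nlinarith
    · have h1 := hQ x h
      rw [prob, div_le_iff₀ hΩ'] at h1
      simpa [h] using h1
  rw [prob, div_le_iff₀ (by rw [Nat.card_prod]; push_cast; positivity), Nat.card_congr e,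
    Nat.card_sigma, Nat.card_prod]
  push_cast
  refine (Finset.sum_le_sum fun x _ => hfib x).trans ?_
  rw [Finset.sum_add_distrib, ← Finset.sum_mul, Finset.sum_boole, Finset.sum_const,
    Finset.card_univ, ← Nat.card_eq_fintype_card, nsmul_eq_mul]
  have h2 : ((Finset.univ.filter P).card : ℝ) ≤ a * Nat.card Ω := by
    rw [prob, div_le_iff₀ hΩ] at hP
    rwa [← Fintype.card_subtype, ← Nat.card_eq_fintype_card]
  nlinarith

/-- Schwartz–Zippel on the image of `S` under `g`: the draws lie in `K`, while the polynomial of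
step 4 has coefficients in `L`. -/
theorem prob_eval_eq_zero_le {K F : Type*} [Field F] {S : Finset K} (hS : S.Nonempty)
    {g : K → F} (hg : Function.Injective g) {m D : ℕ} {p : MvPolynomial (Fin m) F} (hp : p ≠ 0)
    (hD : p.totalDegree ≤ D) :
    prob (fun t : Fin m → S => eval (fun k => g (t k)) p = 0) ≤ D / S.card := by
  classical
  have hsz := schwartz_zippel_totalDegree hp (S.map ⟨g, hg⟩)
  rw [Finset.card_map] at hsz
  have hsz' : (({x ∈ Fintype.piFinset fun _ : Fin m => S.map ⟨g, hg⟩ | eval x p = 0}.card : ℝ) /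
      (S.card : ℝ) ^ m) ≤ p.totalDegree / S.card := by
    have := (NNRat.cast_le (K := ℝ)).2 hsz
    push_cast at this
    exact this
  have hcard : (Nat.card (Fin m → S) : ℝ) = (S.card : ℝ) ^ m := by
    simp
  have hS0 : (0 : ℝ) < S.card := by exact_mod_cast hS.card_pos
  have hle : Nat.card {t : Fin m → S // eval (fun k => g (t k)) p = 0} ≤
      {x ∈ Fintype.piFinset fun _ : Fin m => S.map ⟨g, hg⟩ | eval x p = 0}.card := by
    rw [← Fintype.card_coe, ← Nat.card_eq_fintype_card]
    refine Nat.card_le_card_of_injective (fun t => ⟨fun k => g (t.1 k), ?_⟩) fun t t' h => ?_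
    · simp [t.2]
    · exact Subtype.ext (funext fun k => Subtype.ext (hg (congrFun (congrArg Subtype.val h) k)))
  rw [prob, hcard]
  calc _ ≤ ({x ∈ Fintype.piFinset fun _ : Fin m => S.map ⟨g, hg⟩ | eval x p = 0}.card : ℝ) /
      (S.card : ℝ) ^ m := by gcongr
    _ ≤ p.totalDegree / S.card := hsz'
    _ ≤ D / S.card := by gcongr

/-- `U` may be infinite, so no union bound over its elements is available. Instead, a point outside
the zeros of one chosen `p₀ ≠ 0` cuts `U` down to a proper subspace, and the remaining points handle
that subspace by induction. -/
theorem prob_exists_common_zero_le {K : Type*} [Field K] {S : Finset K} (hS : S.Nonempty)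
    {n D : ℕ} (m : ℕ) (U : Submodule K (MvPolynomial (Fin n) K)) [FiniteDimensional K U]
    (hU : Module.finrank K U ≤ m) (hD : ∀ p ∈ U, p.totalDegree ≤ D) :
    prob (fun pts : Fin m → Fin n → S =>
      ∃ p ∈ U, p ≠ 0 ∧ ∀ k, eval (fun i => (pts k i : K)) p = 0) ≤ m * (D / S.card) := by
  have : Nonempty S := hS.to_subtype
  induction m generalizing U with
  | zero =>
    have hbot : U = ⊥ := Submodule.finrank_eq_zero.1 (Nat.le_zero.1 hU)
    rw [prob_false]
    · simp
    · rintro x ⟨p, hp, hp0, -⟩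
      exact hp0 (by simpa [hbot] using hp)
  | succ m ih =>
    by_cases hbot : U = ⊥
    · rw [prob_false]
      · positivity
      · rintro x ⟨p, hp, hp0, -⟩
        exact hp0 (by simpa [hbot] using hp)
    obtain ⟨p₀, hp₀, hp₀0⟩ := Submodule.exists_mem_ne_zero_of_ne_bot hbot
    have h1 := prob_eval_eq_zero_le hS Function.injective_id hp₀0 (hD p₀ hp₀)
    have h2 : ∀ x : Fin n → S, ¬ eval (fun i => (x i : K)) p₀ = 0 →
        prob (fun pts : Fin m → Fin n → S => ∃ p ∈ U ⊓ LinearMap.ker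
          (aeval (R := K) fun i => (x i : K)).toLinearMap, p ≠ 0 ∧
          ∀ k, eval (fun i => (pts k i : K)) p = 0) ≤ m * (D / S.card) := by
      intro x hx
      -- The polynomials of `U` vanishing at `x` omit `p₀`, so the dimension drops.
      have hlt : U ⊓ LinearMap.ker (aeval (R := K) fun i => (x i : K)).toLinearMap < U := by
        refine lt_of_le_of_ne inf_le_left fun h => hx ?_
        have := (h.symm ▸ hp₀ : p₀ ∈ U ⊓ LinearMap.ker _).2
        simpa [aeval_eq_eval] using this
      have := Submodule.finiteDimensional_of_le hlt.le
      exact ih _ (by have := Submodule.finrank_lt_finrank_of_lt hlt; omega)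
        fun p hp => hD p hp.1
    have h3 := prob_prod_le (by positivity) h1 h2
    rw [← prob_comp_equiv (Fin.consEquiv fun _ : Fin (m + 1) => Fin n → S)]
    refine (prob_mono ?_).trans (h3.trans (le_of_eq (by push_cast; ring)))
    rintro ⟨x, pts⟩ ⟨p, hp, hp0, hev⟩
    refine Or.inr ⟨p, ⟨hp, ?_⟩, hp0, fun k => ?_⟩
    · have := hev 0
      simpa [Fin.consEquiv, aeval_eq_eval] using this
    · have := hev k.succ
      simpa [Fin.consEquiv] using this

end Probability

end LinFact

namespace LinFact

/-! ### Cost of the routines -/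

section Cost

variable {K L : Type u} [Field K] [Field L] [Algebra K L] {n : ℕ} {s : Srt}
  (f : (Fin n → K) → K) {c : Kind → ℕ} {W : ℕ}

theorem cost_bind_le {α β : Type u} {p : Prog (Val K L) n α} {h : α → Prog (Val K L) n β}
    {T₁ T₂ : ℕ} (h₁ : p.cost f c ≤ T₁) (h₂ : (h (p.eval f)).cost f c ≤ T₂) :
    (p >>= h).cost f c ≤ T₁ + T₂ := by
  rw [Prog.cost_bind]
  exact Nat.add_le_add h₁ h₂

theorem cost_ret_le {α : Type u} (a : α) (T : ℕ) :
    (Prog.ret a : Prog (Val K L) n α).cost f c ≤ T := Nat.zero_le _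

theorem cost_tabulate_le {β : Type u} {T : ℕ} (m : ℕ) {g : Fin m → Prog (Val K L) n β}
    (h : ∀ i, (g i).cost f c ≤ T) : (tabulate m g).cost f c ≤ m * T := by
  induction m with
  | zero => exact Nat.zero_le _
  | succ m ih =>
    refine le_trans (cost_bind_le f (h 0) (cost_bind_le f (ih fun i => h i.succ)
      (cost_ret_le f _ 0))) (le_of_eq ?_)
    ring

theorem cost_traverse_le {ι : Type v} {β : Type u} {T : ℕ} {g : ι → Prog (Val K L) n β}
    (l : List ι) (h : ∀ a ∈ l, (g a).cost f c ≤ T) : (traverse g l).cost f c ≤ l.length * T := by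
  induction l with
  | nil => exact Nat.zero_le _
  | cons a l ih =>
    refine le_trans (cost_bind_le f (h a (by simp)) (cost_bind_le f (ih fun b hb => h b (by simp [hb]))
      (cost_ret_le f _ 0))) (le_of_eq ?_)
    rw [List.length_cons]
    ring

variable (hc : ∀ i, i ≠ .eigenvalues → i ≠ .root → c i ≤ W)

include hc

/-- The hypothesis `hc` leaves the prices of eigenvalue computations and root extractions free.
Taking `W = 1` measures time; taking `W = 0` leaves only the two special instructions visible. -/
theorem cost_zero_le : (zero : Prog (Val K L) n (Val K L s)).cost f c ≤ W :=
  hc .const (by decide) (by decide)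

theorem cost_one_le : (one : Prog (Val K L) n (Val K L s)).cost f c ≤ W :=
  hc .const (by decide) (by decide)

theorem cost_op_le (o : Op) (x y : Val K L s) :
    (op o x y : Prog (Val K L) n (Val K L s)).cost f c ≤ W :=
  hc .arith (by decide) (by decide)

theorem cost_toExt_le (x : K) : (toExt (X := Val K L) (n := n) x).cost f c ≤ W :=
  hc .lift (by decide) (by decide)

theorem cost_blackBox_le (x : Fin n → K) : (blackBox (X := Val K L) x).cost f c ≤ W :=
  hc .query (by decide) (by decide)

theorem cost_ifZero_le {β : Type u} {T : ℕ} (x : Val K L s) {p q : Prog (Val K L) n β}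
    (hp : p.cost f c ≤ T) (hq : q.cost f c ≤ T) : (Prog.ifZero s x p q).cost f c ≤ W + T := by
  rw [Prog.cost]
  refine Nat.add_le_add (hc .test (by decide) (by decide)) ?_
  split_ifs <;> assumption

theorem cost_sum_le (l : List (Val K L s)) :
    (sum l : Prog (Val K L) n (Val K L s)).cost f c ≤ (l.length + 1) * W := by
  induction l with
  | nil => simpa [sum] using cost_zero_le f hc
  | cons a l ih =>
    refine le_trans (cost_bind_le f ih (cost_op_le f hc _ _ _)) (le_of_eq ?_)
    rw [List.length_cons]
    ring

theorem cost_prod_le (l : List (Val K L s)) :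
    (prod l : Prog (Val K L) n (Val K L s)).cost f c ≤ (l.length + 1) * W := by
  induction l with
  | nil => simpa [prod] using cost_one_le f hc
  | cons a l ih =>
    refine le_trans (cost_bind_le f ih (cost_op_le f hc _ _ _)) (le_of_eq ?_)
    rw [List.length_cons]
    ring

theorem cost_natural_le (k : ℕ) :
    (natural k : Prog (Val K L) n (Val K L s)).cost f c ≤ (2 * k + 1) * W := by
  induction k with
  | zero => simpa [natural] using cost_zero_le f hc
  | succ k ih =>
    refine le_trans (cost_bind_le f ih (cost_bind_le f (cost_one_le f hc)
      (cost_op_le f hc _ _ _))) (le_of_eq ?_)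
    ring

theorem cost_natural_le_of_le {k d : ℕ} (hk : k ≤ d) :
    (natural k : Prog (Val K L) n (Val K L s)).cost f c ≤ (2 * d + 1) * W :=
  le_trans (cost_natural_le f hc k) (Nat.mul_le_mul_right _ (by omega))

theorem cost_power_le (x : Val K L s) (k : ℕ) :
    (power x k : Prog (Val K L) n (Val K L s)).cost f c ≤ (k + 1) * W := by
  simpa [power] using cost_prod_le f hc (List.replicate k x)

theorem cost_ifAllZero_le {β : Type u} {T : ℕ} {p q : Prog (Val K L) n β}
    (hp : p.cost f c ≤ T) (hq : q.cost f c ≤ T) (l : List (Val K L s)) :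
    (ifAllZero p q l).cost f c ≤ l.length * W + T := by
  induction l with
  | nil => simpa [ifAllZero] using hp
  | cons a l ih =>
    refine le_trans (cost_ifZero_le f hc a ih (hq.trans (Nat.le_add_left _ _))) (le_of_eq ?_)
    rw [List.length_cons]
    ring

theorem cost_ifMem_le {β : Type u} {T : ℕ} {p q : Prog (Val K L) n β}
    (hp : p.cost f c ≤ T) (hq : q.cost f c ≤ T) (x : Val K L s) (l : List (Val K L s)) :
    (ifMem p q x l).cost f c ≤ 2 * l.length * W + T := by
  induction l with
  | nil => simpa [ifMem] using hq
  | cons a l ih =>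
    refine le_trans (cost_bind_le f (cost_op_le f hc _ _ _)
      (cost_ifZero_le f hc _ (hp.trans (Nat.le_add_left _ _)) ih)) (le_of_eq ?_)
    rw [List.length_cons]
    ring

theorem cost_distinct_le (l : List (Val K L s)) :
    (distinct l : Prog (Val K L) n _).cost f c ≤ 2 * l.length * l.length * W := by
  classical
  induction l with
  | nil => exact Nat.zero_le _
  | cons a l ih =>
    have hlen : ((distinct l : Prog (Val K L) n _).eval f).length ≤ l.length := by
      rw [eval_distinct]
      exact (List.dedup_sublist l).length_le
    refine le_trans (cost_bind_le f ih (le_trans (cost_ifMem_le f hc (cost_ret_le f _ 0) (cost_ret_le f _ 0)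
      a _) (Nat.add_le_add_right (Nat.mul_le_mul_right W
        (Nat.mul_le_mul_left 2 hlen)) 0))) ?_
    rw [List.length_cons, add_zero, ← add_mul]
    exact Nat.mul_le_mul_right _ (by nlinarith)

theorem cost_dot_le {m : ℕ} (a b : Fin m → Val K L s) :
    (dot a b : Prog (Val K L) n (Val K L s)).cost f c ≤ (2 * m + 1) * W := by
  refine le_trans (cost_bind_le f (cost_tabulate_le f m fun i => cost_op_le f hc _ _ _)
    (cost_sum_le f hc _)) (le_of_eq ?_)
  rw [List.length_ofFn]
  ring

theorem cost_identity_le (m : ℕ) :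
    (identity m : Prog (Val K L) n (Fin m → Fin m → Val K L s)).cost f c ≤ 2 * W := by
  refine le_trans (cost_bind_le f (cost_zero_le f hc) (cost_bind_le f (cost_one_le f hc)
    (cost_ret_le f _ 0))) (le_of_eq ?_)
  ring

theorem cost_matMul_le {m : ℕ} (A B : Fin m → Fin m → Val K L s) :
    (matMul A B : Prog (Val K L) n _).cost f c ≤ m * (m * (2 * m + 1)) * W := by
  refine le_trans (cost_tabulate_le f m fun i => cost_tabulate_le f m fun j =>
    cost_dot_le f hc _ _) (le_of_eq ?_)
  ring

theorem cost_matPow_le {m : ℕ} (A : Fin m → Fin m → Val K L s) (k : ℕ) :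
    (matPow A k : Prog (Val K L) n _).cost f c ≤ (2 + k * (m * (m * (2 * m + 1)))) * W := by
  induction k with
  | zero => simpa [matPow] using cost_identity_le f hc m
  | succ k ih =>
    refine le_trans (cost_bind_le f ih (cost_matMul_le f hc _ _)) (le_of_eq ?_)
    ring

theorem cost_matPow_le_of_le {m : ℕ} (A : Fin m → Fin m → Val K L s) {k d : ℕ} (hk : k ≤ d) :
    (matPow A k : Prog (Val K L) n _).cost f c ≤ (2 + d * (m * (m * (2 * m + 1)))) * W :=
  le_trans (cost_matPow_le f hc A k) (by gcongr)

/-- A vector costs `2 * m + 2` when tested as a pivot and `4 * m + 2` when reduced, at most `6 * m +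
4` together. -/
theorem cost_eliminate_le {m : ℕ} (r : Fin m → Val K L s) (l : List (Fin m → Val K L s)) :
    (eliminate r l : Prog (Val K L) n _).cost f c ≤ l.length * (6 * m + 4) * W := by
  induction l with
  | nil => exact Nat.zero_le _
  | cons b bs ih =>
    refine le_trans (cost_bind_le f (cost_dot_le f hc _ _) (cost_ifZero_le f hc _
      (T := bs.length * (6 * m + 4) * W)
      (le_trans (cost_bind_le f ih (cost_ret_le f _ 0)) (le_of_eq (add_zero _)))
      (le_trans (cost_traverse_le f bs fun b' _ => cost_bind_le f (cost_dot_le f hc _ _)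
        (cost_bind_le f (cost_op_le f hc _ _ _) (cost_tabulate_le f m fun i =>
          cost_bind_le f (cost_op_le f hc _ _ _) (cost_op_le f hc _ _ _)))) ?_))) ?_
    · rw [mul_assoc]
      exact Nat.mul_le_mul_left _ (by nlinarith)
    · rw [List.length_cons]
      nlinarith

/-- A bound for the number of instructions executed by `kernel m` on a list of `r` rows. -/
def kernelCost (m r : ℕ) : ℕ := 2 + r * (m * (6 * m + 4))

/-- The intermediate lists are linearly independent in dimension `m`, so each row is processed
against at most `m` vectors. -/
theorem cost_kernel_le {m : ℕ} (rs : List (Fin m → Val K L s)) :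
    (kernel m rs : Prog (Val K L) n _).cost f c ≤ kernelCost m rs.length * W := by
  induction rs with
  | nil =>
    refine le_trans (cost_bind_le f (cost_identity_le f hc m) (cost_ret_le f _ 0)) (le_of_eq ?_)
    simp [kernelCost]
  | cons r rs ih =>
    refine le_trans (cost_bind_le f ih (le_trans (cost_eliminate_le f hc r _) (Nat.mul_le_mul_right W
      (Nat.mul_le_mul_right _ (length_eval_kernel_le f rs))))) (le_of_eq ?_)
    rw [List.length_cons, kernelCost, kernelCost]
    ring

theorem cost_kernel_ofFn_le {m r : ℕ} (rs : Fin r → Fin m → Val K L s) :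
    (kernel m (List.ofFn rs) : Prog (Val K L) n _).cost f c ≤ kernelCost m r * W := by
  simpa using cost_kernel_le f hc (List.ofFn rs)

end Cost

end LinFact

namespace LinFact

/-! ### Cost of the steps of the algorithm -/

section Cost

variable {K L : Type u} [Field K] [Field L] [Algebra K L] {n : ℕ}
  (f : (Fin n → K) → K) {c : Kind → ℕ} {W : ℕ}

theorem kernelCost_mono {m m' : ℕ} (h : m ≤ m') (r : ℕ) : kernelCost m r ≤ kernelCost m' r := by
  unfold kernelCost
  gcongr

/-- A bound for the number of instructions executed by `weight d k`, for `k ≤ d`. -/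
def weightCost (d : ℕ) : ℕ := (2 * d + 1) + d * (2 * d + 3) + (d + 1) + 1

/-- A bound for the number of instructions executed by `partialDeriv d`. -/
def partialDerivCost (d : ℕ) : ℕ := 1 + d * ((2 * d + 1) + 4 + weightCost d) + (d + 1)

/-- A bound for the number of instructions executed by `lieBasis d`. -/
def lieBasisCost (n d : ℕ) : ℕ :=
  n * n * (n * partialDerivCost d + n * n) + kernelCost (n * n) (n * n)

/-- A bound for the number of instructions executed by `annihilators M k`, for `k ≤ n`. -/
def annihilatorsCost (n : ℕ) : ℕ :=
  (n + 1) * (2 + n * (n * (n * (2 * n + 1)))) + kernelCost (n + 1) (n * n)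

/-- A bound for the number of instructions executed by `derivAt M k`, for `k ≤ n`. -/
def derivAtCost (n : ℕ) : ℕ :=
  n * (2 + n * (n * (n * (2 * n + 1)))) + n * (2 * n + 2) + n * (n * (2 * n + 1))

/-- A bound for the number of instructions executed by `defect`. -/
def defectCost (n : ℕ) : ℕ := (n + 1) * annihilatorsCost n + derivAtCost n + kernelCost n n

/-- A bound for the number of instructions executed by `commutator`. -/
def commutatorCost (n : ℕ) : ℕ := 2 * (n * (n * (2 * n + 1))) + n * n

/-- A bound for the number of instructions executed by `decideStep d`. -/
def decideStepCost (n d : ℕ) : ℕ :=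
  lieBasisCost n d + n * n * commutatorCost n + n * (n + 1) + n * defectCost n +
    (n * n * (n * n) + n)

/-- A bound for the number of instructions executed by `diagonalize`, apart from the computation of
the eigenvalues. -/
def diagonalizeCost (n : ℕ) : ℕ :=
  n * (n * (2 * n + 1)) + 2 * n * n + n * (2 * (n * n) + kernelCost n n)

/-- A bound for the number of instructions executed by `rescale α`, apart from the extraction of
the root. -/
def rescaleCost (n α : ℕ) : ℕ := 5 + 2 * n + n * (2 * n + 1) + α + n * n

/-- A bound for the number of instructions executed by `algorithm α`, apart from the computation of
the eigenvalues and the extraction of the root. -/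
def algorithmCost (n α : ℕ) : ℕ :=
  decideStepCost n (n * α) + diagonalizeCost n + rescaleCost n α

theorem length_eval_commutator (A B : Fin n → Fin n → K) :
    ((commutator (X := Val K L) A B).eval f).length = n * n := by
  simp [commutator, entries, Prog.eval]

theorem length_eigenvalueList_le (M : Fin n → Fin n → K) : (eigenvalueList L M).length ≤ n := by
  rw [eigenvalueList, Multiset.length_toList]
  refine (Polynomial.card_roots' _).trans ?_
  rw [Matrix.charpoly_natDegree_eq_dim, Fintype.card_fin]

variable (hc : ∀ i, i ≠ .eigenvalues → i ≠ .root → c i ≤ W)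

include hc

theorem cost_weight_le {d k : ℕ} (hk : k ≤ d) :
    (weight d k : Prog (Val K L) n _).cost f c ≤ weightCost d * W := by
  have hlen : ((List.range' 1 d).filter fun j => j ≠ k).length ≤ d :=
    (List.length_filter_le _ _).trans (by simp)
  refine le_trans (cost_bind_le f (cost_natural_le_of_le f hc hk) (cost_bind_le f
    (le_trans (cost_traverse_le f _ (T := (2 * d + 3) * W) fun j hj => ?_)
      (Nat.mul_le_mul_right _ hlen))
    (cost_bind_le f (T₁ := (d + 1) * W) ?_ (cost_op_le f hc _ _ _)))) (le_of_eq ?_)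
  · have hj' : j ≤ d := by
      have := List.mem_range'_1.1 (List.mem_filter.1 hj).1
      omega
    refine le_trans (cost_bind_le f (cost_natural_le_of_le f hc hj') (cost_bind_le f
      (cost_op_le f hc _ _ _) (cost_op_le f hc _ _ _))) (le_of_eq ?_)
    ring
  · refine le_trans (cost_prod_le f hc _) (Nat.mul_le_mul_right _ (Nat.add_le_add_right ?_ _))
    refine le_trans (le_of_eq ?_) hlen
    simp
  · rw [weightCost]
    ring

theorem cost_partialDeriv_le (d : ℕ) (a : Fin n → K) (i : Fin n) :
    (partialDeriv (X := Val K L) d a i).cost f c ≤ partialDerivCost d * W := by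
  refine le_trans (cost_bind_le f (cost_blackBox_le f hc _) (cost_bind_le f
    (cost_traverse_le f _ (T := ((2 * d + 1) + 4 + weightCost d) * W) fun k hk => ?_)
    (cost_sum_le f hc _))) (le_of_eq ?_)
  · have hk' : k ≤ d := by
      have := List.mem_range'_1.1 hk
      omega
    refine le_trans (cost_bind_le f (cost_natural_le_of_le f hc hk') (cost_bind_le f
      (cost_op_le f hc _ _ _) (cost_bind_le f (cost_blackBox_le f hc _) (cost_bind_le f
        (cost_op_le f hc _ _ _) (cost_bind_le f (cost_weight_le f hc hk')
          (cost_op_le f hc _ _ _)))))) (le_of_eq ?_)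
    ring
  · simp only [eval_traverse, List.length_map, List.length_range', partialDerivCost]
    ring

theorem cost_lieRow_le (d : ℕ) (a : Fin n → K) :
    (lieRow (X := Val K L) d a).cost f c ≤ (n * partialDerivCost d + n * n) * W := by
  refine le_trans (cost_bind_le f (cost_tabulate_le f _ fun i => cost_partialDeriv_le f hc d a i)
    (cost_tabulate_le f _ fun e => cost_op_le f hc _ _ _)) (le_of_eq ?_)
  ring

theorem cost_lieBasis_le (d : ℕ) (pts : Fin (n * n) → Fin n → K) :
    (lieBasis (X := Val K L) d pts).cost f c ≤ lieBasisCost n d * W := by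
  refine le_trans (cost_bind_le f (cost_tabulate_le f _ fun p => cost_lieRow_le f hc d _)
    (cost_bind_le f (cost_kernel_ofFn_le f hc _) (cost_ret_le f _ 0))) (le_of_eq ?_)
  rw [lieBasisCost]
  ring

theorem cost_annihilators_le (M : Fin n → Fin n → K) {k : ℕ} (hk : k ≤ n) :
    (annihilators (X := Val K L) M k).cost f c ≤ annihilatorsCost n * W := by
  have hk' : k + 1 ≤ n + 1 := by omega
  refine le_trans (cost_bind_le f (cost_tabulate_le f _ fun e =>
    cost_matPow_le_of_le (s := .base) f hc M (show (e : ℕ) ≤ n by omega))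
    (cost_kernel_ofFn_le f hc _)) ?_
  rw [← mul_assoc, ← Nat.add_mul]
  exact Nat.mul_le_mul_right _
    (Nat.add_le_add (Nat.mul_le_mul_right _ hk') (kernelCost_mono hk' _))

theorem cost_derivAt_le (M : Fin n → Fin n → K) {k : ℕ} (hk : k ≤ n) (b : Fin (k + 1) → K) :
    (derivAt (X := Val K L) M k b).cost f c ≤ derivAtCost n * W := by
  refine le_trans (cost_bind_le f (cost_tabulate_le f k fun e =>
    cost_matPow_le_of_le (s := .base) f hc M (show (e : ℕ) ≤ n by omega))
    (cost_bind_le f (cost_tabulate_le f k (T := (2 * n + 2) * W) fun e => ?_)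
      (cost_tabulate_le f n fun i => cost_tabulate_le f n fun j => cost_dot_le f hc _ _))) ?_
  · refine le_trans (cost_bind_le f
      (cost_natural_le_of_le f hc (show (e : ℕ) + 1 ≤ n by omega))
      (cost_op_le f hc _ _ _)) (le_of_eq ?_)
    ring
  · refine le_trans (b := (k * (2 + n * (n * (n * (2 * n + 1)))) + k * (2 * n + 2) +
      n * (n * (2 * k + 1))) * W) (le_of_eq (by ring)) ?_
    rw [derivAtCost]
    gcongr

theorem cost_defectFrom_le (M : Fin n → Fin n → K) (fuel k : ℕ) (h : fuel + k = n + 1) :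
    (defectFrom (X := Val K L) M fuel k).cost f c ≤
      (fuel * annihilatorsCost n + derivAtCost n + kernelCost n n) * W := by
  induction fuel generalizing k with
  | zero => exact Nat.zero_le _
  | succ fuel ih =>
    refine le_trans (cost_bind_le f (cost_annihilators_le f hc M (by omega))
      (T₂ := (fuel * annihilatorsCost n + derivAtCost n + kernelCost n n) * W) ?_) (le_of_eq ?_)
    · rcases (annihilators (X := Val K L) M k).eval f with _ | ⟨b, l⟩
      · exact ih (k + 1) (by omega)
      · refine le_trans (cost_bind_le f (cost_derivAt_le f hc M (by omega) b)
          (cost_kernel_ofFn_le f hc _)) ?_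
        rw [← add_mul]
        exact Nat.mul_le_mul_right _ (by omega)
    · ring

theorem cost_defect_le (M : Fin n → Fin n → K) :
    (defect (X := Val K L) M).cost f c ≤ defectCost n * W :=
  cost_defectFrom_le f hc M (n + 1) 0 rfl

theorem cost_commutator_le (A B : Fin n → Fin n → K) :
    (commutator (X := Val K L) A B).cost f c ≤ commutatorCost n * W := by
  refine le_trans (cost_bind_le f (cost_matMul_le (s := .base) f hc A B) (cost_bind_le f
    (cost_matMul_le (s := .base) f hc B A) (cost_bind_le f (cost_tabulate_le f n fun i =>
      cost_tabulate_le f n fun j => cost_op_le f hc _ _ _) (cost_ret_le f _ 0)))) (le_of_eq ?_)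
  rw [commutatorCost]
  ring

theorem cost_trace_le (A : Fin n → Fin n → K) :
    (trace (X := Val K L) A).cost f c ≤ (n + 1) * W := by
  simpa [trace] using cost_sum_le (L := L) (s := .base) f hc (List.ofFn fun i => A i i)

theorem cost_decideStep_le (d : ℕ) (pts : Fin (n * n) → Fin n → K) :
    (decideStep (X := Val K L) d pts).cost f c ≤ decideStepCost n d * W := by
  refine le_trans (cost_bind_le f (cost_lieBasis_le f hc d pts)
    (T₂ := (n * n * commutatorCost n + n * (n + 1) + n * defectCost n +
      (n * n * (n * n) + n)) * W) ?_) (le_of_eq ?_)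
  · generalize (lieBasis (X := Val K L) d pts).eval f = B
    split_ifs with hB
    · exact Nat.zero_le _
    -- The length test has been passed, so there are at most `n * n` commutators and `n` minimal
    -- polynomials to compute.
    have hB' : B.length ≤ n := by omega
    have hBB : (B.product B).length ≤ n * n := by
      refine (List.length_product B B).trans_le ?_
      exact Nat.mul_le_mul hB' hB'
    refine le_trans (cost_bind_le f
      (le_trans (cost_traverse_le f _ fun p _ => cost_commutator_le f hc p.1 p.2)
        (Nat.mul_le_mul_right _ hBB))
      (cost_bind_le f (le_trans (cost_traverse_le f _ fun A _ => cost_trace_le f hc A)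
        (Nat.mul_le_mul_right _ hB'))
      (cost_bind_le f (le_trans (cost_traverse_le f _ fun A _ => cost_defect_le f hc A)
        (Nat.mul_le_mul_right _ hB')) (T₂ := (n * n * (n * n) + n) * W) ?_))) (le_of_eq ?_)
    · refine le_trans (cost_ifAllZero_le f hc (T := 0) ?_ (cost_ret_le f _ 0) _) ?_
      · split_ifs <;> exact Nat.zero_le _
      · rw [add_zero]
        refine Nat.mul_le_mul_right _ ?_
        rw [List.length_append, List.length_flatten]
        refine Nat.add_le_add ?_ ?_
        · refine le_trans (List.sum_le_card_nsmul _ (n * n) fun x hx => ?_) ?_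
          · simp only [eval_traverse, List.map_map, List.mem_map, Function.comp] at hx
            obtain ⟨p, -, rfl⟩ := hx
            exact (length_eval_commutator f p.1 p.2).le
          · simp only [eval_traverse, List.length_map, smul_eq_mul]
            exact Nat.mul_le_mul_right _ hBB
        · simpa [eval_traverse] using hB'
    · ring
  · rw [decideStepCost]
    ring

theorem cost_combination_le (t : Fin (n - 1) → K) (B : List (Fin n → Fin n → K)) :
    (combination (X := Val K L) t B).cost f c ≤ n * (n * (2 * n + 1)) * W := by
  have hlen : ((List.ofFn t).zip B).length ≤ n := by
    rw [List.length_zip, List.length_ofFn]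
    omega
  refine le_trans (cost_tabulate_le f n fun i => cost_tabulate_le f n
    (T := (2 * n + 1) * W) fun j => ?_) (le_of_eq (by ring))
  refine le_trans (cost_bind_le f (le_trans (cost_traverse_le f _ fun p _ =>
    cost_op_le f hc _ _ _) (Nat.mul_le_mul_right _ hlen))
    (le_trans (cost_sum_le f hc _) (Nat.mul_le_mul_right (m := n + 1) _ ?_))) (le_of_eq ?_)
  · simp [eval_traverse]
  · ring

theorem cost_leftEigenspace_le (R : Fin n → Fin n → K) (μ : L) :
    (leftEigenspace (X := Val K L) R μ).cost f c ≤ (2 * (n * n) + kernelCost n n) * W := by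
  refine le_trans (cost_bind_le f (cost_tabulate_le f n fun j => cost_tabulate_le f n
    (T := 2 * W) fun i => ?_) (cost_kernel_ofFn_le f hc _)) (le_of_eq ?_)
  · refine le_trans (cost_bind_le f (cost_toExt_le f hc _) (T₂ := W) ?_) (le_of_eq ?_)
    · split_ifs
      · exact cost_op_le f hc _ _ _
      · exact Nat.zero_le _
    · ring
  · ring

theorem cost_diagonalize_le (t : Fin (n - 1) → K) (B : List (Fin n → Fin n → K)) :
    (diagonalize (X := Val K L) t B).cost f c ≤ diagonalizeCost n * W + c .eigenvalues := by
  classical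
  refine le_trans (cost_bind_le f (cost_combination_le f hc t B) (cost_bind_le f
    (T₁ := c .eigenvalues) le_rfl (cost_bind_le f (T₁ := 2 * n * n * W)
      (le_trans (cost_distinct_le f hc _) ?_) (cost_bind_le f
        (le_trans (cost_traverse_le f _ fun μ _ => cost_leftEigenspace_le f hc _ μ)
          (Nat.mul_le_mul_right _ (m := n) ?_)) (cost_ret_le f _ 0))))) (le_of_eq ?_)
  · have := length_eigenvalueList_le (L := L) ((combination (X := Val K L) t B).eval f)
    exact Nat.mul_le_mul_right _ (Nat.mul_le_mul (Nat.mul_le_mul_left _ this) this)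
  · rw [eval_distinct]
    exact (List.dedup_sublist _).length_le.trans (length_eigenvalueList_le _)
  · rw [diagonalizeCost]
    ring

theorem cost_rescale_le (α : ℕ) (x : Fin n → K) (A : Fin n → Fin n → L) :
    (rescale (X := Val K L) α x A).cost f c ≤ rescaleCost n α * W + c .root := by
  refine le_trans (cost_bind_le f (cost_blackBox_le f hc _) (cost_bind_le f
    (cost_toExt_le f hc _) (cost_bind_le f (cost_tabulate_le f n fun i => cost_toExt_le f hc _)
    (cost_bind_le f (cost_tabulate_le f n fun i => cost_dot_le f hc _ _)
    (cost_bind_le f (cost_prod_le f hc _) (cost_bind_le f (cost_power_le f hc _ _)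
    (cost_bind_le f (cost_op_le f hc _ _ _) (cost_bind_le f (T₁ := c .root) le_rfl
    (cost_tabulate_le f n fun i => cost_tabulate_le f n (T := W) fun j => ?_)))))))))
    (le_of_eq ?_)
  · split_ifs
    · exact cost_op_le f hc _ _ _
    · exact Nat.zero_le _
  · rw [List.length_ofFn, rescaleCost]
    ring

/-- The prices `c .eigenvalues` and `c .root` appear once each and are not multiplied by `W`, so
suitable prices turn the same bound into the time bound and the two counts. -/
theorem cost_runOn_le (α : ℕ) (ω : Coins K n) :
    (runOn K L α ω).cost f c ≤ algorithmCost n α * W + c .eigenvalues + c .root := by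
  refine le_trans (cost_bind_le f (cost_decideStep_le f hc (n * α) ω.pts)
    (T₂ := (diagonalizeCost n + rescaleCost n α) * W + c .eigenvalues + c .root) ?_)
    (le_of_eq ?_)
  · rcases (decideStep (X := Val K L) (n * α) ω.pts).eval f with _ | B
    · exact Nat.zero_le _
    · refine le_trans (cost_bind_le f (cost_diagonalize_le f hc ω.coeffs B)
        (T₂ := rescaleCost n α * W + c .root) ?_) (le_of_eq ?_)
      · split_ifs
        · exact le_trans (cost_bind_le f (cost_rescale_le f hc _ _ _) (cost_ret_le f _ 0)) le_rfl
        · exact Nat.zero_le _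
      · ring
  · rw [algorithmCost]
    ring

end Cost

/-! ### Polynomial bounds -/

/-- `g n α` is bounded by a polynomial in `n + n * α`, for positive `n` and `α`. -/
def IsPolyBounded (g : ℕ → ℕ → ℕ) : Prop :=
  ∃ C c : ℕ, ∀ n α : ℕ, 1 ≤ n → 1 ≤ α → g n α ≤ C * (n + n * α) ^ c

namespace IsPolyBounded

variable {g h : ℕ → ℕ → ℕ}

theorem mono (hh : IsPolyBounded h) (H : ∀ n α, 1 ≤ n → 1 ≤ α → g n α ≤ h n α) :
    IsPolyBounded g := by
  obtain ⟨C, c, hC⟩ := hh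
  exact ⟨C, c, fun n α hn hα => (H n α hn hα).trans (hC n α hn hα)⟩

theorem const (k : ℕ) : IsPolyBounded fun _ _ => k := ⟨k, 0, by simp⟩

theorem size : IsPolyBounded fun n α => n + n * α := ⟨1, 1, by simp⟩

theorem fst : IsPolyBounded fun n _ => n := size.mono fun _ _ _ _ => Nat.le_add_right _ _

theorem snd : IsPolyBounded fun _ α => α :=
  size.mono fun _ α hn _ => le_add_left (Nat.le_mul_of_pos_left α hn)

theorem mul (hg : IsPolyBounded g) (hh : IsPolyBounded h) :
    IsPolyBounded fun n α => g n α * h n α := by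
  obtain ⟨C, c, hC⟩ := hg
  obtain ⟨D, d, hD⟩ := hh
  refine ⟨C * D, c + d, fun n α hn hα => (Nat.mul_le_mul (hC n α hn hα) (hD n α hn hα)).trans
    (le_of_eq ?_)⟩
  ring

theorem add (hg : IsPolyBounded g) (hh : IsPolyBounded h) :
    IsPolyBounded fun n α => g n α + h n α := by
  obtain ⟨C, c, hC⟩ := hg
  obtain ⟨D, d, hD⟩ := hh
  refine ⟨C + D, c + d, fun n α hn hα => ?_⟩
  have hN : 1 ≤ n + n * α := le_add_right hn
  rw [add_mul]
  exact Nat.add_le_add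
    ((hC n α hn hα).trans (Nat.mul_le_mul_left _ (Nat.pow_le_pow_right hN (by omega))))
    ((hD n α hn hα).trans (Nat.mul_le_mul_left _ (Nat.pow_le_pow_right hN (by omega))))

end IsPolyBounded

/-- The summand 2 pays for the eigenvalue computation and the root extraction. -/
theorem isPolyBounded_cost : IsPolyBounded fun n α => numCoins n + (algorithmCost n α + 2) := by
  have hn : IsPolyBounded fun n _ => n := .fst
  have hα : IsPolyBounded fun _ α => α := .snd
  have hk := IsPolyBounded.const
  have hn' : IsPolyBounded fun n _ => n - 1 := hn.mono fun _ _ _ _ => Nat.sub_le _ 1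
  unfold numCoins algorithmCost decideStepCost diagonalizeCost rescaleCost lieBasisCost
    partialDerivCost weightCost defectCost annihilatorsCost derivAtCost commutatorCost kernelCost
  repeat' first
    | exact hn
    | exact hα
    | exact hn'
    | exact hk _
    | apply IsPolyBounded.add
    | apply IsPolyBounded.mul

end LinFact

/-! ### The error probability and the main theorem -/

namespace LinFact

open MvPolynomial

variable {K L : Type u} [Field K] [Field L] [Algebra K L] {n α : ℕ}
  {f : MvPolynomial (Fin n) K}

/-- Random choices as a triple. -/
def coinsEquiv (V : Type u) (n : ℕ) :
    Coins V n ≃ (Fin (n * n) → Fin n → V) × (Fin (n - 1) → V) × (Fin n → V) where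
  toFun ω := (ω.pts, ω.coeffs, ω.pt)
  invFun z := ⟨z.1, z.2.1, z.2.2⟩
  left_inv _ := rfl
  right_inv _ := rfl

theorem IsFactorization.ne_zero {l : Fin n → Fin n → L} (hl : IsFactorization f α l) :
    f ≠ 0 := by
  rintro rfl
  have h := hl.2
  rw [map_zero] at h
  have h' := eq_zero_of_pow_eq_zero h.symm
  obtain ⟨i, -, hi⟩ := Finset.prod_eq_zero_iff.1 h'
  refine hl.1.ne_zero i (funext fun j => ?_)
  have := congrArg (coeff (Finsupp.single j 1)) hi
  simpa [coeff_sum, coeff_C_mul, coeff_X, Finsupp.single_left_inj] using this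

/-- Two nested union bounds. `Q` depends on `pts` because the exceptional coefficients of step 4
depend on the basis found in step 1; `R` depends on `f` alone in the application. -/
theorem prob_coins_le {V : Type u} [Finite V] [Nonempty V]
    {E : Coins V n → Prop} (P : (Fin (n * n) → Fin n → V) → Prop)
    (Q : (Fin (n * n) → Fin n → V) → (Fin (n - 1) → V) → Prop) (R : (Fin n → V) → Prop)
    (hE : ∀ ω, E ω → P ω.pts ∨ Q ω.pts ω.coeffs ∨ R ω.pt) {a b c : ℝ} (hb : 0 ≤ b) (hc : 0 ≤ c)
    (hP : prob P ≤ a) (hQ : ∀ pts, prob (Q pts) ≤ b) (hR : prob R ≤ c) :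
    prob E ≤ a + (b + c) := by
  have : Finite (Coins V n) := Finite.of_equiv _ (coinsEquiv V n).symm
  refine (prob_mono hE).trans (le_trans (le_of_eq (prob_comp_equiv (coinsEquiv V n)
    fun z => P z.1 ∨ Q z.1 z.2.1 ∨ R z.2.2)) ?_)
  have h : ∀ pts, prob (fun z : (Fin (n - 1) → V) × (Fin n → V) => Q pts z.1 ∨ R z.2) ≤ b + c :=
    fun pts => prob_prod_le (P := Q pts) (Q := fun _ => R) hc (hQ pts) fun _ _ => hR
  exact prob_prod_le (P := P)
    (Q := fun pts (z : (Fin (n - 1) → V) × (Fin n → V)) => Q pts z.1 ∨ R z.2)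
    (add_nonneg hb hc) hP fun pts _ => h pts

theorem errorProb_le [CharZero K] [IsAlgClosed L] (hn : 1 ≤ n) (hα : 1 ≤ α) (hf : f.IsHomogeneous (n * α))
    {S : Finset K} (hS : S.Nonempty) :
    errorProb L f α S ≤ ((n * n * (n * α) + (n * n + n * α) : ℕ) : ℝ) / S.card := by
  have : Nonempty S := hS.to_subtype
  have hpts : prob (fun pts : Fin (n * n) → Fin n → S =>
      ∃ p ∈ LinearMap.range (lieAction f), p ≠ 0 ∧ ∀ k, eval (fun i => (pts k i : K)) p = 0) ≤
      ((n * n : ℕ) : ℝ) * (((n * α : ℕ) : ℝ) / S.card) := by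
    refine prob_exists_common_zero_le hS _ _ ((LinearMap.finrank_range_le _).trans ?_) ?_
    · simp [Module.finrank_matrix]
    · rintro _ ⟨x, rfl⟩
      exact (isHomogeneous_lieAction hf x).totalDegree_le
  have hgood : ∀ pts : Fin (n * n) → Fin n → S,
      ¬ (∃ p ∈ LinearMap.range (lieAction f), p ≠ 0 ∧
        ∀ k, eval (fun i => (pts k i : K)) p = 0) →
      ∀ x, (∀ k, eval (fun i => (pts k i : K)) (lieAction f x) = 0) → lieAction f x = 0 := by
    intro pts h x hx
    by_contra h0
    exact h ⟨_, ⟨x, rfl⟩, h0, hx⟩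
  have hcard : (0 : ℝ) < S.card := by exact_mod_cast hS.card_pos
  have herr : errorProb L f α S = prob fun ω : Coins S n =>
      ¬ IsCorrect f α ((runOn K L α (ω.map Subtype.val)).eval (blackBoxOf f)) := rfl
  have hsum : ((n * n * (n * α) + (n * n + n * α) : ℕ) : ℝ) / S.card =
      ((n * n : ℕ) : ℝ) * (((n * α : ℕ) : ℝ) / S.card) +
        (((n * n : ℕ) : ℝ) / S.card + ((n * α : ℕ) : ℝ) / S.card) := by
    push_cast
    ring
  rw [herr, hsum]
  by_cases hl : ∃ l : Fin n → Fin n → L, IsFactorization f α l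
  · obtain ⟨l, hl⟩ := hl
    classical
    -- The polynomial must be available for all points; for bad ones the constant 1 serves, since it
    -- never vanishes.
    have key : ∀ pts : Fin (n * n) → Fin n → S, ∃ q : MvPolynomial (Fin (n - 1)) L,
        q ≠ 0 ∧ q.totalDegree ≤ n * n ∧
        ((∀ x, (∀ k, eval (fun i => (pts k i : K)) (lieAction f x) = 0) → lieAction f x = 0) →
        ∀ t x, eval (fun k => algebraMap K L (t k)) q ≠ 0 → eval x f ≠ 0 →
        IsCorrect f α ((runOn K L α ⟨fun k i => pts k i, t, x⟩).eval (blackBoxOf f))) := by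
      intro pts
      by_cases h : ∀ x, (∀ k, eval (fun i => (pts k i : K)) (lieAction f x) = 0) →
          lieAction f x = 0
      · obtain ⟨q, hq0, hq, H⟩ := exists_isCorrect_of_isFactorization hn hα hf hl h
        exact ⟨q, hq0, hq, fun _ => H⟩
      · exact ⟨1, one_ne_zero, by simp, fun h' => absurd h' h⟩
    choose q hq0 hq H using key
    have hQ : ∀ pts, prob (fun t : Fin (n - 1) → S =>
        eval (fun k => algebraMap K L (t k)) (q pts) = 0) ≤ ((n * n : ℕ) : ℝ) / S.card :=
      fun pts => prob_eval_eq_zero_le (g := algebraMap K L) hS (algebraMap K L).injective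
        (hq0 pts) (hq pts)
    have hR : prob (fun x : Fin n → S => eval (fun k => (x k : K)) f = 0) ≤
        ((n * α : ℕ) : ℝ) / S.card :=
      prob_eval_eq_zero_le (g := fun x => x) hS Function.injective_id hl.ne_zero
        hf.totalDegree_le
    refine prob_coins_le _ _ _ (fun ω hω => ?_) (by positivity) (by positivity) hpts hQ hR
    by_contra h
    obtain ⟨h₁, h₂⟩ := not_or.1 h
    obtain ⟨h₂, h₃⟩ := not_or.1 h₂
    exact hω (H ω.pts (hgood _ h₁) _ _ h₂ h₃)
  -- Without a factorization, bad points in step 1 are the only source of error.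
  · refine prob_coins_le _ (fun _ _ => False) (fun _ => False) (fun ω hω => Or.inl ?_)
      (by positivity) (by positivity) hpts (fun _ => ?_) ?_
    · by_contra h
      exact hω (isCorrect_of_not_exists hn hα hf _ (hgood _ h) hl)
    · rw [prob_false fun _ => id]
      positivity
    · rw [prob_false fun _ => id]
      positivity

end LinFact

theorem mainTheorem10 :
    ∃ C c : ℕ, ∀ (K L : Type u) [Field K] [CharZero K] [Field L] [Algebra K L] [IsAlgClosure K L]
      (n α : ℕ) (_ : 1 ≤ n) (_ : 1 ≤ α)
      (f : MvPolynomial (Fin n) K) (_ : f.IsHomogeneous (n * α)),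
      (∀ ω : LinFact.Coins K n,
        LinFact.numCoins n + (LinFact.runOn K L α ω).time (LinFact.blackBoxOf f)
            ≤ C * (n + n * α) ^ c ∧
        (LinFact.runOn K L α ω).count (LinFact.blackBoxOf f) .eigenvalues ≤ 1 ∧
        (LinFact.runOn K L α ω).count (LinFact.blackBoxOf f) .root ≤ 1) ∧
      ∀ (ε : ℝ) (_ : 0 < ε) (S : Finset K), (C : ℝ) * (n + n * α) ^ c ≤ ε * S.card →
        LinFact.errorProb L f α S ≤ ε := by
  -- One polynomial bound dominates the sum of the running time, 1, and the numerator of the error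
  -- bound. The extra 1 will force `S` to be nonempty.
  obtain ⟨C, c, hC⟩ := (LinFact.isPolyBounded_cost.add
    (LinFact.IsPolyBounded.const 1)).add (((LinFact.IsPolyBounded.fst.mul .fst).mul
      (LinFact.IsPolyBounded.fst.mul .snd)).add
      ((LinFact.IsPolyBounded.fst.mul .fst).add (LinFact.IsPolyBounded.fst.mul .snd)))
  refine ⟨C, c, fun K L _ _ _ _ _ n α hn hα f hf => ⟨fun ω => ⟨?_, ?_, ?_⟩, ?_⟩⟩
  · have h := LinFact.cost_runOn_le (L := L) (LinFact.blackBoxOf f) (c := fun _ => 1) (W := 1)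
      (fun _ _ _ => le_rfl) α ω
    have := hC n α hn hα
    dsimp only at this
    rw [LinFact.Prog.time]
    omega
  -- With `W = 0` only the single charge for eigenvalues remains; the count of roots is obtained in
  -- the same way.
  · have h := LinFact.cost_runOn_le (L := L) (LinFact.blackBoxOf f)
      (c := fun j => if j = .eigenvalues then 1 else 0) (W := 0)
      (fun i h _ => by simp [h]) α ω
    simpa [LinFact.Prog.count] using h
  · have h := LinFact.cost_runOn_le (L := L) (LinFact.blackBoxOf f)
      (c := fun j => if j = .root then 1 else 0) (W := 0)
      (fun i _ h => by simp [h]) α ω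
    simpa [LinFact.Prog.count] using h
  · intro ε hε S hS
    have : IsAlgClosed L := IsAlgClosure.isAlgClosed K
    have hCn := hC n α hn hα
    dsimp only at hCn
    have hCn' : ((n * n * (n * α) + (n * n + n * α) : ℕ) : ℝ) + 1 ≤ C * (n + n * α) ^ c := by
      exact_mod_cast (show n * n * (n * α) + (n * n + n * α) + 1 ≤ C * (n + n * α) ^ c by omega)
    -- For empty `S` the right-hand side of `hS` would be 0, while its left-hand side is at least 1.
    have hpos : (0 : ℝ) < S.card := by
      by_contra h0
      have h1 := mul_nonpos_of_nonneg_of_nonpos hε.le (not_lt.1 h0)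
      have h2 : (0 : ℝ) ≤ ((n * n * (n * α) + (n * n + n * α) : ℕ) : ℝ) := Nat.cast_nonneg _
      linarith
    refine (LinFact.errorProb_le hn hα hf (Finset.card_pos.1 (by exact_mod_cast hpos))).trans ?_
    rw [div_le_iff₀ hpos]
    linarith
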